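/- Let $-\infty\le a<b\le\infty$, let $J\in\mathbb C^{n\times n}$ be constant, invertible and skew-Hermitian, and let $q,w$ be $n\times n$ matrices of distributions of order $0$ on $(a,b)$ (distributional derivatives $q=Q'$, $w=W'$ of functions of locally bounded variation, i.e. local matrix-valued measures $dQ$, $dW$), with $q$ Hermitian and $w$ non-negative. A function $u$ of locally bounded variation, with one-sided limits $u^\pm$, is called balanced if $u=(u^++u^-)/2$. Let $\mathcal L^2(w)$ be the space of functions with $\int f^*wf<\infty$, with semi-inner product $\langle f,g\rangle=\int f^*wg$, and let $L^2(w)$ be its quotient by the functions of norm zero. Let $\mathcal T_{\max}$ be the set of pairs $(u,f)\in\mathcal L^2(w)\times\mathcal L^2(w)$ such that $u$ is balanced, of locally bounded variation, and $Ju'+qu=wf$ on $(a,b)$, and let $T_{\max}=\{([u],[f]):(u,f)\in\mathcal T_{\max}\}\subset L^2(w)\times L^2(w)$, with norm $(\|[u]\|^2+\|[f]\|^2)^{1/2}$. Let $\mathcal L_0$ be the space of balanced functions $h$ of locally bounded variation with $Jh'+qh=0$ and $\|h\|=0$. Let $\Delta_q(x)=dQ(\{x\})$, $B_\pm(x,0)=J\pm\tfrac12\Delta_q(x)$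 and $\Xi_0=\{x\in(a,b):\det B_+(x,0)\det B_-(x,0)=0\}$. Let $(\tau_k)_{k\in\mathbb Z}$ be a strictly increasing sequence in $(a,b)$ with $\tau_k\to a$ as $k\to-\infty$ and $\tau_k\to b$ as $k\to\infty$, such that $\Xi_0\subset\{\tau_k:k\in\mathbb Z\}$ and $B_\pm(\tau_0,0)=J$. Put $N_0=\{h(\tau_0):h\in\mathcal L_0\}$ and, for $k\ge1$, $N_k=\{h^+(\tau_k):h\in\mathcal L_0,\ \operatorname{supp}h\subset[\tau_k,b)\}$ and $N_{-k}=\{h^-(\tau_{-k}):h\in\mathcal L_0,\ \operatorname{supp}h\subset(a,\tau_{-k}]\}$. A balanced function $v$ of locally bounded variation satisfies condition $(0)$ if $v(\tau_0)\perp N_0$, and, for $k\ge1$, condition $(\pm k)$ if $v^\pm(\tau_{\pm k})\perp N_{\pm k}$. For each $([u],[f])\in T_{\max}$ there is a unique balanced $v\in[u]$ with $(v,f)\in\mathcal T_{\max}$ that satisfies condition $(k)$ for every $k\in\mathbb Z$; put $E([u],[f])=v$. Theorem. Let $m\ge1$ and $I_m=(\tau_{-m},\tau_m)$, and let $\mathrm{BV}^\#(I_m)^n$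 be the space of balanced $\mathbb C^n$-valued functions of bounded variation on $I_m$, with the norm given by the sum of the variation over $I_m$ and $|u(\tau_0)|$. Then $E_m:T_{\max}\to\mathrm{BV}^\#(I_m)^n$, $E_m([u],[f])=E([u],[f])|_{I_m}$, is a (well-defined) bounded linear operator. -/

import Mathlib

open Set Filter Topology MeasureTheory
open scoped ComplexOrder

namespace BVSystem

/-- `ℂⁿ` with its Euclidean norm and inner product. -/
abbrev Cn (n : ℕ) := EuclideanSpace ℂ (Fin n)

/-- The open interval `(a, b)` of the real line, `-∞ ≤ a < b ≤ ∞`. -/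
def interval (a b : EReal) : Set ℝ := {x : ℝ | a < (x : EReal) ∧ (x : EReal) < b}

/-! ### Balanced functions of bounded variation -/

/-- `f` is balanced at `x`: the one-sided limits exist and `f x` is their mean. -/
def IsBalancedAt {X : Type*} [TopologicalSpace X] [Preorder X] {n : ℕ}
    (f : X → Cn n) (x : X) : Prop :=
  ∃ l r : Cn n, Tendsto f (𝓝[<] x) (𝓝 l) ∧ Tendsto f (𝓝[>] x) (𝓝 r) ∧ f x = (1 / 2 : ℂ) • (l + r)

/-- Balanced functions of locally bounded variation on `I`
(values outside `I` are irrelevant). -/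
def IsBVlocSharp {n : ℕ} (I : Set ℝ) (u : ℝ → Cn n) : Prop :=
  LocallyBoundedVariationOn u I ∧ ∀ x ∈ I, IsBalancedAt u x

theorem IsBalancedAt.add {X : Type*} [TopologicalSpace X] [Preorder X] {n : ℕ}
    {f g : X → Cn n} {x : X} (hf : IsBalancedAt f x) (hg : IsBalancedAt g x) :
    IsBalancedAt (f + g) x := by
  obtain ⟨l, r, h1, h2, h3⟩ := hf
  obtain ⟨l', r', h1', h2', h3'⟩ := hg
  refine ⟨l + l', r + r', h1.add h1', h2.add h2', ?_⟩
  rw [Pi.add_apply, h3, h3', ← smul_add]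
  congr 1
  abel

theorem IsBalancedAt.smul {X : Type*} [TopologicalSpace X] [Preorder X] {n : ℕ}
    {f : X → Cn n} {x : X} (c : ℂ) (hf : IsBalancedAt f x) :
    IsBalancedAt (c • f) x := by
  obtain ⟨l, r, h1, h2, h3⟩ := hf
  refine ⟨c • l, c • r, h1.const_smul c, h2.const_smul c, ?_⟩
  rw [Pi.smul_apply, h3, ← smul_add, smul_comm]

theorem IsBalancedAt.zero {X : Type*} [TopologicalSpace X] [Preorder X] {n : ℕ} (x : X) :
    IsBalancedAt (0 : X → Cn n) x :=
  ⟨0, 0, tendsto_const_nhds, tendsto_const_nhds, by simp⟩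

theorem eVariationOn_add_le {X : Type*} [LinearOrder X] {n : ℕ} (f g : X → Cn n) (s : Set X) :
    eVariationOn (f + g) s ≤ eVariationOn f s + eVariationOn g s := by
  refine iSup_le fun p => ?_
  calc ∑ i ∈ Finset.range p.1, edist ((f + g) (p.2.1 (i + 1))) ((f + g) (p.2.1 i))
      ≤ ∑ i ∈ Finset.range p.1, (edist (f (p.2.1 (i + 1))) (f (p.2.1 i))
          + edist (g (p.2.1 (i + 1))) (g (p.2.1 i))) :=
        Finset.sum_le_sum fun i _ => edist_add_add_le _ _ _ _
    _ = _ := Finset.sum_add_distrib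
    _ ≤ _ := add_le_add (eVariationOn.sum_le p.2.2.1 p.2.2.2)
        (eVariationOn.sum_le p.2.2.1 p.2.2.2)

theorem eVariationOn_smul {X : Type*} [LinearOrder X] {n : ℕ} (c : ℂ) (f : X → Cn n)
    (s : Set X) : eVariationOn (c • f) s = ‖c‖ₑ * eVariationOn f s := by
  unfold eVariationOn
  rw [ENNReal.mul_iSup]
  refine iSup_congr fun p => ?_
  rw [Finset.mul_sum]
  refine Finset.sum_congr rfl fun i _ => ?_
  rw [Pi.smul_apply, Pi.smul_apply, edist_smul₀, ENNReal.smul_def, smul_eq_mul]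
  rfl

theorem boundedVariationOn_add {X : Type*} [LinearOrder X] {n : ℕ} {f g : X → Cn n} {s : Set X}
    (hf : BoundedVariationOn f s) (hg : BoundedVariationOn g s) :
    BoundedVariationOn (f + g) s :=
  ne_top_of_le_ne_top (ENNReal.add_ne_top.2 ⟨hf, hg⟩) (eVariationOn_add_le f g s)

theorem boundedVariationOn_smul {X : Type*} [LinearOrder X] {n : ℕ} {f : X → Cn n} {s : Set X}
    (c : ℂ) (hf : BoundedVariationOn f s) : BoundedVariationOn (c • f) s := by
  unfold BoundedVariationOn
  rw [eVariationOn_smul]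
  exact ENNReal.mul_ne_top enorm_ne_top hf

theorem boundedVariationOn_zero {X : Type*} [LinearOrder X] {n : ℕ} (s : Set X) :
    BoundedVariationOn (0 : X → Cn n) s := by
  have h := eVariationOn_smul (0 : ℂ) (0 : X → Cn n) s
  rw [zero_smul, enorm_zero, zero_mul] at h
  unfold BoundedVariationOn
  rw [h]
  exact ENNReal.zero_ne_top

theorem IsBVlocSharp.add {n : ℕ} {I : Set ℝ} {u v : ℝ → Cn n}
    (hu : IsBVlocSharp I u) (hv : IsBVlocSharp I v) : IsBVlocSharp I (u + v) :=
  ⟨fun c d hc hd => boundedVariationOn_add (hu.1 c d hc hd) (hv.1 c d hc hd),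
    fun x hx => (hu.2 x hx).add (hv.2 x hx)⟩

theorem IsBVlocSharp.smul {n : ℕ} {I : Set ℝ} {u : ℝ → Cn n} (k : ℂ)
    (hu : IsBVlocSharp I u) : IsBVlocSharp I (k • u) :=
  ⟨fun c d hc hd => boundedVariationOn_smul k (hu.1 c d hc hd),
    fun x hx => (hu.2 x hx).smul k⟩

theorem IsBVlocSharp.zero {n : ℕ} (I : Set ℝ) : IsBVlocSharp I (0 : ℝ → Cn n) :=
  ⟨fun _ _ _ _ => boundedVariationOn_zero _, fun x _ => IsBalancedAt.zero x⟩

/-- The balanced functions of bounded variation on the open interval `(c, d)`, as a vector space. -/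
def bvSharp (n : ℕ) (c d : ℝ) : Submodule ℂ (Ioo c d → Cn n) where
  carrier := {f | BoundedVariationOn f univ ∧ ∀ x, IsBalancedAt f x}
  add_mem' hf hg := ⟨boundedVariationOn_add hf.1 hg.1, fun x => (hf.2 x).add (hg.2 x)⟩
  zero_mem' := ⟨boundedVariationOn_zero _, fun x => IsBalancedAt.zero x⟩
  smul_mem' k _ hf := ⟨boundedVariationOn_smul k hf.1, fun x => (hf.2 x).smul k⟩

/-- The normed space `BV^#((c, d))ⁿ`; its norm is the variation over `(c, d)` plus the
norm of the value at the point `x₀`. -/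
def BVSharp (n : ℕ) (c d : ℝ) (_x₀ : Ioo c d) : Type := ↥(bvSharp n c d)

namespace BVSharp

variable {n : ℕ} {c d : ℝ} {x₀ : Ioo c d}

instance : AddCommGroup (BVSharp n c d x₀) := inferInstanceAs (AddCommGroup ↥(bvSharp n c d))

instance : Module ℂ (BVSharp n c d x₀) := inferInstanceAs (Module ℂ ↥(bvSharp n c d))

/-- The underlying function on `(c, d)`. -/
def toFun (f : BVSharp n c d x₀) : Ioo c d → Cn n := Subtype.val (p := (· ∈ bvSharp n c d)) f

noncomputable instance : Norm (BVSharp n c d x₀) :=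
  ⟨fun f => (eVariationOn f.toFun univ).toReal + ‖f.toFun x₀‖⟩

theorem normCore : NormedSpace.Core ℂ (BVSharp n c d x₀) where
  norm_nonneg f := by
    change 0 ≤ (eVariationOn f.toFun univ).toReal + ‖f.toFun x₀‖
    positivity
  norm_smul k f := by
    change (eVariationOn (k • f.toFun) univ).toReal + ‖k • f.toFun x₀‖
      = ‖k‖ * ((eVariationOn f.toFun univ).toReal + ‖f.toFun x₀‖)
    rw [eVariationOn_smul, ENNReal.toReal_mul, norm_smul, toReal_enorm]
    ring
  norm_triangle f g := by
    change (eVariationOn (f.toFun + g.toFun) univ).toReal + ‖f.toFun x₀ + g.toFun x₀‖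
      ≤ ((eVariationOn f.toFun univ).toReal + ‖f.toFun x₀‖)
        + ((eVariationOn g.toFun univ).toReal + ‖g.toFun x₀‖)
    have hf : eVariationOn f.toFun univ ≠ ⊤ := f.2.1
    have hg : eVariationOn g.toFun univ ≠ ⊤ := g.2.1
    have h := ENNReal.toReal_mono (ENNReal.add_ne_top.2 ⟨hf, hg⟩)
      (eVariationOn_add_le f.toFun g.toFun univ)
    rw [ENNReal.toReal_add hf hg] at h
    linarith [norm_add_le (f.toFun x₀) (g.toFun x₀)]
  norm_eq_zero_iff f := by
    change (eVariationOn f.toFun univ).toReal + ‖f.toFun x₀‖ = 0 ↔ f = 0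
    constructor
    · intro h
      have h1 : (eVariationOn f.toFun univ).toReal = 0 := by
        linarith [norm_nonneg (f.toFun x₀),
          ENNReal.toReal_nonneg (a := eVariationOn f.toFun univ)]
      have h2 : ‖f.toFun x₀‖ = 0 := by linarith
      have hf : eVariationOn f.toFun univ ≠ ⊤ := f.2.1
      have h3 : eVariationOn f.toFun univ = 0 :=
        ((ENNReal.toReal_eq_zero_iff _).1 h1).resolve_right hf
      refine Subtype.ext (funext fun x => ?_)
      have h4 := (eVariationOn.eq_zero_iff _).1 h3 x (mem_univ _) x₀ (mem_univ _)
      rw [edist_eq_zero] at h4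
      exact h4.trans (norm_eq_zero.1 h2)
    · rintro rfl
      have h1 : eVariationOn (toFun (0 : BVSharp n c d x₀)) univ = 0 :=
        (eVariationOn.eq_zero_iff _).2 fun x _ y _ => edist_self (0 : Cn n)
      have h2 : toFun (0 : BVSharp n c d x₀) x₀ = 0 := rfl
      rw [h1, h2]
      simp

noncomputable instance : NormedAddCommGroup (BVSharp n c d x₀) := NormedAddCommGroup.ofCore normCore

noncomputable instance : NormedSpace ℂ (BVSharp n c d x₀) := NormedSpace.ofCore normCore

end BVSharp

/-! ### Distributions of order zero

A matrix of distributions of order `0` on `I` is the distributional derivative of a matrix function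
`F` whose entries are of locally bounded variation.  It is the same thing as the local
(Lebesgue-Stieltjes) measure `dF`, which satisfies `dF([c, d)) = F⁻(d) - F⁻(c)`. -/

/-- The entrywise left-hand limit. -/
noncomputable def leftLimM {n : ℕ} (F : ℝ → Matrix (Fin n) (Fin n) ℂ) (x : ℝ) :
    Matrix (Fin n) (Fin n) ℂ :=
  Matrix.of fun i j => Function.leftLim (fun y => F y i j) x

/-- The entrywise right-hand limit. -/
noncomputable def rightLimM {n : ℕ} (F : ℝ → Matrix (Fin n) (Fin n) ℂ) (x : ℝ) :
    Matrix (Fin n) (Fin n) ℂ :=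
  Matrix.of fun i j => Function.rightLim (fun y => F y i j) x

/-- The mass `dF({x}) = F⁺(x) - F⁻(x)` of the distributional derivative of `F` at `x`. -/
noncomputable def jump {n : ℕ} (F : ℝ → Matrix (Fin n) (Fin n) ℂ) (x : ℝ) :
    Matrix (Fin n) (Fin n) ℂ :=
  rightLimM F x - leftLimM F x

/-- A matrix-valued local measure on `I`, written as a density with respect to a
positive measure which is finite on compact subintervals of `I`. -/
structure MatrixMeasure (n : ℕ) (I : Set ℝ) where
  base : Measure ℝ
  density : ℝ → Matrix (Fin n) (Fin n) ℂ
  measurable_density : ∀ i j, Measurable fun x => density x i j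
  base_Icc_lt_top : ∀ c ∈ I, ∀ d ∈ I, base (Icc c d) < ⊤
  integrableOn_density : ∀ c ∈ I, ∀ d ∈ I, ∀ i j,
    IntegrableOn (fun x => density x i j) (Icc c d) base

/-- A matrix-valued local measure with a density which is positive semidefinite. -/
structure PosMatrixMeasure (n : ℕ) (I : Set ℝ) extends MatrixMeasure n I where
  posSemidef : ∀ x, (density x).PosSemidef

/-- `M` is the local measure `dF` generated by `F`. -/
def MatrixMeasure.IsGeneratedBy {n : ℕ} {I : Set ℝ} (M : MatrixMeasure n I)
    (F : ℝ → Matrix (Fin n) (Fin n) ℂ) : Prop :=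
  ∀ c ∈ I, ∀ d ∈ I, c < d → ∀ i j,
    (leftLimM F d - leftLimM F c) i j = ∫ x in Ico c d, M.density x i j ∂M.base

/-- The zero measure. -/
noncomputable def PosMatrixMeasure.zero (n : ℕ) (I : Set ℝ) : PosMatrixMeasure n I where
  base := 0
  density := 0
  measurable_density _ _ := measurable_const
  base_Icc_lt_top _ _ _ _ := by simp
  integrableOn_density _ _ _ _ _ _ := by simp [IntegrableOn]
  posSemidef _ := Matrix.PosSemidef.zero

open Classical in
/-- The local measure `dF` on `I` generated by `F` (which exists, by the Radon-Nikodym theorem, when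
the entries of `F` are of locally bounded variation on `I`; nothing below depends on the choice of
the base measure). -/
noncomputable def dMeasure {n : ℕ} (I : Set ℝ) (F : ℝ → Matrix (Fin n) (Fin n) ℂ) :
    MatrixMeasure n I :=
  if h : ∃ M : MatrixMeasure n I, M.IsGeneratedBy F then h.choose
  else (PosMatrixMeasure.zero n I).toMatrixMeasure

open Classical in
/-- The local measure `dF` on `I` generated by `F`, for an `F` of locally bounded variation with
non-negative derivative; it then has a positive semidefinite density. -/
noncomputable def dMeasurePos {n : ℕ} (I : Set ℝ) (F : ℝ → Matrix (Fin n) (Fin n) ℂ) :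
    PosMatrixMeasure n I :=
  if h : ∃ M : PosMatrixMeasure n I, M.toMatrixMeasure.IsGeneratedBy F then h.choose
  else PosMatrixMeasure.zero n I

/-- The entries of `F` are of locally bounded variation on `I`, i.e. `F'` is a matrix of
distributions of order `0`. -/
def IsBVlocM {n : ℕ} (I : Set ℝ) (F : ℝ → Matrix (Fin n) (Fin n) ℂ) : Prop :=
  ∀ i j, LocallyBoundedVariationOn (fun x => F x i j) I

/-- The distribution `F'` is Hermitian, i.e. the measure `dF` has Hermitian values. -/
def HasHermitianDeriv {n : ℕ} (I : Set ℝ) (F : ℝ → Matrix (Fin n) (Fin n) ℂ) : Prop :=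
  ∀ c ∈ I, ∀ d ∈ I, c < d → (leftLimM F d - leftLimM F c).IsHermitian

/-- The distribution `F'` is non-negative, i.e. the measure `dF` has positive semidefinite
values. -/
def HasNonnegDeriv {n : ℕ} (I : Set ℝ) (F : ℝ → Matrix (Fin n) (Fin n) ℂ) : Prop :=
  ∀ c ∈ I, ∀ d ∈ I, c < d → (leftLimM F d - leftLimM F c).PosSemidef

/-- The vector-valued density `A(x) u(x)` of the distribution `q u`, where `q = A · base`. -/
noncomputable def MatrixMeasure.act {n : ℕ} {I : Set ℝ} (M : MatrixMeasure n I) (u : ℝ → Cn n)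
    (x : ℝ) : Cn n :=
  Matrix.toEuclideanLin (M.density x) (u x)

/-! ### The space `L²(w)` -/

section LTwo

variable {n : ℕ} {I : Set ℝ} (w : PosMatrixMeasure n I)

/-- The density of `f* w g` with respect to the base measure of `w`. -/
noncomputable def PosMatrixMeasure.form (f g : ℝ → Cn n) (x : ℝ) : ℂ :=
  inner ℂ (f x) (w.act g x)

open scoped MatrixOrder Matrix.Norms.L2Operator in
theorem PosMatrixMeasure.exists_factor (x : ℝ) : ∃ C : Matrix (Fin n) (Fin n) ℂ,
    ∀ f g : ℝ → Cn n, w.form f g x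
      = inner ℂ (Matrix.toEuclideanLin C (f x)) (Matrix.toEuclideanLin C (g x)) := by
  obtain ⟨C, hC⟩ := CStarAlgebra.nonneg_iff_eq_star_mul_self.1 (w.posSemidef x).nonneg
  refine ⟨C, fun f g => ?_⟩
  rw [PosMatrixMeasure.form, MatrixMeasure.act, hC, Matrix.star_eq_conjTranspose, ← LinearMap.adjoint_inner_right,
    ← Matrix.toEuclideanLin_conjTranspose_eq_adjoint]
  congr 1
  simp

theorem PosMatrixMeasure.aestronglyMeasurable_form {f g : ℝ → Cn n}
    (hf : AEStronglyMeasurable f (w.base.restrict I))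
    (hg : AEStronglyMeasurable g (w.base.restrict I)) :
    AEStronglyMeasurable (w.form f g) (w.base.restrict I) := by
  have hc : ∀ i, AEStronglyMeasurable (fun x => g x i) (w.base.restrict I) := fun i =>
    (EuclideanSpace.proj (𝕜 := ℂ) i).continuous.comp_aestronglyMeasurable hg
  have h : w.form f g = fun x => inner ℂ (f x) (w.act g x) := rfl
  rw [h]
  refine hf.inner ?_
  have h2 : w.act g = fun x => WithLp.toLp 2 (fun i => ∑ j, w.density x i j * g x j) := by
    funext x
    rfl
  rw [h2]
  refine (PiLp.continuous_toLp 2 _).comp_aestronglyMeasurable ?_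
  refine (aemeasurable_pi_lambda _ fun i => ?_).aestronglyMeasurable
  exact Finset.aemeasurable_fun_sum _ fun j _ =>
    (w.measurable_density i j).aemeasurable.mul (hc j).aemeasurable

theorem PosMatrixMeasure.integrable_form {f g : ℝ → Cn n}
    (hf : AEStronglyMeasurable f (w.base.restrict I))
    (hg : AEStronglyMeasurable g (w.base.restrict I))
    (hff : Integrable (w.form f f) (w.base.restrict I))
    (hgg : Integrable (w.form g g) (w.base.restrict I)) :
    Integrable (w.form f g) (w.base.restrict I) := by
  refine (hff.norm.add hgg.norm).mono' (w.aestronglyMeasurable_form hf hg)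
    (Eventually.of_forall fun x => ?_)
  obtain ⟨C, hC⟩ := w.exists_factor x
  rw [Pi.add_apply, hC, hC, hC]
  have h1 := norm_inner_le_norm (𝕜 := ℂ) (Matrix.toEuclideanLin C (f x))
    (Matrix.toEuclideanLin C (g x))
  rw [inner_self_eq_norm_sq_to_K, inner_self_eq_norm_sq_to_K, norm_pow, norm_pow]
  simp only [RCLike.norm_ofReal, abs_norm]
  nlinarith [sq_nonneg (‖Matrix.toEuclideanLin C (f x)‖ - ‖Matrix.toEuclideanLin C (g x)‖),
    sq_nonneg (‖Matrix.toEuclideanLin C (f x)‖), sq_nonneg (‖Matrix.toEuclideanLin C (g x)‖)]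

theorem PosMatrixMeasure.form_add_left (f g h : ℝ → Cn n) :
    w.form (f + g) h = w.form f h + w.form g h := by
  funext x
  simp [PosMatrixMeasure.form]

theorem PosMatrixMeasure.form_add_right (f g h : ℝ → Cn n) :
    w.form f (g + h) = w.form f g + w.form f h := by
  funext x
  simp [PosMatrixMeasure.form, MatrixMeasure.act]

theorem PosMatrixMeasure.form_smul_left (c : ℂ) (f g : ℝ → Cn n) :
    w.form (c • f) g = (starRingEnd ℂ c) • w.form f g := by
  funext x
  simp [PosMatrixMeasure.form, mul_comm]

theorem PosMatrixMeasure.form_smul_right (c : ℂ) (f g : ℝ → Cn n) :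
    w.form f (c • g) = c • w.form f g := by
  funext x
  simp [PosMatrixMeasure.form, MatrixMeasure.act]

/-- The functions `f` with `∫ f* w f < ∞`, as a vector space. -/
def sqIntegrable : Submodule ℂ (ℝ → Cn n) where
  carrier := {f | AEStronglyMeasurable f (w.base.restrict I) ∧
    Integrable (w.form f f) (w.base.restrict I)}
  add_mem' {f g} hf hg := by
    refine ⟨hf.1.add hg.1, ?_⟩
    rw [w.form_add_left, w.form_add_right, w.form_add_right]
    exact (hf.2.add (w.integrable_form hf.1 hg.1 hf.2 hg.2)).add
      ((w.integrable_form hg.1 hf.1 hg.2 hf.2).add hg.2)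
  zero_mem' := by
    refine ⟨aestronglyMeasurable_const, ?_⟩
    have h : w.form 0 0 = 0 := by
      funext x
      simp [PosMatrixMeasure.form]
    rw [h]
    exact integrable_zero _ _ _
  smul_mem' c f hf := by
    refine ⟨hf.1.const_smul c, ?_⟩
    rw [w.form_smul_left, w.form_smul_right]
    exact (hf.2.smul c).smul _

/-- `𝓛²(w)`, a space of functions with the semi-inner product `⟨f, g⟩ = ∫ f* w g`
(only the values on `I` matter). -/
def CalL2 : Type := ↥(sqIntegrable w)

namespace CalL2

variable {w}

instance : AddCommGroup (CalL2 w) := inferInstanceAs (AddCommGroup ↥(sqIntegrable w))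

instance : Module ℂ (CalL2 w) := inferInstanceAs (Module ℂ ↥(sqIntegrable w))

/-- The element of `𝓛²(w)` given by a function. -/
def mk (f : ℝ → Cn n) (hf : f ∈ sqIntegrable w) : CalL2 w := ⟨f, hf⟩

/-- The underlying function. -/
def toFun (f : CalL2 w) : ℝ → Cn n := Subtype.val (p := (· ∈ sqIntegrable w)) f

theorem integrable_form (f g : CalL2 w) :
    Integrable (w.form f.toFun g.toFun) (w.base.restrict I) :=
  w.integrable_form f.2.1 g.2.1 f.2.2 g.2.2

/-- The semi-inner product `⟨f, g⟩ = ∫ f* w g`. -/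
@[reducible]
noncomputable def preCore : PreInnerProductSpace.Core ℂ (CalL2 w) where
  inner f g := ∫ x in I, w.form f.toFun g.toFun x ∂w.base
  conj_inner_symm f g := by
    change starRingEnd ℂ (∫ x in I, w.form g.toFun f.toFun x ∂w.base)
      = ∫ x in I, w.form f.toFun g.toFun x ∂w.base
    rw [← integral_conj]
    congr 1
    funext x
    obtain ⟨C, hC⟩ := w.exists_factor x
    rw [hC, hC, inner_conj_symm]
  re_inner_nonneg f := by
    rw [← integral_re (integrable_form f f)]
    refine integral_nonneg fun x => ?_
    obtain ⟨C, hC⟩ := w.exists_factor x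
    change 0 ≤ RCLike.re (w.form f.toFun f.toFun x)
    rw [hC]
    exact inner_self_nonneg
  add_left f g h := by
    change ∫ x in I, w.form (f.toFun + g.toFun) h.toFun x ∂w.base
      = (∫ x in I, w.form f.toFun h.toFun x ∂w.base) + ∫ x in I, w.form g.toFun h.toFun x ∂w.base
    rw [w.form_add_left]
    exact integral_add (integrable_form f h) (integrable_form g h)
  smul_left f g c := by
    change ∫ x in I, w.form (c • f.toFun) g.toFun x ∂w.base
      = starRingEnd ℂ c * ∫ x in I, w.form f.toFun g.toFun x ∂w.base
    rw [w.form_smul_left]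
    exact integral_smul (starRingEnd ℂ c) (w.form f.toFun g.toFun)

noncomputable instance : SeminormedAddCommGroup (CalL2 w) :=
  InnerProductSpace.Core.toSeminormedAddCommGroup (c := preCore)

noncomputable instance : InnerProductSpace ℂ (CalL2 w) := InnerProductSpace.ofCore preCore

end CalL2

/-- The Hilbert space `L²(w)`: the quotient of `𝓛²(w)` by the functions of norm zero. -/
abbrev L2 : Type := SeparationQuotient (CalL2 w)

variable {w}

/-- The class `[f]` of an element of `𝓛²(w)`. -/
noncomputable def cls (f : CalL2 w) : L2 w := SeparationQuotient.mk f

end LTwo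

/-! ### The differential equation and the maximal relation -/

section Relation

variable {n : ℕ} {I : Set ℝ} (J : Matrix (Fin n) (Fin n) ℂ) (q : MatrixMeasure n I)
  (w : PosMatrixMeasure n I)

/-- `J u' + q u = w f` on `I`, as an identity between distributions of order `0`, i.e. between
local measures (`u'` is the measure with `u'([c, d)) = u⁻(d) - u⁻(c)`). -/
def IsSolution (u f : ℝ → Cn n) : Prop :=
  ∀ c ∈ I, ∀ d ∈ I, c < d →
    IntegrableOn (q.act u) (Ico c d) q.base ∧
    IntegrableOn (w.act f) (Ico c d) w.base ∧
    Matrix.toEuclideanLin J (Function.leftLim u d - Function.leftLim u c)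
      + ∫ x in Ico c d, q.act u x ∂q.base = ∫ x in Ico c d, w.act f x ∂w.base

theorem IsBVlocSharp.leftLim_add {u v : ℝ → Cn n} (hu : IsBVlocSharp I u) (hv : IsBVlocSharp I v)
    {x : ℝ} (hx : x ∈ I) :
    Function.leftLim (u + v) x = Function.leftLim u x + Function.leftLim v x := by
  obtain ⟨l, r, h1, -, -⟩ := hu.2 x hx
  obtain ⟨l', r', h1', -, -⟩ := hv.2 x hx
  have h2 : Tendsto (u + v) (𝓝[<] x) (𝓝 (l + l')) := h1.add h1'
  rw [leftLim_eq_of_tendsto h1, leftLim_eq_of_tendsto h1', leftLim_eq_of_tendsto h2]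

theorem IsBVlocSharp.leftLim_smul {u : ℝ → Cn n} (k : ℂ) (hu : IsBVlocSharp I u)
    {x : ℝ} (hx : x ∈ I) :
    Function.leftLim (k • u) x = k • Function.leftLim u x := by
  obtain ⟨l, r, h1, -, -⟩ := hu.2 x hx
  have h2 : Tendsto (k • u) (𝓝[<] x) (𝓝 (k • l)) := h1.const_smul k
  rw [leftLim_eq_of_tendsto h1, leftLim_eq_of_tendsto h2]

theorem MatrixMeasure.act_add (M : MatrixMeasure n I) (u v : ℝ → Cn n) :
    M.act (u + v) = M.act u + M.act v := by
  funext x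
  simp [MatrixMeasure.act]

theorem MatrixMeasure.act_smul (M : MatrixMeasure n I) (k : ℂ) (u : ℝ → Cn n) :
    M.act (k • u) = k • M.act u := by
  funext x
  simp [MatrixMeasure.act]

theorem MatrixMeasure.act_zero (M : MatrixMeasure n I) :
    M.act (0 : ℝ → Cn n) = 0 := by
  funext x
  simp [MatrixMeasure.act]

variable {J q w}

theorem IsSolution.add {u v f g : ℝ → Cn n} (hu : IsBVlocSharp I u) (hv : IsBVlocSharp I v)
    (h : IsSolution J q w u f) (h' : IsSolution J q w v g) :
    IsSolution J q w (u + v) (f + g) := by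
  intro c hc d hd hcd
  obtain ⟨h1, h2, h3⟩ := h c hc d hd hcd
  obtain ⟨h1', h2', h3'⟩ := h' c hc d hd hcd
  rw [MatrixMeasure.act_add, MatrixMeasure.act_add]
  refine ⟨h1.add h1', h2.add h2', ?_⟩
  simp only [Pi.add_apply]
  rw [integral_add h1 h1', integral_add h2 h2', ← h3, ← h3', hu.leftLim_add hv hc,
    hu.leftLim_add hv hd]
  simp only [map_add, map_sub]
  abel

theorem IsSolution.smul {u f : ℝ → Cn n} (k : ℂ) (hu : IsBVlocSharp I u)
    (h : IsSolution J q w u f) : IsSolution J q w (k • u) (k • f) := by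
  intro c hc d hd hcd
  obtain ⟨h1, h2, h3⟩ := h c hc d hd hcd
  rw [MatrixMeasure.act_smul, MatrixMeasure.act_smul]
  refine ⟨h1.smul k, h2.smul k, ?_⟩
  simp only [Pi.smul_apply]
  rw [integral_smul, integral_smul, ← h3, hu.leftLim_smul k hc, hu.leftLim_smul k hd,
    ← smul_sub, map_smul, smul_add]

theorem IsSolution.zero : IsSolution J q w 0 0 := by
  intro c hc d hd hcd
  have hl : ∀ x : ℝ, Function.leftLim (0 : ℝ → Cn n) x = 0 := fun x =>
    leftLim_eq_of_tendsto tendsto_const_nhds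
  rw [MatrixMeasure.act_zero, MatrixMeasure.act_zero, hl, hl]
  refine ⟨integrableOn_zero, integrableOn_zero, ?_⟩
  simp

variable (J q w)

/-- The pairs `(u, f)` of elements of `𝓛²(w)` such that `u` is balanced and of locally bounded
variation and `J u' + q u = w f`. -/
def calTmax : Submodule ℂ (CalL2 w × CalL2 w) where
  carrier := {p | IsBVlocSharp I p.1.toFun ∧ IsSolution J q w p.1.toFun p.2.toFun}
  add_mem' hp hp' := ⟨hp.1.add hp'.1, hp.2.add hp.1 hp'.1 hp'.2⟩
  zero_mem' := ⟨IsBVlocSharp.zero I, IsSolution.zero⟩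
  smul_mem' k _ hp := ⟨hp.1.smul k, hp.2.smul k hp.1⟩

/-- The maximal relation, a subspace of the Hilbert space `L²(w) × L²(w)`, with the norm
`(‖[u]‖² + ‖[f]‖²)^{1/2}`. -/
def Tmax : Submodule ℂ (WithLp 2 (L2 w × L2 w)) where
  carrier := {p | ∃ t ∈ calTmax J q w, cls t.1 = p.fst ∧ cls t.2 = p.snd}
  add_mem' := by
    rintro p p' ⟨t, ht, h1, h2⟩ ⟨t', ht', h1', h2'⟩
    refine ⟨t + t', add_mem ht ht', ?_, ?_⟩
    · rw [WithLp.add_fst, ← h1, ← h1']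
      rfl
    · rw [WithLp.add_snd, ← h2, ← h2']
      rfl
  zero_mem' := ⟨0, zero_mem _, rfl, rfl⟩
  smul_mem' := by
    rintro k p ⟨t, ht, h1, h2⟩
    refine ⟨k • t, Submodule.smul_mem _ k ht, ?_, ?_⟩
    · rw [WithLp.smul_fst, ← h1]
      rfl
    · rw [WithLp.smul_snd, ← h2]
      rfl

/-! ### Distinguished representatives -/

/-- The space `𝓛₀` of solutions of `J u' + q u = 0` of norm zero. -/
def L0 : Set (ℝ → Cn n) :=
  {h | IsBVlocSharp I h ∧ IsSolution J q w h 0 ∧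
    ∃ hh : h ∈ sqIntegrable w, ‖CalL2.mk h hh‖ = 0}

/-- The value at `τ₀` for `k = 0`, the right-hand limit at `τ_k` for `k > 0` and the left-hand limit
at `τ_k` for `k < 0`. -/
noncomputable def valueAt (τ : ℤ → ℝ) (k : ℤ) (u : ℝ → Cn n) : Cn n :=
  if k = 0 then u (τ 0) else if 0 < k then Function.rightLim u (τ k)
    else Function.leftLim u (τ k)

/-- The subspace `N_k` of `ℂⁿ`: the values at `τ_k`, in the sense of `valueAt`, of the `h ∈ 𝓛₀` which
(for `k > 0`) are supported in `[τ_k, b)` or (for `k < 0`) are supported in `(a, τ_k]`. -/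
def N (τ : ℤ → ℝ) (k : ℤ) : Set (Cn n) :=
  {y | ∃ h ∈ L0 J q w, (0 < k → ∀ x ∈ I, x < τ k → h x = 0) ∧
    (k < 0 → ∀ x ∈ I, τ k < x → h x = 0) ∧ valueAt τ k h = y}

/-- Condition `(k)`: the value of `u` at `τ_k`, in the sense of `valueAt`, is orthogonal to `N_k`. -/
def Condition (τ : ℤ → ℝ) (k : ℤ) (u : ℝ → Cn n) : Prop :=
  ∀ y ∈ N J q w τ k, inner ℂ y (valueAt τ k u) = 0

variable {J q w}

/-- `v` is a distinguished representative of `p = ([u], [f])`: it is a balanced function in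
the class `[u]` with `J v' + q v = w f` and satisfies condition `(k)` for every `k`. -/
def IsDistinguished (τ : ℤ → ℝ) (p : Tmax J q w) (v : ℝ → Cn n) : Prop :=
  (∃ t ∈ calTmax J q w, cls t.1 = p.1.fst ∧ cls t.2 = p.1.snd ∧ t.1.toFun = v) ∧
    ∀ k : ℤ, Condition J q w τ k v

end Relation

/-- The matrix `B_±(x, 0) = J ± Δ_q(x) / 2` for the sign `s = ±1`, where `q = Q'`. -/
noncomputable def Bmat {n : ℕ} (J : Matrix (Fin n) (Fin n) ℂ)
    (Q : ℝ → Matrix (Fin n) (Fin n) ℂ) (s : ℂ) (x : ℝ) : Matrix (Fin n) (Fin n) ℂ :=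
  J + (s / 2) • jump Q x

end BVSystem

namespace BVSystem

/-! ### One-sided limits of balanced functions -/

/-! A balanced function is described by its scalar data: the components of its value and of its two
one-sided limits at every point of the interval. The proof works in the space of finitely supported
linear functionals of these data, with two subspaces: `boundedFunctionals`, the functionals bounded
by the graph seminorm on `calTmax`, and `conditionFunctionals`, spanned by u ↦ ⟨z, u(τ_k)⟩ (in the
sense of `valueAt`) with z ∈ N_k. Everything follows from these being complementary
(`isCompl_functionals`).

Granted this, write the evaluation of a single datum as φ + ψ with φ bounded and ψ a condition
functional. If (u, f) satisfies all conditions, ψ vanishes on u, so the evaluation is bounded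
(`exists_data_bound`). Since J is invertible and q has little mass near a point once the point
itself is removed, finitely many data together with ‖f‖ control u uniformly on a compact interval
(`exists_sideVal_le`), and the equation then controls the variation (`exists_eVariationOn_le`). For
the existence of representatives, take the linear form which is zero on the first subspace and
evaluation at u on the second: it is given by the data of some h ∈ 𝓛₀, and u - h satisfies the
conditions (`exists_sub_condition`). Neither completeness of L²(w) nor the closed graph theorem
enters.

The two subspaces meet in zero (`disjoint_functionals`) because a bounded functional kills 𝓛₀,
whereas the outermost term of a nonzero combination of conditions is detected by an element of 𝓛₀
supported from τ_k outwards. They span (`codisjoint_functionals`) because a form killing both is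
itself a family of data y. By Hahn-Banach, y is approximated at finitely many indices by elements of
`calTmax` of small norm; the local bounds make this uniform on compact intervals, so y is the data
of some h ∈ 𝓛₀ (`exists_mem_L0_of_annihilates`). This h satisfies every condition, hence vanishes
(`eq_zero_of_forall_condition`).

That last uniqueness statement, which also makes E well defined and linear, propagates zeros
outwards from τ_0. There are no singular points strictly between consecutive τ_k. Once h vanishes up
to τ_{k+1}, its truncation to [τ_{k+1}, b) is still in 𝓛₀, so the right-hand limit there lies in
N_{k+1} and is orthogonal to itself. The left side is symmetric. -/

/-- The left-hand limit, the value or the right-hand limit, according to the sign. -/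
noncomputable def sideVal {n : ℕ} (s : SignType) (u : ℝ → Cn n) (x : ℝ) : Cn n :=
  match s with
  | .neg => Function.leftLim u x
  | .zero => u x
  | .pos => Function.rightLim u x

theorem valueAt_eq_sideVal {n : ℕ} (τ : ℤ → ℝ) (k : ℤ) (u : ℝ → Cn n) :
    valueAt τ k u = sideVal (SignType.sign k) u (τ k) := by
  rcases lt_trichotomy k 0 with h | h | h
  · rw [sign_neg h, valueAt, if_neg h.ne, if_neg h.not_gt]
    rfl
  · subst h
    rw [sign_zero, valueAt, if_pos rfl]
    rfl
  · rw [sign_pos h, valueAt, if_neg h.ne', if_pos h]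
    rfl

section Sides

variable {n : ℕ} {I : Set ℝ} {u v : ℝ → Cn n} {x : ℝ}

theorem IsBalancedAt.tendsto_left (hu : IsBalancedAt u x) :
    Tendsto u (𝓝[<] x) (𝓝 (Function.leftLim u x)) := by
  obtain ⟨l, -, h, -⟩ := hu
  exact tendsto_leftLim_of_tendsto ⟨l, h⟩

theorem IsBalancedAt.tendsto_right (hu : IsBalancedAt u x) :
    Tendsto u (𝓝[>] x) (𝓝 (Function.rightLim u x)) := by
  obtain ⟨-, r, -, h, -⟩ := hu
  exact tendsto_rightLim_of_tendsto ⟨r, h⟩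

theorem IsBalancedAt.eq_half (hu : IsBalancedAt u x) :
    u x = (1 / 2 : ℂ) • (Function.leftLim u x + Function.rightLim u x) := by
  obtain ⟨l, r, h1, h2, h3⟩ := hu
  rw [leftLim_eq_of_tendsto h1, rightLim_eq_of_tendsto h2, h3]

theorem IsBalancedAt.norm_le (hu : IsBalancedAt u x) {A : ℝ}
    (h1 : ‖Function.leftLim u x‖ ≤ A) (h2 : ‖Function.rightLim u x‖ ≤ A) : ‖u x‖ ≤ A := by
  rw [hu.eq_half, norm_smul]
  have := norm_add_le (Function.leftLim u x) (Function.rightLim u x)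
  norm_num
  linarith

theorem IsBalancedAt.sideVal_add (hu : IsBalancedAt u x) (hv : IsBalancedAt v x) (s : SignType) :
    sideVal s (u + v) x = sideVal s u x + sideVal s v x := by
  cases s
  · rfl
  · exact leftLim_eq_of_tendsto (hu.tendsto_left.add hv.tendsto_left)
  · exact rightLim_eq_of_tendsto (hu.tendsto_right.add hv.tendsto_right)

theorem IsBalancedAt.sideVal_smul (hu : IsBalancedAt u x) (c : ℂ) (s : SignType) :
    sideVal s (c • u) x = c • sideVal s u x := by
  cases s
  · rfl
  · exact leftLim_eq_of_tendsto (hu.tendsto_left.const_smul c)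
  · exact rightLim_eq_of_tendsto (hu.tendsto_right.const_smul c)

theorem IsBalancedAt.sideVal_sub (hu : IsBalancedAt u x) (hv : IsBalancedAt v x) (s : SignType) :
    sideVal s (u - v) x = sideVal s u x - sideVal s v x := by
  cases s
  · rfl
  · exact leftLim_eq_of_tendsto (hu.tendsto_left.sub hv.tendsto_left)
  · exact rightLim_eq_of_tendsto (hu.tendsto_right.sub hv.tendsto_right)

/-- The one-sided limits of `u` at `x` are determined by the values of `u` close to `x`. -/
theorem sideVal_congr_nhds (h : u =ᶠ[𝓝 x] v) (s : SignType) (hv : IsBalancedAt v x) :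
    sideVal s u x = sideVal s v x := by
  cases s
  · exact h.eq_of_nhds
  · exact leftLim_eq_of_tendsto (hv.tendsto_left.congr' (h.symm.filter_mono nhdsWithin_le_nhds))
  · exact rightLim_eq_of_tendsto (hv.tendsto_right.congr' (h.symm.filter_mono nhdsWithin_le_nhds))

theorem IsBalancedAt.congr_nhds (hv : IsBalancedAt v x) (h : u =ᶠ[𝓝 x] v) : IsBalancedAt u x := by
  obtain ⟨l, r, h1, h2, h3⟩ := hv
  exact ⟨l, r, h1.congr' (h.symm.filter_mono nhdsWithin_le_nhds),
    h2.congr' (h.symm.filter_mono nhdsWithin_le_nhds), h.eq_of_nhds.trans h3⟩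

theorem sideVal_zero (s : SignType) : sideVal s (0 : ℝ → Cn n) x = 0 := by
  cases s
  · rfl
  · exact leftLim_eq_of_tendsto tendsto_const_nhds
  · exact rightLim_eq_of_tendsto tendsto_const_nhds

/-- Left-hand limits, taken at points to the right of `x`, tend to the right-hand limit at `x`. -/
theorem tendsto_leftLim_nhdsGT {E : Type*} [TopologicalSpace E] [T3Space E] {g : ℝ → E} {r : E}
    (hr : Tendsto g (𝓝[>] x) (𝓝 r))
    (hl : ∀ᶠ y in 𝓝[>] x, ∃ l, Tendsto g (𝓝[<] y) (𝓝 l)) :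
    Tendsto (Function.leftLim g) (𝓝[>] x) (𝓝 r) := by
  refine (closed_nhds_basis r).tendsto_right_iff.2 ?_
  rintro s ⟨s_mem, s_closed⟩
  obtain ⟨b, hb, hbs⟩ := (mem_nhdsGT_iff_exists_Ioo_subset (a := x)).1 (hr s_mem)
  filter_upwards [Ioo_mem_nhdsGT hb, hl] with c hc hlc
  refine s_closed.mem_of_tendsto (tendsto_leftLim_of_tendsto hlc) ?_
  filter_upwards [Ioo_mem_nhdsLT hc.1] with d hd using hbs ⟨hd.1, hd.2.trans hc.2⟩

theorem IsBVlocSharp.exists_norm_le (hu : IsBVlocSharp I u) {c d : ℝ} (hc : c ∈ I) (hd : d ∈ I) :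
    ∃ A, ∀ x ∈ I ∩ Icc c d, ‖u x‖ ≤ A := by
  have h := hu.1 c d hc hd
  rcases (I ∩ Icc c d).eq_empty_or_nonempty with h0 | ⟨y, hy⟩
  · exact ⟨0, fun x hx => by simp [h0] at hx⟩
  · refine ⟨‖u y‖ + (eVariationOn u (I ∩ Icc c d)).toReal, fun x hx => ?_⟩
    have h1 := h.dist_le hx hy
    rw [dist_eq_norm] at h1
    have h2 := norm_add_le (u y) (u x - u y)
    rw [add_sub_cancel] at h2
    linarith

end Sides

/-! ### Norm bounds for densities -/

section Density

variable {n : ℕ} {I : Set ℝ} (M : MatrixMeasure n I)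

/-- The sum of the absolute values of the entries of the density. -/
noncomputable def MatrixMeasure.normDensity (x : ℝ) : ℝ := ∑ i, ∑ j, ‖M.density x i j‖

theorem MatrixMeasure.normDensity_nonneg (x : ℝ) : 0 ≤ M.normDensity x :=
  Finset.sum_nonneg fun _ _ => Finset.sum_nonneg fun _ _ => norm_nonneg _

theorem MatrixMeasure.integrableOn_normDensity {c d : ℝ} (hc : c ∈ I) (hd : d ∈ I) :
    IntegrableOn M.normDensity (Icc c d) M.base :=
  integrable_finsetSum _ fun i _ => integrable_finsetSum _ fun j _ =>
    (M.integrableOn_density c hc d hd i j).norm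

theorem norm_le_sum_norm (v : Cn n) : ‖v‖ ≤ ∑ i, ‖v i‖ := by
  have h : v = ∑ i, EuclideanSpace.single i (v i) := by
    ext j
    simp [Finset.sum_apply]
  calc ‖v‖ = ‖∑ i, EuclideanSpace.single i (v i)‖ := by rw [← h]
    _ ≤ ∑ i, ‖(EuclideanSpace.single i (v i) : Cn n)‖ := norm_sum_le _ _
    _ = _ := by simp

theorem norm_apply_le (v : Cn n) (i : Fin n) : ‖v i‖ ≤ ‖v‖ := PiLp.norm_apply_le v i

theorem MatrixMeasure.act_apply (u : ℝ → Cn n) (x : ℝ) (i : Fin n) :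
    M.act u x i = ∑ j, M.density x i j * u x j := rfl

theorem MatrixMeasure.norm_act_le (u : ℝ → Cn n) (x : ℝ) :
    ‖M.act u x‖ ≤ M.normDensity x * ‖u x‖ := by
  refine (norm_le_sum_norm _).trans ?_
  rw [normDensity, Finset.sum_mul]
  refine Finset.sum_le_sum fun i _ => ?_
  rw [M.act_apply, Finset.sum_mul]
  refine (norm_sum_le _ _).trans (Finset.sum_le_sum fun j _ => ?_)
  rw [norm_mul]
  gcongr
  exact norm_apply_le _ _

theorem MatrixMeasure.aestronglyMeasurable_act {S : Set ℝ} {u : ℝ → Cn n}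
    (hu : AEStronglyMeasurable u (M.base.restrict S)) :
    AEStronglyMeasurable (M.act u) (M.base.restrict S) := by
  have hc : ∀ i, AEStronglyMeasurable (fun x => u x i) (M.base.restrict S) := fun i =>
    (EuclideanSpace.proj (𝕜 := ℂ) i).continuous.comp_aestronglyMeasurable hu
  refine (PiLp.continuous_toLp 2 _).comp_aestronglyMeasurable
    (aemeasurable_pi_lambda (fun x i => ∑ j, M.density x i j * u x j)
      fun i => ?_).aestronglyMeasurable
  exact Finset.aemeasurable_fun_sum _ fun j _ =>
    (M.measurable_density i j).aemeasurable.mul (hc j).aemeasurable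

theorem MatrixMeasure.act_sub (u v : ℝ → Cn n) : M.act (u - v) = M.act u - M.act v := by
  funext x
  simp [MatrixMeasure.act]

variable (w : PosMatrixMeasure n I)

theorem PosMatrixMeasure.form_self_re_nonneg (f : ℝ → Cn n) (x : ℝ) : 0 ≤ (w.form f f x).re := by
  obtain ⟨C, hC⟩ := w.exists_factor x
  rw [hC]
  exact inner_self_nonneg (𝕜 := ℂ)

/-- Cauchy-Schwarz for the semidefinite form at x, applied to g = wf and f: |g|⁴ = |g*wf|² ≤
(g*wg)(f*wf), and g*wg is at most the norm density times |g|². Dividing by |g|² leaves the claim. -/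
theorem PosMatrixMeasure.norm_act_sq_le (f : ℝ → Cn n) (x : ℝ) :
    ‖w.act f x‖ ^ 2 ≤ w.normDensity x * (w.form f f x).re := by
  obtain ⟨C, hC⟩ := w.exists_factor x
  set g : ℝ → Cn n := w.act f with hg
  have h1 : w.form g f x = (‖g x‖ ^ 2 : ℝ) := by
    rw [PosMatrixMeasure.form, ← hg, inner_self_eq_norm_sq_to_K]
    simp
  have h2 : ‖w.form g f x‖ = ‖g x‖ ^ 2 := by
    rw [h1, Complex.norm_real, Real.norm_of_nonneg (by positivity)]
  have h3 : ‖w.form g f x‖ ≤ ‖Matrix.toEuclideanLin C (g x)‖ * ‖Matrix.toEuclideanLin C (f x)‖ := by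
    rw [hC]
    exact norm_inner_le_norm _ _
  have h4 : ∀ k : ℝ → Cn n, (w.form k k x).re = ‖Matrix.toEuclideanLin C (k x)‖ ^ 2 := fun k => by
    rw [hC, inner_self_eq_norm_sq_to_K]
    norm_cast
  have h5 : (w.form g g x).re ≤ w.normDensity x * ‖g x‖ ^ 2 := by
    refine (Complex.re_le_norm _).trans ((norm_inner_le_norm _ _).trans ?_)
    have := w.norm_act_le g x
    nlinarith [norm_nonneg (g x)]
  have h6 : (‖g x‖ ^ 2) ^ 2 ≤ (w.normDensity x * ‖g x‖ ^ 2) * (w.form f f x).re := by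
    rw [h4] at h5 ⊢
    rw [h2] at h3
    calc (‖g x‖ ^ 2) ^ 2
        ≤ (‖Matrix.toEuclideanLin C (g x)‖ * ‖Matrix.toEuclideanLin C (f x)‖) ^ 2 := by gcongr
      _ ≤ _ := by
        rw [mul_pow]
        gcongr
  rcases (norm_nonneg (g x)).eq_or_lt with h0 | h0
  · rw [← h0]
    have := mul_nonneg (w.normDensity_nonneg x) (w.form_self_re_nonneg f x)
    simpa using this
  · have h7 : 0 < ‖g x‖ ^ 2 := by positivity
    nlinarith

variable {w}

theorem CalL2.norm_sq (f : CalL2 w) :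
    ‖f‖ ^ 2 = ∫ x in I, (w.form f.toFun f.toFun x).re ∂w.base := by
  have h : ‖f‖ ^ 2 = RCLike.re (inner ℂ f f) := (inner_self_eq_norm_sq (𝕜 := ℂ) f).symm
  have h2 : inner ℂ f f = ∫ x in I, w.form f.toFun f.toFun x ∂w.base := rfl
  rw [h, h2, ← integral_re (CalL2.integrable_form f f)]
  rfl

/-- Optimising the free parameter in Young's inequality; this replaces the integral Cauchy-Schwarz
inequality, with T + 1 in place of a square root. -/
theorem le_of_forall_young {X T F : ℝ} (hF : 0 ≤ F) (hT : 0 ≤ T)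
    (h : ∀ s : ℝ, 0 < s → X ≤ s * T + s⁻¹ * F ^ 2) : X ≤ (T + 1) * F := by
  refine le_of_forall_pos_le_add fun ε hε => ?_
  -- The natural choice s = F is not admissible when F = 0, hence the small positive shift.
  have hs : 0 < F + ε / (T + 1) := by positivity
  have h1 := h _ hs
  have h2 : (F + ε / (T + 1))⁻¹ * F ^ 2 ≤ F := by
    rw [inv_mul_le_iff₀ hs]
    nlinarith [mul_nonneg hF (by positivity : 0 ≤ ε / (T + 1))]
  have h3 : (ε / (T + 1)) * T ≤ ε := by
    rw [div_mul_eq_mul_div, div_le_iff₀ (by positivity)]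
    nlinarith
  nlinarith

theorem CalL2.norm_act_le_young (f : CalL2 w) {s : ℝ} (hs : 0 < s) (x : ℝ) :
    ‖w.act f.toFun x‖ ≤ s * w.normDensity x + s⁻¹ * (w.form f.toFun f.toFun x).re := by
  have h := w.norm_act_sq_le f.toFun x
  have h1 := w.normDensity_nonneg x
  have h2 := w.form_self_re_nonneg f.toFun x
  have h3 : 0 ≤ s⁻¹ := by positivity
  have h4 : s * s⁻¹ = 1 := mul_inv_cancel₀ hs.ne'
  refine abs_le_of_sq_le_sq' ?_ (by positivity) |>.2
  have h5 : (s * w.normDensity x) * (s⁻¹ * (w.form f.toFun f.toFun x).re)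
    = w.normDensity x * (w.form f.toFun f.toFun x).re := by
    rw [mul_mul_mul_comm, h4, one_mul]
  have ha : 0 ≤ s * w.normDensity x := by positivity
  have hb : 0 ≤ s⁻¹ * (w.form f.toFun f.toFun x).re := by positivity
  nlinarith [mul_nonneg ha hb]

theorem CalL2.integrableOn_act (f : CalL2 w) {c d : ℝ} (hc : c ∈ I) (hd : d ∈ I)
    (hcd : Icc c d ⊆ I) : IntegrableOn (w.act f.toFun) (Icc c d) w.base := by
  refine Integrable.mono' (g := fun x => 1 * w.normDensity x
      + 1⁻¹ * (w.form f.toFun f.toFun x).re) ?_ ?_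
    (Eventually.of_forall fun x => f.norm_act_le_young one_pos x)
  · exact ((w.integrableOn_normDensity hc hd).const_mul _).add
      (((CalL2.integrable_form f f).mono_measure (Measure.restrict_mono_set _ hcd)).re.const_mul _)
  · exact w.aestronglyMeasurable_act
      (f.2.1.mono_measure (Measure.restrict_mono_set _ hcd))

/-- Integrating the pointwise Young inequality and then choosing the parameter. This is how ‖f‖
enters every estimate: the measure wf has total variation at most a constant times ‖f‖ on a compact
interval. -/
theorem CalL2.integral_norm_act_le (f : CalL2 w) {c d : ℝ}
    (hc : c ∈ I) (hd : d ∈ I) (hcd : Icc c d ⊆ I) :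
    ∫ x in Icc c d, ‖w.act f.toFun x‖ ∂w.base
      ≤ ((∫ x in Icc c d, w.normDensity x ∂w.base) + 1) * ‖f‖ := by
  refine le_of_forall_young (norm_nonneg f)
    (integral_nonneg fun x => w.normDensity_nonneg x) fun s hs => ?_
  have h1 : IntegrableOn (fun x => (w.form f.toFun f.toFun x).re) I w.base :=
    (CalL2.integrable_form f f).re
  calc ∫ x in Icc c d, ‖w.act f.toFun x‖ ∂w.base
      ≤ ∫ x in Icc c d, (s * w.normDensity x + s⁻¹ * (w.form f.toFun f.toFun x).re) ∂w.base := by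
        refine integral_mono (f.integrableOn_act hc hd hcd).norm
          (((w.integrableOn_normDensity hc hd).const_mul _).add ((h1.mono_set hcd).const_mul _))
          fun x => f.norm_act_le_young hs x
    _ = s * (∫ x in Icc c d, w.normDensity x ∂w.base)
        + s⁻¹ * ∫ x in Icc c d, (w.form f.toFun f.toFun x).re ∂w.base := by
        rw [integral_add ((w.integrableOn_normDensity hc hd).const_mul _)
          ((h1.mono_set hcd).const_mul _), integral_const_mul, integral_const_mul]
    _ ≤ _ := by
        rw [CalL2.norm_sq f]
        refine add_le_add le_rfl (mul_le_mul_of_nonneg_left ?_ (inv_nonneg.2 hs.le))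
        exact setIntegral_mono_set h1
          (Eventually.of_forall fun x => w.form_self_re_nonneg _ x) hcd.eventuallyLE

end Density

/-! ### The equation as an identity of measures on all kinds of intervals -/

section Equation

variable {n : ℕ} {I : Set ℝ} {J : Matrix (Fin n) (Fin n) ℂ} {q : MatrixMeasure n I}
  {w : PosMatrixMeasure n I} {u f : ℝ → Cn n}

theorem exists_gt_mem (hI : IsOpen I) {x : ℝ} (hx : x ∈ I) : ∃ y ∈ I, x < y := by
  obtain ⟨y, hy, h⟩ := (mem_nhdsGE_iff_exists_Icc_subset (a := x)).1
    (mem_nhdsWithin_of_mem_nhds (hI.mem_nhds hx))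
  exact ⟨y, h ⟨hy.le, le_rfl⟩, hy⟩

theorem IsSolution.integrableOn_left (h : IsSolution J q w u f) (hI : IsOpen I) {c d : ℝ}
    (hc : c ∈ I) (hd : d ∈ I) : IntegrableOn (q.act u) (Icc c d) q.base := by
  obtain ⟨e, he, hde⟩ := exists_gt_mem hI hd
  rcases le_or_gt c d with hcd | hcd
  · exact (h c hc e he (hcd.trans_lt hde)).1.mono_set fun x hx => ⟨hx.1, hx.2.trans_lt hde⟩
  · simp [Icc_eq_empty hcd.not_ge]

theorem IsSolution.integrableOn_right (h : IsSolution J q w u f) (hI : IsOpen I) {c d : ℝ}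
    (hc : c ∈ I) (hd : d ∈ I) : IntegrableOn (w.act f) (Icc c d) w.base := by
  obtain ⟨e, he, hde⟩ := exists_gt_mem hI hd
  rcases le_or_gt c d with hcd | hcd
  · exact (h c hc e he (hcd.trans_lt hde)).2.1.mono_set fun x hx => ⟨hx.1, hx.2.trans_lt hde⟩
  · simp [Icc_eq_empty hcd.not_ge]

variable (q w u f) in
/-- The mass which the measure `w f - q u` gives to `S`. -/
noncomputable def source (S : Set ℝ) : Cn n :=
  (∫ x in S, w.act f x ∂w.base) - ∫ x in S, q.act u x ∂q.base

variable (q w u f) in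
/-- An upper bound for the total variation of `w f - q u` over `S`. -/
noncomputable def sourceMass (S : Set ℝ) : ℝ :=
  (∫ x in S, ‖w.act f x‖ ∂w.base) + ∫ x in S, ‖q.act u x‖ ∂q.base

theorem sourceMass_nonneg (S : Set ℝ) : 0 ≤ sourceMass q w u f S :=
  add_nonneg (integral_nonneg fun _ => norm_nonneg _) (integral_nonneg fun _ => norm_nonneg _)

theorem norm_source_le (S : Set ℝ) : ‖source q w u f S‖ ≤ sourceMass q w u f S :=
  (norm_sub_le _ _).trans
    (add_le_add (norm_integral_le_integral_norm _) (norm_integral_le_integral_norm _))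

theorem IsSolution.source_union (h : IsSolution J q w u f) (hI : IsOpen I) {c d : ℝ}
    (hc : c ∈ I) (hd : d ∈ I) {S T : Set ℝ} (hST : Disjoint S T) (hT : MeasurableSet T)
    (hS : S ⊆ Icc c d) (hT' : T ⊆ Icc c d) :
    source q w u f (S ∪ T) = source q w u f S + source q w u f T := by
  have h1 := h.integrableOn_left hI hc hd
  have h2 := h.integrableOn_right hI hc hd
  rw [source, setIntegral_union hST hT (h2.mono_set hS) (h2.mono_set hT'),
    setIntegral_union hST hT (h1.mono_set hS) (h1.mono_set hT'), source, source]
  abel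

theorem IsSolution.sourceMass_union (h : IsSolution J q w u f) (hI : IsOpen I) {c d : ℝ}
    (hc : c ∈ I) (hd : d ∈ I) {S T : Set ℝ} (hST : Disjoint S T) (hT : MeasurableSet T)
    (hS : S ⊆ Icc c d) (hT' : T ⊆ Icc c d) :
    sourceMass q w u f (S ∪ T) = sourceMass q w u f S + sourceMass q w u f T := by
  have h1 : IntegrableOn (fun x => ‖q.act u x‖) (Icc c d) q.base :=
    (h.integrableOn_left hI hc hd).norm
  have h2 : IntegrableOn (fun x => ‖w.act f x‖) (Icc c d) w.base :=
    (h.integrableOn_right hI hc hd).norm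
  rw [sourceMass, setIntegral_union hST hT (h2.mono_set hS) (h2.mono_set hT'),
    setIntegral_union hST hT (h1.mono_set hS) (h1.mono_set hT'), sourceMass, sourceMass]
  abel

theorem IsSolution.sourceMass_mono (h : IsSolution J q w u f) (hI : IsOpen I) {c d : ℝ}
    (hc : c ∈ I) (hd : d ∈ I) {S T : Set ℝ} (hST : S ⊆ T) (hT : T ⊆ Icc c d) :
    sourceMass q w u f S ≤ sourceMass q w u f T := by
  have h1 := ((h.integrableOn_left hI hc hd).mono_set hT).norm
  have h2 := ((h.integrableOn_right hI hc hd).mono_set hT).norm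
  exact add_le_add
    (setIntegral_mono_set h2 (Eventually.of_forall fun _ => norm_nonneg _) hST.eventuallyLE)
    (setIntegral_mono_set h1 (Eventually.of_forall fun _ => norm_nonneg _) hST.eventuallyLE)

theorem IsSolution.source_Ico (h : IsSolution J q w u f) {c d : ℝ} (hc : c ∈ I) (hd : d ∈ I)
    (hcd : c < d) : Matrix.toEuclideanLin J (Function.leftLim u d - Function.leftLim u c)
      = source q w u f (Ico c d) := by
  rw [source, ← (h c hc d hd hcd).2.2, add_sub_cancel_right]

theorem tendsto_setIntegral_Ico {E : Type*} [NormedAddCommGroup E] [NormedSpace ℝ E]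
    {μ : Measure ℝ} {g : ℝ → E} {x d : ℝ} (hg : IntegrableOn g (Icc x d) μ) {s : ℕ → ℝ}
    (hs : StrictAnti s) (hsd : ∀ k, s k ∈ Ioo x d) (hsx : Tendsto s atTop (𝓝 x)) :
    Tendsto (fun k => ∫ y in Ico x (s k), g y ∂μ) atTop (𝓝 (∫ y in {x}, g y ∂μ)) := by
  have h : (⋂ k, Ico x (s k)) = {x} := by
    refine Subset.antisymm (fun y hy => ?_) ?_
    · rw [mem_iInter] at hy
      exact le_antisymm (ge_of_tendsto' hsx fun k => (hy k).2.le) (hy 0).1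
    · rintro _ rfl
      exact mem_iInter.2 fun k => ⟨le_rfl, (hsd k).1⟩
  rw [← h]
  exact tendsto_setIntegral_of_antitone (fun _ => measurableSet_Ico)
    (fun i j hij => Ico_subset_Ico_right (hs.antitone hij))
    ⟨0, hg.mono_set fun y hy => ⟨hy.1, hy.2.le.trans (hsd 0).2.le⟩⟩

/-- Shrink [x, s_k) to {x} in the equation: the left-hand limits of u at s_k tend to its right-hand
limit at x, and the integrals tend to the atoms at x. Adding or removing such endpoint atoms
converts the half-open form of the equation into the other forms. -/
theorem IsSolution.source_singleton (h : IsSolution J q w u f) (hI : IsOpen I)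
    (hu : IsBVlocSharp I u) {x : ℝ} (hx : x ∈ I) :
    Matrix.toEuclideanLin J (Function.rightLim u x - Function.leftLim u x)
      = source q w u f {x} := by
  obtain ⟨d, hd, hxd⟩ := (mem_nhdsGE_iff_exists_Icc_subset (a := x)).1
    (mem_nhdsWithin_of_mem_nhds (hI.mem_nhds hx))
  have hdI : d ∈ I := hxd ⟨le_of_lt hd, le_rfl⟩
  obtain ⟨s, hs, hsd, hsx⟩ := exists_seq_strictAnti_tendsto' (show x < d from hd)
  have hsI : ∀ k, s k ∈ I := fun k => hxd ⟨(hsd k).1.le, (hsd k).2.le⟩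
  have h1 := (tendsto_setIntegral_Ico (h.integrableOn_right hI hx hdI) hs hsd hsx).sub
    (tendsto_setIntegral_Ico (h.integrableOn_left hI hx hdI) hs hsd hsx)
  have h2 : Tendsto (Function.leftLim u) (𝓝[>] x) (𝓝 (Function.rightLim u x)) := by
    refine tendsto_leftLim_nhdsGT (hu.2 x hx).tendsto_right ?_
    filter_upwards [mem_nhdsWithin_of_mem_nhds (hI.mem_nhds hx)] with y hy
    exact ⟨_, (hu.2 y hy).tendsto_left⟩
  have h3 : Tendsto s atTop (𝓝[>] x) :=
    tendsto_nhdsWithin_iff.2 ⟨hsx, Eventually.of_forall fun k => (hsd k).1⟩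
  have h4 := ((LinearMap.continuous_of_finiteDimensional (Matrix.toEuclideanLin J)).tendsto _).comp
    ((h2.comp h3).sub_const (Function.leftLim u x))
  refine tendsto_nhds_unique h4 (h1.congr fun k => ?_)
  exact (h.source_Ico hx (hsI k) (hsd k).1).symm

theorem IsSolution.source_Ioo (h : IsSolution J q w u f) (hI : IsOpen I)
    (hu : IsBVlocSharp I u) {c d : ℝ} (hc : c ∈ I) (hd : d ∈ I) (hcd : c < d) :
    Matrix.toEuclideanLin J (Function.leftLim u d - Function.rightLim u c)
      = source q w u f (Ioo c d) := by
  have h1 := h.source_union hI hc hd (S := {c}) (T := Ioo c d) (by simp) measurableSet_Ioo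
    (by simp [hcd.le]) Ioo_subset_Icc_self
  rw [singleton_union, Ioo_insert_left hcd, ← h.source_Ico hc hd hcd,
    ← h.source_singleton hI hu hc] at h1
  rw [← sub_eq_iff_eq_add'.2 h1, ← map_sub]
  congr 1
  abel

theorem IsSolution.source_Ioc (h : IsSolution J q w u f) (hI : IsOpen I)
    (hu : IsBVlocSharp I u) {c d : ℝ} (hc : c ∈ I) (hd : d ∈ I) (hcd : c < d) :
    Matrix.toEuclideanLin J (Function.rightLim u d - Function.rightLim u c)
      = source q w u f (Ioc c d) := by
  have h1 := h.source_union hI hc hd (S := Ioo c d) (T := {d}) (by simp)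
    (measurableSet_singleton d) Ioo_subset_Icc_self (by simp [hcd.le])
  rw [union_singleton, Ioo_insert_right hcd, ← h.source_Ioo hI hu hc hd hcd,
    ← h.source_singleton hI hu hd, ← map_add] at h1
  rw [h1]
  congr 1
  abel

theorem IsSolution.source_Icc (h : IsSolution J q w u f) (hI : IsOpen I)
    (hu : IsBVlocSharp I u) {c d : ℝ} (hc : c ∈ I) (hd : d ∈ I) (hcd : c < d) :
    Matrix.toEuclideanLin J (Function.rightLim u d - Function.leftLim u c)
      = source q w u f (Icc c d) := by
  have h1 := h.source_union hI hc hd (S := Ico c d) (T := {d}) (by simp)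
    (measurableSet_singleton d) Ico_subset_Icc_self (by simp [hcd.le])
  rw [union_singleton, Ico_insert_right hcd.le, ← h.source_Ico hc hd hcd,
    ← h.source_singleton hI hu hd, ← map_add] at h1
  rw [h1]
  congr 1
  abel

theorem exists_norm_le_toEuclideanLin (hJ : IsUnit J) :
    ∃ κ : ℝ, 0 < κ ∧ ∀ v : Cn n, ‖v‖ ≤ κ * ‖Matrix.toEuclideanLin J v‖ := by
  let L := LinearMap.toContinuousLinearMap (Matrix.toEuclideanLin J⁻¹)
  -- The added 1 only makes the constant strictly positive, also for n = 0.
  refine ⟨‖L‖ + 1, by positivity, fun v => ?_⟩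
  have h : L (Matrix.toEuclideanLin J v) = v := by
    have h0 : J⁻¹ * J = 1 := Matrix.nonsing_inv_mul J ((Matrix.isUnit_iff_isUnit_det J).1 hJ)
    rw [LinearMap.coe_toContinuousLinearMap']
    ext i
    simp [Matrix.toEuclideanLin, h0]
  calc ‖v‖ = ‖L (Matrix.toEuclideanLin J v)‖ := by rw [h]
    _ ≤ ‖L‖ * ‖Matrix.toEuclideanLin J v‖ := L.le_opNorm _
    _ ≤ _ := by gcongr; linarith

end Equation

/-! ### Variation and local bounds -/

section Bounds

variable {n : ℕ} {I : Set ℝ} {J : Matrix (Fin n) (Fin n) ℂ} {q : MatrixMeasure n I}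
  {w : PosMatrixMeasure n I} {u f : ℝ → Cn n}

/-- The increments of u are dominated by those of G, whose sum telescopes. -/
theorem eVariationOn_le_of_norm_sub_le {u : ℝ → Cn n} {G : ℝ → ℝ} {S : Set ℝ} {A : ℝ}
    (h : ∀ x ∈ S, ∀ y ∈ S, x ≤ y → ‖u y - u x‖ ≤ G y - G x)
    (hA : ∀ x ∈ S, ∀ y ∈ S, x ≤ y → G y - G x ≤ A) : eVariationOn u S ≤ ENNReal.ofReal A := by
  refine iSup_le fun p => ?_
  obtain ⟨N, s, hs, hsS⟩ := p
  calc ∑ i ∈ Finset.range N, edist (u (s (i + 1))) (u (s i))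
      ≤ ∑ i ∈ Finset.range N, ENNReal.ofReal (G (s (i + 1)) - G (s i)) := by
        refine Finset.sum_le_sum fun i _ => ?_
        rw [edist_dist, dist_eq_norm]
        exact ENNReal.ofReal_le_ofReal (h _ (hsS i) _ (hsS (i + 1)) (hs (Nat.le_succ i)))
    _ = ENNReal.ofReal (∑ i ∈ Finset.range N, (G (s (i + 1)) - G (s i))) :=
        (ENNReal.ofReal_sum_of_nonneg fun i _ =>
          (norm_nonneg _).trans (h _ (hsS i) _ (hsS (i + 1)) (hs (Nat.le_succ i)))).symm
    _ ≤ _ := by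
        rw [Finset.sum_range_sub (fun i => G (s i))]
        exact ENNReal.ofReal_le_ofReal (hA _ (hsS 0) _ (hsS N) (hs (Nat.zero_le N)))

theorem IsSolution.eVariationOn_le (h : IsSolution J q w u f) (hI : IsOpen I)
    (hu : IsBVlocSharp I u) {κ : ℝ} (hκ : 0 < κ)
    (hκJ : ∀ v : Cn n, ‖v‖ ≤ κ * ‖Matrix.toEuclideanLin J v‖) {c d : ℝ}
    (hc : c ∈ I) (hd : d ∈ I) (hcd : Icc c d ⊆ I) :
    eVariationOn u (Icc c d) ≤ ENNReal.ofReal (κ * sourceMass q w u f (Icc c d)) := by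
  set m := sourceMass q w u f with hm
  have hIco : ∀ x ∈ Icc c d, ∀ y ∈ Icc c d, x ≤ y →
      m (Ico c y) - m (Ico c x) = m (Ico x y) := fun x hx y hy hxy => by
    rw [← Ico_union_Ico_eq_Ico hx.1 hxy, hm, h.sourceMass_union hI hc hd (by simp)
      measurableSet_Ico (fun z hz => ⟨hz.1, hz.2.le.trans hx.2⟩)
      (fun z hz => ⟨hx.1.trans hz.1, hz.2.le.trans hy.2⟩)]
    ring
  have hIoc : ∀ x ∈ Icc c d, ∀ y ∈ Icc c d, x ≤ y →
      m (Ioc c y) - m (Ioc c x) = m (Ioc x y) := fun x hx y hy hxy => by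
    rw [← Ioc_union_Ioc_eq_Ioc hx.1 hxy, hm, h.sourceMass_union hI hc hd (by simp)
      measurableSet_Ioc (fun z hz => ⟨hz.1.le, hz.2.trans hx.2⟩)
      (fun z hz => ⟨hx.1.trans hz.1.le, hz.2.trans hy.2⟩)]
    ring
  -- An increment of the balanced u is the mean of the increments of its left- and right-hand
  -- limits, which are governed by the mass on [x, y) and on (x, y]. So the dominating function
  -- averages the two distribution functions.
  refine eVariationOn_le_of_norm_sub_le (G := fun x => κ / 2 * (m (Ico c x) + m (Ioc c x))) ?_ ?_
  · intro x hx y hy hxy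
    have e : κ / 2 * (m (Ico c y) + m (Ioc c y)) - κ / 2 * (m (Ico c x) + m (Ioc c x))
        = κ / 2 * (m (Ico x y) + m (Ioc x y)) := by
      rw [← hIco x hx y hy hxy, ← hIoc x hx y hy hxy]
      ring
    change _ ≤ κ / 2 * (m (Ico c y) + m (Ioc c y)) - κ / 2 * (m (Ico c x) + m (Ioc c x))
    rw [e]
    rcases hxy.eq_or_lt with rfl | hxy
    · rw [sub_self, norm_zero]
      have := sourceMass_nonneg (q := q) (w := w) (u := u) (f := f) (Ico x x)
      have := sourceMass_nonneg (q := q) (w := w) (u := u) (f := f) (Ioc x x)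
      positivity
    · have e2 : u y - u x = (1 / 2 : ℂ) • ((Function.leftLim u y - Function.leftLim u x)
          + (Function.rightLim u y - Function.rightLim u x)) := by
        rw [(hu.2 x (hcd hx)).eq_half, (hu.2 y (hcd hy)).eq_half, ← smul_sub]
        congr 1
        abel
      have h1 := hκJ (Function.leftLim u y - Function.leftLim u x)
      have h2 := hκJ (Function.rightLim u y - Function.rightLim u x)
      rw [h.source_Ico (hcd hx) (hcd hy) hxy] at h1
      rw [h.source_Ioc hI hu (hcd hx) (hcd hy) hxy] at h2
      have h1' := h1.trans (mul_le_mul_of_nonneg_left (norm_source_le _) hκ.le)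
      have h2' := h2.trans (mul_le_mul_of_nonneg_left (norm_source_le _) hκ.le)
      rw [e2, norm_smul]
      have h3 := norm_add_le (Function.leftLim u y - Function.leftLim u x)
        (Function.rightLim u y - Function.rightLim u x)
      norm_num
      linarith
  · intro x hx y hy hxy
    have h1 := h.sourceMass_mono hI hc hd (S := Ico x y) (T := Icc c d)
      (fun z hz => ⟨hx.1.trans hz.1, hz.2.le.trans hy.2⟩) le_rfl
    have h2 := h.sourceMass_mono hI hc hd (S := Ioc x y) (T := Icc c d)
      (fun z hz => ⟨hx.1.trans hz.1.le, hz.2.trans hy.2⟩) le_rfl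
    change κ / 2 * (m (Ico c y) + m (Ioc c y)) - κ / 2 * (m (Ico c x) + m (Ioc c x)) ≤ _
    rw [← mul_sub, add_sub_add_comm, hIco x hx y hy hxy, hIoc x hx y hy hxy]
    nlinarith

theorem IsSolution.sourceMass_le (h : IsSolution J q w u f) (hI : IsOpen I) {c d A : ℝ}
    (hc : c ∈ I) (hd : d ∈ I) {S T : Set ℝ} (hS : MeasurableSet S)
    (hST : S ⊆ T) (hTc : T ⊆ Icc c d) (hA0 : 0 ≤ A) (hA : ∀ x ∈ S, ‖u x‖ ≤ A) :
    sourceMass q w u f S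
      ≤ (∫ x in T, ‖w.act f x‖ ∂w.base) + (∫ x in T, q.normDensity x ∂q.base) * A := by
  have h1 := ((h.integrableOn_left hI hc hd).mono_set hTc)
  have h2 := ((h.integrableOn_right hI hc hd).mono_set hTc).norm
  have h3 := (q.integrableOn_normDensity hc hd).mono_set hTc
  refine add_le_add
    (setIntegral_mono_set h2 (Eventually.of_forall fun _ => norm_nonneg _) hST.eventuallyLE) ?_
  rw [← integral_mul_const]
  calc ∫ x in S, ‖q.act u x‖ ∂q.base ≤ ∫ x in S, q.normDensity x * A ∂q.base := by
        refine setIntegral_mono_on (h1.mono_set hST).norm ((h3.mono_set hST).mul_const _) hS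
          fun x hx => (q.norm_act_le u x).trans ?_
        exact mul_le_mul_of_nonneg_left (hA x hx) (q.normDensity_nonneg x)
    _ ≤ _ := setIntegral_mono_set (h3.mul_const _)
        (Eventually.of_forall fun x => mul_nonneg (q.normDensity_nonneg x) hA0) hST.eventuallyLE

/-- Absorption: the supremum A satisfies A ≤ a + A/2, hence A ≤ 2a. The a priori bound makes A
finite. -/
theorem norm_le_two_mul_of_forall {S : Set ℝ} {a : ℝ}
    (hb : ∃ A, ∀ x ∈ S, ‖u x‖ ≤ A)
    (h : ∀ A, 0 ≤ A → (∀ x ∈ S, ‖u x‖ ≤ A) → ∀ x ∈ S, ‖u x‖ ≤ a + A / 2) :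
    ∀ x ∈ S, ‖u x‖ ≤ 2 * a := by
  obtain ⟨B, hB⟩ := hb
  rcases S.eq_empty_or_nonempty with rfl | ⟨y, hy⟩
  · simp
  have hbdd : BddAbove ((fun x => ‖u x‖) '' S) := ⟨B, by rintro _ ⟨x, hx, rfl⟩; exact hB x hx⟩
  set A := sSup ((fun x => ‖u x‖) '' S) with hA
  have h1 : ∀ x ∈ S, ‖u x‖ ≤ A := fun x hx => le_csSup hbdd ⟨x, hx, rfl⟩
  have h2 : A ≤ a + A / 2 := by
    refine csSup_le ⟨_, y, hy, rfl⟩ ?_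
    rintro _ ⟨x, hx, rfl⟩
    exact h A ((norm_nonneg _).trans (h1 y hy)) h1 x hx
  intro x hx
  linarith [h1 x hx]

/-- A substitute for Gronwall's inequality: q has so little mass on the open interval that the term
qu contributes at most half the supremum of u, which is absorbed. Starting from the right-hand limit
at s keeps a possible atom at s out of the estimate. -/
theorem IsSolution.sideVal_le_of_rightLim (h : IsSolution J q w u f) (hI : IsOpen I)
    (hu : IsBVlocSharp I u) {κ : ℝ} (hκ : 0 < κ)
    (hκJ : ∀ v : Cn n, ‖v‖ ≤ κ * ‖Matrix.toEuclideanLin J v‖) {s t : ℝ}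
    (hs : s ∈ I) (ht : t ∈ I) (hst : Icc s t ⊆ I)
    (hq : κ * ∫ x in Ioo s t, q.normDensity x ∂q.base ≤ 1 / 2) {z : ℝ} (hz : z ∈ Ioo s t)
    (σ : SignType) :
    ‖sideVal σ u z‖
      ≤ 2 * (‖Function.rightLim u s‖ + κ * ∫ x in Ioo s t, ‖w.act f x‖ ∂w.base) := by
  set B := ∫ x in Ioo s t, ‖w.act f x‖ ∂w.base with hB
  have hB0 : 0 ≤ B := integral_nonneg fun _ => norm_nonneg _
  have key : ∀ A, 0 ≤ A → (∀ x ∈ Ioo s t, ‖u x‖ ≤ A) → ∀ x ∈ Ioo s t, ∀ σ : SignType,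
      ‖sideVal σ u x‖ ≤ (‖Function.rightLim u s‖ + κ * B) + A / 2 := by
    intro A hA0 hA x hx
    have hxI : x ∈ I := hst ⟨hx.1.le, hx.2.le⟩
    have hmass : ∀ S, MeasurableSet S → S ⊆ Ioo s t →
        κ * ‖source q w u f S‖ ≤ κ * B + A / 2 := fun S hS hSt => by
      have h1 := (norm_source_le (q := q) (w := w) (u := u) (f := f) S).trans
        (h.sourceMass_le hI hs ht hS hSt Ioo_subset_Icc_self hA0
          fun x hx => hA x (hSt hx))
      nlinarith [mul_le_mul_of_nonneg_left h1 hκ.le]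
    have hl : ‖Function.leftLim u x‖ ≤ (‖Function.rightLim u s‖ + κ * B) + A / 2 := by
      have h1 := hκJ (Function.leftLim u x - Function.rightLim u s)
      rw [h.source_Ioo hI hu hs hxI hx.1] at h1
      have h2 := hmass (Ioo s x) measurableSet_Ioo fun y hy => ⟨hy.1, hy.2.trans hx.2⟩
      have h3 := norm_le_norm_add_norm_sub' (Function.leftLim u x) (Function.rightLim u s)
      linarith
    have hr : ‖Function.rightLim u x‖ ≤ (‖Function.rightLim u s‖ + κ * B) + A / 2 := by
      have h1 := hκJ (Function.rightLim u x - Function.rightLim u s)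
      rw [h.source_Ioc hI hu hs hxI hx.1] at h1
      have h2 := hmass (Ioc s x) measurableSet_Ioc fun y hy => ⟨hy.1, hy.2.trans_lt hx.2⟩
      have h3 := norm_le_norm_add_norm_sub' (Function.rightLim u x) (Function.rightLim u s)
      linarith
    intro σ
    cases σ
    · exact (hu.2 x hxI).norm_le hl hr
    · exact hl
    · exact hr
  obtain ⟨A, hA⟩ := hu.exists_norm_le hs ht
  have h1 := norm_le_two_mul_of_forall (u := u) (S := Ioo s t)
    (a := ‖Function.rightLim u s‖ + κ * B)
    ⟨A, fun x hx => hA x ⟨hst ⟨hx.1.le, hx.2.le⟩, hx.1.le, hx.2.le⟩⟩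
    fun A hA0 hA x hx => key A hA0 hA x hx .zero
  -- Once the values are bounded by 2a, a second use of `key` with A = 2a gives a + a, now for the
  -- one-sided limits as well.
  have h2 := key _ (by positivity) h1 z hz σ
  linarith

theorem IsSolution.sideVal_le_of_leftLim (h : IsSolution J q w u f) (hI : IsOpen I)
    (hu : IsBVlocSharp I u) {κ : ℝ} (hκ : 0 < κ)
    (hκJ : ∀ v : Cn n, ‖v‖ ≤ κ * ‖Matrix.toEuclideanLin J v‖) {s t : ℝ}
    (hs : s ∈ I) (ht : t ∈ I) (hst : Icc s t ⊆ I)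
    (hq : κ * ∫ x in Ioo s t, q.normDensity x ∂q.base ≤ 1 / 2) {z : ℝ} (hz : z ∈ Ioo s t)
    (σ : SignType) :
    ‖sideVal σ u z‖
      ≤ 2 * (‖Function.leftLim u t‖ + κ * ∫ x in Ioo s t, ‖w.act f x‖ ∂w.base) := by
  set B := ∫ x in Ioo s t, ‖w.act f x‖ ∂w.base with hB
  have hB0 : 0 ≤ B := integral_nonneg fun _ => norm_nonneg _
  have key : ∀ A, 0 ≤ A → (∀ x ∈ Ioo s t, ‖u x‖ ≤ A) → ∀ x ∈ Ioo s t, ∀ σ : SignType,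
      ‖sideVal σ u x‖ ≤ (‖Function.leftLim u t‖ + κ * B) + A / 2 := by
    intro A hA0 hA x hx
    have hxI : x ∈ I := hst ⟨hx.1.le, hx.2.le⟩
    have hmass : ∀ S, MeasurableSet S → S ⊆ Ioo s t →
        κ * ‖source q w u f S‖ ≤ κ * B + A / 2 := fun S hS hSt => by
      have h1 := (norm_source_le (q := q) (w := w) (u := u) (f := f) S).trans
        (h.sourceMass_le hI hs ht hS hSt Ioo_subset_Icc_self hA0
          fun x hx => hA x (hSt hx))
      nlinarith [mul_le_mul_of_nonneg_left h1 hκ.le]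
    have hl : ‖Function.leftLim u x‖ ≤ (‖Function.leftLim u t‖ + κ * B) + A / 2 := by
      have h1 := hκJ (Function.leftLim u t - Function.leftLim u x)
      rw [h.source_Ico hxI ht hx.2] at h1
      have h2 := hmass (Ico x t) measurableSet_Ico fun y hy => ⟨hx.1.trans_le hy.1, hy.2⟩
      have h3 := norm_le_norm_add_norm_sub (Function.leftLim u t) (Function.leftLim u x)
      linarith
    have hr : ‖Function.rightLim u x‖ ≤ (‖Function.leftLim u t‖ + κ * B) + A / 2 := by
      have h1 := hκJ (Function.leftLim u t - Function.rightLim u x)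
      rw [h.source_Ioo hI hu hxI ht hx.2] at h1
      have h2 := hmass (Ioo x t) measurableSet_Ioo fun y hy => ⟨hx.1.trans hy.1, hy.2⟩
      have h3 := norm_le_norm_add_norm_sub (Function.leftLim u t) (Function.rightLim u x)
      linarith
    intro σ
    cases σ
    · exact (hu.2 x hxI).norm_le hl hr
    · exact hl
    · exact hr
  obtain ⟨A, hA⟩ := hu.exists_norm_le hs ht
  have h1 := norm_le_two_mul_of_forall (u := u) (S := Ioo s t)
    (a := ‖Function.leftLim u t‖ + κ * B)
    ⟨A, fun x hx => hA x ⟨hst ⟨hx.1.le, hx.2.le⟩, hx.1.le, hx.2.le⟩⟩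
    fun A hA0 hA x hx => key A hA0 hA x hx .zero
  have h2 := key _ (by positivity) h1 z hz σ
  linarith

end Bounds

/-! ### Uniform bounds on compact intervals -/

section CompactBounds

variable {n : ℕ} {I : Set ℝ} {J : Matrix (Fin n) (Fin n) ℂ} {q : MatrixMeasure n I}
  {w : PosMatrixMeasure n I}

/-- The one-sided open intervals at x shrink to the empty set, so an atom at x does no harm. -/
theorem exists_setIntegral_Ioo_lt {μ : Measure ℝ} {g : ℝ → ℝ} {x δ η : ℝ} (hδ : 0 < δ)
    (hη : 0 < η) (hg : IntegrableOn g (Icc (x - δ) (x + δ)) μ) :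
    ∃ ε, 0 < ε ∧ ε ≤ δ ∧ ∫ y in Ioo x (x + ε), g y ∂μ < η ∧
      ∫ y in Ioo (x - ε) x, g y ∂μ < η := by
  obtain ⟨s, hs, hsd, hsx⟩ := exists_seq_strictAnti_tendsto' hδ
  have h1 : Tendsto (fun k => ∫ y in Ioo x (x + s k), g y ∂μ) atTop (𝓝 0) := by
    have h : (⋂ k, Ioo x (x + s k)) = ∅ := by
      refine eq_empty_of_forall_notMem fun y hy => ?_
      rw [mem_iInter] at hy
      have h2 : y - x ≤ 0 := ge_of_tendsto' hsx fun k => by linarith [(hy k).2]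
      linarith [(hy 0).1]
    have h3 := tendsto_setIntegral_of_antitone (f := g) (μ := μ) (s := fun k => Ioo x (x + s k))
      (fun _ => measurableSet_Ioo)
      (fun i j hij => Ioo_subset_Ioo_right (by linarith [hs.antitone hij]))
      ⟨0, hg.mono_set fun y hy => ⟨by linarith [hy.1], by linarith [hy.2, (hsd 0).2]⟩⟩
    rwa [h, setIntegral_empty] at h3
  have h2 : Tendsto (fun k => ∫ y in Ioo (x - s k) x, g y ∂μ) atTop (𝓝 0) := by
    have h : (⋂ k, Ioo (x - s k) x) = ∅ := by
      refine eq_empty_of_forall_notMem fun y hy => ?_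
      rw [mem_iInter] at hy
      have h2 : x - y ≤ 0 := ge_of_tendsto' hsx fun k => by linarith [(hy k).1]
      linarith [(hy 0).2]
    have h3 := tendsto_setIntegral_of_antitone (f := g) (μ := μ) (s := fun k => Ioo (x - s k) x)
      (fun _ => measurableSet_Ioo)
      (fun i j hij => Ioo_subset_Ioo_left (by linarith [hs.antitone hij]))
      ⟨0, hg.mono_set fun y hy => ⟨by linarith [hy.1, (hsd 0).2], by linarith [hy.2]⟩⟩
    rwa [h, setIntegral_empty] at h3
  obtain ⟨k, hk1, hk2⟩ := ((h1.eventually_lt_const hη).and (h2.eventually_lt_const hη)).exists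
  exact ⟨s k, (hsd k).1, (hsd k).2.le, hk1, hk2⟩

/-- Every point has a neighbourhood, deprived of that point, on which `q` has small mass. -/
theorem MatrixMeasure.exists_small_nhds (q : MatrixMeasure n I) (hI : IsOpen I) {κ : ℝ}
    (hκ : 0 < κ) {x : ℝ} (hx : x ∈ I) :
    ∃ ε, 0 < ε ∧ Icc (x - ε) (x + ε) ⊆ I ∧
      κ * ∫ y in Ioo x (x + ε), q.normDensity y ∂q.base ≤ 1 / 2 ∧
      κ * ∫ y in Ioo (x - ε) x, q.normDensity y ∂q.base ≤ 1 / 2 := by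
  obtain ⟨δ, hδ, hδI⟩ := Metric.nhds_basis_closedBall.mem_iff.1 (hI.mem_nhds hx)
  rw [Real.closedBall_eq_Icc] at hδI
  obtain ⟨ε, hε, hεδ, h1, h2⟩ := exists_setIntegral_Ioo_lt hδ
    (by positivity : 0 < 1 / (2 * κ)) (q.integrableOn_normDensity (c := x - δ) (d := x + δ)
      (hδI ⟨le_rfl, by linarith⟩) (hδI ⟨by linarith, le_rfl⟩))
  have e : κ * (1 / (2 * κ)) = 1 / 2 := by field_simp
  refine ⟨ε, hε, fun y hy => hδI ⟨by linarith [hy.1], by linarith [hy.2]⟩, ?_, ?_⟩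
  · rw [← e]; gcongr
  · rw [← e]; gcongr

theorem CalL2.setIntegral_norm_act_le (f : CalL2 w) {c d : ℝ} (hc : c ∈ I) (hd : d ∈ I)
    (hcd : Icc c d ⊆ I) {S : Set ℝ} (hS : S ⊆ Icc c d) :
    ∫ x in S, ‖w.act f.toFun x‖ ∂w.base
      ≤ ((∫ x in Icc c d, w.normDensity x ∂w.base) + 1) * ‖f‖ :=
  (setIntegral_mono_set (f.integrableOn_act hc hd hcd).norm
    (Eventually.of_forall fun _ => norm_nonneg _) hS.eventuallyLE).trans
    (f.integral_norm_act_le hc hd hcd)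

/-- On a compact interval, solutions are controlled by their one-sided limits and values at
finitely many points and by the right-hand side of the equation. -/
theorem exists_sideVal_le (q : MatrixMeasure n I) (w : PosMatrixMeasure n I) (hJ : IsUnit J)
    (hI : IsOpen I) {c d : ℝ} (hcd : Icc c d ⊆ I) :
    ∃ P : Finset ℝ, (∀ x ∈ P, x ∈ I) ∧ ∃ C : ℝ, 0 ≤ C ∧ ∀ t ∈ calTmax J q w, ∀ z ∈ Icc c d,
      ∀ σ : SignType, ‖sideVal σ t.1.toFun z‖
        ≤ C * ((∑ x ∈ P, ∑ ρ : SignType, ‖sideVal ρ t.1.toFun x‖) + ‖t.2‖) := by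
  obtain ⟨κ, hκ, hκJ⟩ := exists_norm_le_toEuclideanLin hJ
  -- The property passes to subsets and to unions of two sets, so by compactness it is enough to
  -- find it near each point.
  refine isCompact_Icc.induction_on (p := fun S => ∃ P : Finset ℝ, (∀ x ∈ P, x ∈ I) ∧
    ∃ C : ℝ, 0 ≤ C ∧ ∀ t ∈ calTmax J q w, ∀ z ∈ S,
      ∀ σ : SignType, ‖sideVal σ t.1.toFun z‖
        ≤ C * ((∑ x ∈ P, ∑ ρ : SignType, ‖sideVal ρ t.1.toFun x‖) + ‖t.2‖)) ?_ ?_ ?_ ?_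
  · exact ⟨∅, by simp, 0, le_rfl, by simp⟩
  · rintro S T hST ⟨P, hP, C, hC, h⟩
    exact ⟨P, hP, C, hC, fun t ht z hz => h t ht z (hST hz)⟩
  · classical
    rintro S T ⟨P, hP, C, hC, h⟩ ⟨P', hP', C', hC', h'⟩
    refine ⟨P ∪ P', fun x hx => (Finset.mem_union.1 hx).elim (hP x) (hP' x), C + C',
      by positivity, fun t ht z hz σ => ?_⟩
    have h0 : ∀ x ∈ P ∪ P', 0 ≤ ∑ ρ : SignType, ‖sideVal ρ t.1.toFun x‖ :=
      fun x _ => Finset.sum_nonneg fun _ _ => norm_nonneg _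
    have h1 := Finset.sum_le_sum_of_subset_of_nonneg (Finset.subset_union_left (s₂ := P'))
      fun x hx _ => h0 x hx
    have h2 := Finset.sum_le_sum_of_subset_of_nonneg (Finset.subset_union_right (s₁ := P))
      fun x hx _ => h0 x hx
    have h3 := Finset.sum_nonneg h0
    have h4 := norm_nonneg t.2
    rcases hz with hz | hz
    · refine (h t ht z hz σ).trans ?_
      gcongr
      linarith
    · refine (h' t ht z hz σ).trans ?_
      gcongr
      linarith
  · intro x hx
    have hxI := hcd hx
    obtain ⟨ε, hε, hεI, hq1, hq2⟩ := q.exists_small_nhds hI hκ hxI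
    have hl : x - ε ∈ I := hεI ⟨le_rfl, by linarith⟩
    have hr : x + ε ∈ I := hεI ⟨by linarith, le_rfl⟩
    set K := (∫ y in Icc (x - ε) (x + ε), w.normDensity y ∂w.base) + 1 with hK
    have hK0 : 0 ≤ K := by
      have : 0 ≤ ∫ y in Icc (x - ε) (x + ε), w.normDensity y ∂w.base :=
        integral_nonneg fun y => w.normDensity_nonneg y
      positivity
    -- Near x the data at x alone suffice: points to the right are controlled by the right-hand
    -- limit at x and points to the left by the left-hand limit.
    refine ⟨Ioo (x - ε) (x + ε), mem_nhdsWithin_of_mem_nhds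
      (Ioo_mem_nhds (by linarith) (by linarith)), {x}, by simpa using hxI, 2 * (1 + κ * K),
      by positivity, fun t ht z hz σ => ?_⟩
    obtain ⟨hu, hs⟩ := ht
    rw [Finset.sum_singleton]
    have h0 : ∀ ρ : SignType, ‖sideVal ρ t.1.toFun x‖
        ≤ ∑ ρ : SignType, ‖sideVal ρ t.1.toFun x‖ := fun ρ =>
      Finset.single_le_sum (f := fun ρ : SignType => ‖sideVal ρ t.1.toFun x‖)
        (fun _ _ => norm_nonneg _) (Finset.mem_univ ρ)
    have h4 := norm_nonneg t.2
    have key : ∀ ρ : SignType, ∀ B, B ≤ K * ‖t.2‖ →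
        2 * (‖sideVal ρ t.1.toFun x‖ + κ * B) ≤ 2 * (1 + κ * K)
          * ((∑ ρ : SignType, ‖sideVal ρ t.1.toFun x‖) + ‖t.2‖) := fun ρ B hB => by
      have h5 := h0 ρ
      have h6 : 0 ≤ ∑ ρ : SignType, ‖sideVal ρ t.1.toFun x‖ := (norm_nonneg _).trans h5
      have h7 := mul_le_mul_of_nonneg_left hB hκ.le
      have h8 : 0 ≤ κ * K * ∑ ρ : SignType, ‖sideVal ρ t.1.toFun x‖ := by positivity
      nlinarith
    rcases lt_trichotomy z x with hzx | rfl | hzx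
    · refine (hs.sideVal_le_of_leftLim hI hu hκ hκJ hl hxI
        (fun y hy => hεI ⟨hy.1, by linarith [hy.2]⟩) hq2 ⟨hz.1, hzx⟩ σ).trans (key .neg _ ?_)
      exact t.2.setIntegral_norm_act_le hl hr hεI
        fun y hy => ⟨hy.1.le, by linarith [hy.2]⟩
    · have h5 := h0 σ
      have h6 : 0 ≤ ∑ ρ : SignType, ‖sideVal ρ t.1.toFun z‖ := (norm_nonneg _).trans h5
      have h8 : 0 ≤ κ * K * ((∑ ρ : SignType, ‖sideVal ρ t.1.toFun z‖) + ‖t.2‖) := by positivity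
      nlinarith
    · refine (hs.sideVal_le_of_rightLim hI hu hκ hκJ hxI hr
        (fun y hy => hεI ⟨by linarith [hy.1], hy.2⟩) hq1 ⟨hzx, hz.2⟩ σ).trans (key .pos _ ?_)
      exact t.2.setIntegral_norm_act_le hl hr hεI
        fun y hy => ⟨by linarith [hy.1], hy.2.le⟩

/-- On a compact interval, the variation of a solution is controlled by its supremum and the
right-hand side of the equation. -/
theorem exists_eVariationOn_le (q : MatrixMeasure n I) (w : PosMatrixMeasure n I) (hJ : IsUnit J)
    (hI : IsOpen I) {c d : ℝ} (hc : c ∈ I) (hd : d ∈ I) (hcd : Icc c d ⊆ I) :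
    ∃ C : ℝ, 0 ≤ C ∧ ∀ t ∈ calTmax J q w, ∀ A, 0 ≤ A → (∀ z ∈ Icc c d, ‖t.1.toFun z‖ ≤ A) →
      eVariationOn t.1.toFun (Icc c d) ≤ ENNReal.ofReal (C * (A + ‖t.2‖)) := by
  obtain ⟨κ, hκ, hκJ⟩ := exists_norm_le_toEuclideanLin hJ
  set K := (∫ y in Icc c d, w.normDensity y ∂w.base) + 1
  set L := ∫ y in Icc c d, q.normDensity y ∂q.base
  have hL : 0 ≤ L := integral_nonneg fun y => q.normDensity_nonneg y
  have hK : 0 ≤ K := add_nonneg (integral_nonneg fun y => w.normDensity_nonneg y) zero_le_one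
  refine ⟨κ * (K + L), by positivity, fun t ht A hA0 hA => ?_⟩
  refine (ht.2.eVariationOn_le hI ht.1 hκ hκJ hc hd hcd).trans (ENNReal.ofReal_le_ofReal ?_)
  have h1 := ht.2.sourceMass_le hI hc hd measurableSet_Icc (le_refl (Icc c d)) (le_refl (Icc c d))
    hA0 hA
  have h2 := t.2.integral_norm_act_le hc hd hcd
  have h3 := norm_nonneg t.2
  rw [mul_assoc]
  gcongr
  nlinarith [mul_nonneg hK hA0, mul_nonneg hL h3]

end CompactBounds

/-! ### Solutions of norm zero -/

section NormZero

variable {n : ℕ} {I : Set ℝ} {J : Matrix (Fin n) (Fin n) ℂ} {q : MatrixMeasure n I}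
  {w : PosMatrixMeasure n I} {u f h : ℝ → Cn n}

theorem PosMatrixMeasure.mem_sqIntegrable_of_act_eq_zero
    (hf : AEStronglyMeasurable f (w.base.restrict I)) (h0 : w.act f =ᵐ[w.base.restrict I] 0) :
    f ∈ sqIntegrable w := by
  refine ⟨hf, (integrable_zero ℝ ℂ _).congr ?_⟩
  filter_upwards [h0] with x hx
  rw [PosMatrixMeasure.form, hx]
  exact (inner_zero_right _).symm

/-- By `norm_act_sq_le` the density of f*wf vanishes exactly where wf does. The resulting
almost-everywhere condition survives truncations and is the one checked for limits. -/
theorem CalL2.norm_eq_zero_iff (f : CalL2 w) :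
    ‖f‖ = 0 ↔ w.act f.toFun =ᵐ[w.base.restrict I] 0 := by
  rw [← sq_eq_zero_iff, CalL2.norm_sq, integral_eq_zero_iff_of_nonneg
    (fun x => w.form_self_re_nonneg _ x) (CalL2.integrable_form f f).re]
  refine ⟨fun h => ?_, fun h => ?_⟩
  · filter_upwards [h] with x hx
    have h1 := w.norm_act_sq_le f.toFun x
    change (w.form f.toFun f.toFun x).re = 0 at hx
    rw [hx, mul_zero] at h1
    simpa using h1
  · filter_upwards [h] with x hx
    change (w.form f.toFun f.toFun x).re = 0
    rw [PosMatrixMeasure.form, hx, Pi.zero_apply, inner_zero_right, Complex.zero_re]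

theorem mem_L0_iff : h ∈ L0 J q w ↔ IsBVlocSharp I h ∧ IsSolution J q w h 0 ∧
    AEStronglyMeasurable h (w.base.restrict I) ∧ w.act h =ᵐ[w.base.restrict I] 0 := by
  constructor
  · rintro ⟨h1, h2, h3, h4⟩
    exact ⟨h1, h2, h3.1, (CalL2.norm_eq_zero_iff (CalL2.mk h h3)).1 h4⟩
  · rintro ⟨h1, h2, h3, h4⟩
    have h5 := PosMatrixMeasure.mem_sqIntegrable_of_act_eq_zero h3 h4
    exact ⟨h1, h2, h5, (CalL2.norm_eq_zero_iff (CalL2.mk h h5)).2 h4⟩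

/-- The class of right-hand sides does not matter: `w f` vanishes if `f` has norm zero. -/
theorem IsSolution.to_zero (hI : I.OrdConnected) (hs : IsSolution J q w u f)
    (hf : w.act f =ᵐ[w.base.restrict I] 0) : IsSolution J q w u 0 := by
  intro c hc d hd hcd
  obtain ⟨h1, -, h3⟩ := hs c hc d hd hcd
  have h4 : Ico c d ⊆ I := Ico_subset_Icc_self.trans (hI.out hc hd)
  rw [MatrixMeasure.act_zero]
  refine ⟨h1, integrableOn_zero, ?_⟩
  rw [h3]
  exact integral_congr_ae (hf.filter_mono (ae_mono (Measure.restrict_mono_set _ h4)))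

/-- The pair `(h, 0)` given by a solution of norm zero. -/
def nullPair (hh : h ∈ L0 J q w) : CalL2 w × CalL2 w := (CalL2.mk h hh.2.2.1, 0)

theorem nullPair_mem (hh : h ∈ L0 J q w) : nullPair hh ∈ calTmax J q w := ⟨hh.1, hh.2.1⟩

theorem norm_nullPair (hh : h ∈ L0 J q w) : ‖nullPair hh‖ = 0 := by
  obtain ⟨h0, h1⟩ := hh.2.2
  rw [nullPair, Prod.norm_def]
  simp [h1]

/-- If ‖f‖ = 0 then wf = 0, so the equation becomes homogeneous. Applied to differences, this places
the ambiguity of a representative in 𝓛₀. -/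
theorem mem_L0_of_norm_eq_zero (hI : I.OrdConnected) {t : CalL2 w × CalL2 w}
    (ht : t ∈ calTmax J q w) (h1 : ‖t.1‖ = 0) (h2 : ‖t.2‖ = 0) : t.1.toFun ∈ L0 J q w :=
  ⟨ht.1, ht.2.to_zero hI ((CalL2.norm_eq_zero_iff _).1 h2), t.1.2, h1⟩

theorem L0_add (hI : I.OrdConnected) {g : ℝ → Cn n} (hh : h ∈ L0 J q w) (hg : g ∈ L0 J q w) :
    h + g ∈ L0 J q w := by
  refine mem_L0_of_norm_eq_zero (t := nullPair hh + nullPair hg) hI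
    (add_mem (nullPair_mem hh) (nullPair_mem hg)) ?_ ?_
  · have h1 : ‖(nullPair hh).1‖ = 0 := hh.2.2.2
    have h2 : ‖(nullPair hg).1‖ = 0 := hg.2.2.2
    refine le_antisymm ((norm_add_le _ _).trans ?_) (norm_nonneg _)
    rw [h1, h2, add_zero]
  · change ‖(0 : CalL2 w) + 0‖ = 0
    rw [add_zero, norm_zero]

theorem L0_smul (hI : I.OrdConnected) (c : ℂ) (hh : h ∈ L0 J q w) : c • h ∈ L0 J q w := by
  refine mem_L0_of_norm_eq_zero (t := c • nullPair hh) hI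
    (Submodule.smul_mem _ c (nullPair_mem hh)) ?_ ?_
  · have h1 : ‖(nullPair hh).1‖ = 0 := hh.2.2.2
    change ‖c • (nullPair hh).1‖ = 0
    rw [norm_smul, h1, mul_zero]
  · change ‖c • (0 : CalL2 w)‖ = 0
    rw [smul_zero, norm_zero]

theorem L0_zero : (0 : ℝ → Cn n) ∈ L0 J q w :=
  mem_L0_iff.2 ⟨IsBVlocSharp.zero I, IsSolution.zero, aestronglyMeasurable_const, by
    rw [MatrixMeasure.act_zero]⟩

end NormZero

/-! ### Uniqueness for the homogeneous equation -/

section Uniqueness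

variable {n : ℕ} {I : Set ℝ} {J : Matrix (Fin n) (Fin n) ℂ} {q : MatrixMeasure n I}
  {w : PosMatrixMeasure n I} {h : ℝ → Cn n}

/-- The mass of the matrix measure at `x`. -/
noncomputable def MatrixMeasure.atom (q : MatrixMeasure n I) (x : ℝ) : Matrix (Fin n) (Fin n) ℂ :=
  (q.base.real {x} : ℂ) • q.density x

theorem source_zero_singleton (x : ℝ) :
    source q w h 0 {x} = -Matrix.toEuclideanLin (q.atom x) (h x) := by
  rw [source, MatrixMeasure.act_zero, integral_singleton, integral_singleton, Pi.zero_apply,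
    smul_zero, zero_sub, MatrixMeasure.atom, map_smul, LinearMap.smul_apply, MatrixMeasure.act]
  norm_cast

/-- Insert h(x) = (h⁺ + h⁻)/2 into the atom equation J(h⁺ - h⁻) = -Δh(x): the result is B₊h⁺ = B₋h⁻,
so at a nonsingular point each one-sided limit determines the other. -/
theorem IsSolution.jump_eq (hs : IsSolution J q w h 0) (hI : IsOpen I) (hh : IsBVlocSharp I h)
    {x : ℝ} (hx : x ∈ I) :
    Matrix.toEuclideanLin (J + (1 / 2 : ℂ) • q.atom x) (Function.rightLim h x)
      = Matrix.toEuclideanLin (J + (-1 / 2 : ℂ) • q.atom x) (Function.leftLim h x) := by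
  have h1 := hs.source_singleton hI hh hx
  rw [source_zero_singleton, (hh.2 x hx).eq_half] at h1
  rw [← sub_eq_zero] at h1 ⊢
  rw [← h1]
  simp only [map_add, map_smul, map_sub, LinearMap.add_apply, LinearMap.smul_apply]
  module

theorem eq_zero_of_toEuclideanLin_eq_zero {A : Matrix (Fin n) (Fin n) ℂ} (hA : A.det ≠ 0)
    {v : Cn n} (h : Matrix.toEuclideanLin A v = 0) : v = 0 := by
  obtain ⟨κ, -, hκ⟩ := exists_norm_le_toEuclideanLin
    ((Matrix.isUnit_iff_isUnit_det A).2 (isUnit_iff_ne_zero.2 hA))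
  have h1 := hκ v
  rw [h, norm_zero, mul_zero] at h1
  exact norm_le_zero_iff.1 h1

/-- The local bound with zero initial limit and zero right-hand side. No regularity of x is needed,
because the starting datum is already the limit on the side considered. -/
theorem IsSolution.eventually_right (hs : IsSolution J q w h 0) (hJ : IsUnit J) (hI : IsOpen I)
    (hh : IsBVlocSharp I h) {x : ℝ} (hx : x ∈ I) (h0 : Function.rightLim h x = 0) :
    ∀ᶠ z in 𝓝[>] x, ∀ σ : SignType, sideVal σ h z = 0 := by
  obtain ⟨κ, hκ, hκJ⟩ := exists_norm_le_toEuclideanLin hJ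
  obtain ⟨ε, hε, hεI, hq, -⟩ := q.exists_small_nhds hI hκ hx
  filter_upwards [Ioo_mem_nhdsGT (show x < x + ε by linarith)] with z hz σ
  have h1 := hs.sideVal_le_of_rightLim hI hh hκ hκJ hx (hεI ⟨by linarith, le_rfl⟩)
    (fun y hy => hεI ⟨by linarith [hy.1], hy.2⟩) hq hz σ
  rw [h0, MatrixMeasure.act_zero] at h1
  simpa using h1

theorem IsSolution.eventually_left (hs : IsSolution J q w h 0) (hJ : IsUnit J) (hI : IsOpen I)
    (hh : IsBVlocSharp I h) {x : ℝ} (hx : x ∈ I) (h0 : Function.leftLim h x = 0) :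
    ∀ᶠ z in 𝓝[<] x, ∀ σ : SignType, sideVal σ h z = 0 := by
  obtain ⟨κ, hκ, hκJ⟩ := exists_norm_le_toEuclideanLin hJ
  obtain ⟨ε, hε, hεI, -, hq⟩ := q.exists_small_nhds hI hκ hx
  filter_upwards [Ioo_mem_nhdsLT (show x - ε < x by linarith)] with z hz σ
  have h1 := hs.sideVal_le_of_leftLim hI hh hκ hκJ (hεI ⟨le_rfl, by linarith⟩) hx
    (fun y hy => hεI ⟨hy.1, by linarith [hy.2]⟩) hq hz σ
  rw [h0, MatrixMeasure.act_zero] at h1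
  simpa using h1

/-- A solution of the homogeneous equation which vanishes somewhere in an interval without
singular points vanishes on that interval. -/
theorem IsSolution.eq_zero_of_nonempty (hs : IsSolution J q w h 0) (hJ : IsUnit J)
    (hI : IsOpen I) (hh : IsBVlocSharp I h) {s t : ℝ} (hst : Ioo s t ⊆ I)
    (hgood : ∀ x ∈ Ioo s t, (J + (1 / 2 : ℂ) • q.atom x).det ≠ 0 ∧
      (J + (-1 / 2 : ℂ) • q.atom x).det ≠ 0)
    (hne : ∃ x ∈ Ioo s t, ∀ σ : SignType, sideVal σ h x = 0) :
    ∀ x ∈ Ioo s t, ∀ σ : SignType, sideVal σ h x = 0 := by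
  set O : Set ℝ := {x | x ∈ Ioo s t ∧ ∀ σ : SignType, sideVal σ h x = 0} with hO
  -- Invertibility of both matrices carries a zero limit across the point, from either side. The set
  -- O then turns out to be open and relatively closed in a connected interval.
  have hall : ∀ x ∈ Ioo s t, Function.leftLim h x = 0 ∨ Function.rightLim h x = 0 → x ∈ O := by
    intro x hx h0
    have hj := hs.jump_eq hI hh (hst hx)
    obtain ⟨g1, g2⟩ := hgood x hx
    have h1 : Function.leftLim h x = 0 ∧ Function.rightLim h x = 0 := by
      rcases h0 with h0 | h0
      · rw [h0, map_zero] at hj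
        exact ⟨h0, eq_zero_of_toEuclideanLin_eq_zero g1 hj⟩
      · rw [h0, map_zero] at hj
        exact ⟨eq_zero_of_toEuclideanLin_eq_zero g2 hj.symm, h0⟩
    refine ⟨hx, fun σ => ?_⟩
    cases σ
    · change h x = 0
      rw [(hh.2 x (hst hx)).eq_half, h1.1, h1.2, add_zero, smul_zero]
    · exact h1.1
    · exact h1.2
  have hopen : IsOpen O := by
    rw [isOpen_iff_mem_nhds]
    rintro x ⟨hx, hx0⟩
    have h1 := hs.eventually_left hJ hI hh (hst hx) (hx0 .neg)
    have h2 := hs.eventually_right hJ hI hh (hst hx) (hx0 .pos)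
    have h3 : ∀ᶠ z in 𝓝[≠] x, ∀ σ : SignType, sideVal σ h z = 0 := by
      rw [← nhdsLT_sup_nhdsGT]
      exact Filter.eventually_sup.2 ⟨h1, h2⟩
    have h4 : ∀ᶠ z in 𝓝 x, ∀ σ : SignType, sideVal σ h z = 0 := by
      rw [eventually_nhdsWithin_iff] at h3
      filter_upwards [h3] with z hz
      rcases eq_or_ne z x with rfl | hzx
      · exact hx0
      · exact hz hzx
    filter_upwards [h4, isOpen_Ioo.mem_nhds hx] with z hz hz' using ⟨hz', hz⟩
  have hclosed : closure O ∩ Ioo s t ⊆ O := by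
    rintro x ⟨hxc, hx⟩
    by_contra hxO
    -- A limit point of O outside O is approached by zeros of h from at least one side, which forces
    -- the limit on that side to be zero.
    have h1 : ∃ᶠ z in 𝓝[≠] x, z ∈ O := by
      rw [frequently_nhdsWithin_iff]
      refine (mem_closure_iff_frequently.1 hxc).mono fun z hz => ⟨hz, ?_⟩
      rintro rfl
      exact hxO hz
    rw [← nhdsLT_sup_nhdsGT, frequently_sup] at h1
    refine hxO (hall x hx ?_)
    rcases h1 with h1 | h1
    · left
      exact isClosed_singleton.mem_of_frequently_of_tendsto
        (h1.mono fun z hz => (hz.2 .zero : h z = 0)) (hh.2 x (hst hx)).tendsto_left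
    · right
      exact isClosed_singleton.mem_of_frequently_of_tendsto
        (h1.mono fun z hz => (hz.2 .zero : h z = 0)) (hh.2 x (hst hx)).tendsto_right
  obtain ⟨x, hx, hx0⟩ := hne
  have := isPreconnected_Ioo.subset_of_closure_inter_subset hopen ⟨x, hx, hx, hx0⟩ hclosed
  exact fun y hy => (this hy).2

theorem IsSolution.eq_zero_of_rightLim (hs : IsSolution J q w h 0) (hJ : IsUnit J)
    (hI : IsOpen I) (hh : IsBVlocSharp I h) {s t : ℝ} (hs' : s ∈ I) (hst' : s < t)
    (hst : Ioo s t ⊆ I)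
    (hgood : ∀ x ∈ Ioo s t, (J + (1 / 2 : ℂ) • q.atom x).det ≠ 0 ∧
      (J + (-1 / 2 : ℂ) • q.atom x).det ≠ 0) (h0 : Function.rightLim h s = 0) :
    ∀ x ∈ Ioo s t, ∀ σ : SignType, sideVal σ h x = 0 := by
  refine hs.eq_zero_of_nonempty hJ hI hh hst hgood ?_
  obtain ⟨x, hx⟩ := ((hs.eventually_right hJ hI hh hs' h0).and (Ioo_mem_nhdsGT hst')).exists
  exact ⟨x, hx.2, hx.1⟩

theorem IsSolution.eq_zero_of_leftLim (hs : IsSolution J q w h 0) (hJ : IsUnit J)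
    (hI : IsOpen I) (hh : IsBVlocSharp I h) {s t : ℝ} (ht' : t ∈ I) (hst' : s < t)
    (hst : Ioo s t ⊆ I)
    (hgood : ∀ x ∈ Ioo s t, (J + (1 / 2 : ℂ) • q.atom x).det ≠ 0 ∧
      (J + (-1 / 2 : ℂ) • q.atom x).det ≠ 0) (h0 : Function.leftLim h t = 0) :
    ∀ x ∈ Ioo s t, ∀ σ : SignType, sideVal σ h x = 0 := by
  refine hs.eq_zero_of_nonempty hJ hI hh hst hgood ?_
  obtain ⟨x, hx⟩ := ((hs.eventually_left hJ hI hh ht' h0).and (Ioo_mem_nhdsLT hst')).exists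
  exact ⟨x, hx.2, hx.1⟩

end Uniqueness

/-! ### Truncation of solutions -/

section Truncation

variable {n : ℕ} {I : Set ℝ} {J : Matrix (Fin n) (Fin n) ℂ} {q : MatrixMeasure n I}
  {w : PosMatrixMeasure n I} {h : ℝ → Cn n} {τ : ℝ}

theorem boundedVariationOn_indicator_const (v : Cn n) (S : Set ℝ) (τ : ℝ) :
    BoundedVariationOn ((Iic τ).indicator fun _ => v) S ∧
      BoundedVariationOn ((Ici τ).indicator fun _ => v) S := by
  constructor
  · refine ne_top_of_le_ne_top ENNReal.ofReal_ne_top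
      (eVariationOn_le_of_norm_sub_le (A := ‖v‖) (G := fun x => if x ≤ τ then 0 else ‖v‖)
        (fun x _ y _ hxy => ?_) fun x _ y _ hxy => ?_)
    · by_cases h1 : x ≤ τ <;> by_cases h2 : y ≤ τ <;> simp [indicator, h1, h2]
      linarith
    · have := norm_nonneg v
      by_cases h1 : x ≤ τ <;> by_cases h2 : y ≤ τ <;> simp [h1, h2]
  · refine ne_top_of_le_ne_top ENNReal.ofReal_ne_top
      (eVariationOn_le_of_norm_sub_le (A := ‖v‖) (G := fun x => if τ ≤ x then ‖v‖ else 0)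
        (fun x _ y _ hxy => ?_) fun x _ y _ hxy => ?_)
    · by_cases h1 : τ ≤ x <;> by_cases h2 : τ ≤ y <;> simp [indicator, h1, h2]
      linarith
    · have := norm_nonneg v
      by_cases h1 : τ ≤ x <;> by_cases h2 : τ ≤ y <;> simp [h1, h2]

theorem boundedVariationOn_point (v : Cn n) (S : Set ℝ) (τ : ℝ) :
    BoundedVariationOn (fun x => if x = τ then v else 0) S := by
  have hc : BoundedVariationOn (fun _ : ℝ => -v) S := by
    rw [BoundedVariationOn, eVariationOn.constant_on]
    · exact ENNReal.zero_ne_top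
    · rintro _ ⟨x, -, rfl⟩ _ ⟨y, -, rfl⟩
      rfl
  have e : (fun x => if x = τ then v else 0)
      = (Iic τ).indicator (fun _ => v) + ((Ici τ).indicator (fun _ => v) + fun _ => -v) := by
    funext x
    rcases lt_trichotomy x τ with hx | rfl | hx
    · simp [indicator, hx.le, hx.not_ge, hx.ne]
    · simp [indicator]
    · simp [indicator, hx.le, hx.not_ge, hx.ne']
  rw [e]
  exact boundedVariationOn_add (boundedVariationOn_indicator_const _ _ _).1
    (boundedVariationOn_add (boundedVariationOn_indicator_const _ _ _).2 hc)

/-- Composing h with the monotone map x ↦ max(x, τ) does not increase the variation; the truncation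
differs from this composition by a step of height h(τ) and a correction at the single point τ. -/
theorem locallyBoundedVariationOn_indicator_Ici (hh : LocallyBoundedVariationOn h I) (hτ : τ ∈ I) :
    LocallyBoundedVariationOn ((Ici τ).indicator h) I := by
  intro c d hc hd
  have hc' : min c τ ∈ I := by rcases min_choice c τ with e | e <;> rwa [e]
  have hd' : max d τ ∈ I := by rcases max_choice d τ with e | e <;> rwa [e]
  have hmax : BoundedVariationOn (h ∘ fun x => max x τ) (I ∩ Icc c d) := by
    refine ne_top_of_le_ne_top (hh _ _ hc' hd') (eVariationOn.comp_le_of_monotoneOn h _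
      (fun x _ y _ hxy => max_le_max hxy le_rfl) fun x hx => ⟨?_, ?_, ?_⟩)
    · rcases max_choice x τ with e | e
      · rw [e]; exact hx.1
      · rwa [e]
    · exact (min_le_right _ _).trans (le_max_right _ _)
    · exact max_le_max hx.2.2 le_rfl
  have e : (Ici τ).indicator h = (h ∘ fun x => max x τ)
      + ((Iic τ).indicator (fun _ => -h τ) + (fun x => if x = τ then h τ else 0)) := by
    funext x
    rcases lt_trichotomy x τ with hx | rfl | hx
    · simp [indicator, hx.le, hx.not_ge, hx.ne]
    · simp [indicator]
    · simp [indicator, hx.le, hx.not_ge, hx.ne']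
  rw [e]
  exact boundedVariationOn_add hmax (boundedVariationOn_add
    (boundedVariationOn_indicator_const _ _ _).1 (boundedVariationOn_point _ _ _))

theorem locallyBoundedVariationOn_indicator_Iic (hh : LocallyBoundedVariationOn h I) (hτ : τ ∈ I) :
    LocallyBoundedVariationOn ((Iic τ).indicator h) I := by
  have e : (Iic τ).indicator h
      = h + ((-1 : ℂ) • (Ici τ).indicator h + (fun x => if x = τ then h τ else 0)) := by
    funext x
    rcases lt_trichotomy x τ with hx | rfl | hx
    · simp [indicator, hx.le, hx.not_ge, hx.ne]
    · simp [indicator]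
    · simp [indicator, hx.le, hx.not_ge, hx.ne']
  intro c d hc hd
  rw [e]
  exact boundedVariationOn_add (hh c d hc hd) (boundedVariationOn_add (boundedVariationOn_smul _
    (locallyBoundedVariationOn_indicator_Ici hh hτ c d hc hd)) (boundedVariationOn_point _ _ _))

theorem indicator_Ici_eventuallyEq {x : ℝ} (hx : τ < x) : (Ici τ).indicator h =ᶠ[𝓝 x] h := by
  filter_upwards [Ioi_mem_nhds hx] with y hy
  exact indicator_of_mem (mem_Ici.2 (le_of_lt hy)) h

theorem indicator_Ici_eventuallyEq_zero {x : ℝ} (hx : x < τ) :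
    (Ici τ).indicator h =ᶠ[𝓝 x] 0 := by
  filter_upwards [Iio_mem_nhds hx] with y hy
  exact indicator_of_notMem (fun h => not_lt_of_ge (mem_Ici.1 h) hy) _

theorem indicator_Iic_eventuallyEq {x : ℝ} (hx : x < τ) : (Iic τ).indicator h =ᶠ[𝓝 x] h := by
  filter_upwards [Iio_mem_nhds hx] with y hy
  exact indicator_of_mem (mem_Iic.2 (le_of_lt hy)) h

theorem indicator_Iic_eventuallyEq_zero {x : ℝ} (hx : τ < x) :
    (Iic τ).indicator h =ᶠ[𝓝 x] 0 := by
  filter_upwards [Ioi_mem_nhds hx] with y hy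
  exact indicator_of_notMem (fun h => not_lt_of_ge (mem_Iic.1 h) hy) _

theorem tendsto_indicator_Ici_left : Tendsto ((Ici τ).indicator h) (𝓝[<] τ) (𝓝 0) :=
  tendsto_const_nhds.congr' (eventually_nhdsWithin_of_forall fun _ hy =>
    (indicator_of_notMem (fun h => not_lt_of_ge (mem_Ici.1 h) hy) h).symm)

theorem tendsto_indicator_Ici_right {r : Cn n} (hr : Tendsto h (𝓝[>] τ) (𝓝 r)) :
    Tendsto ((Ici τ).indicator h) (𝓝[>] τ) (𝓝 r) :=
  hr.congr' (eventually_nhdsWithin_of_forall fun _ hy =>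
    (indicator_of_mem (mem_Ici.2 (le_of_lt hy)) h).symm)

theorem tendsto_indicator_Iic_right : Tendsto ((Iic τ).indicator h) (𝓝[>] τ) (𝓝 0) :=
  tendsto_const_nhds.congr' (eventually_nhdsWithin_of_forall fun _ hy =>
    (indicator_of_notMem (fun h => not_lt_of_ge (mem_Iic.1 h) hy) h).symm)

theorem tendsto_indicator_Iic_left {l : Cn n} (hl : Tendsto h (𝓝[<] τ) (𝓝 l)) :
    Tendsto ((Iic τ).indicator h) (𝓝[<] τ) (𝓝 l) :=
  hl.congr' (eventually_nhdsWithin_of_forall fun _ hy =>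
    (indicator_of_mem (mem_Iic.2 (le_of_lt hy)) h).symm)

/-- Since h⁻(τ) = 0, the value h(τ) is already the mean of 0 and h⁺(τ), so cutting at τ with τ
included keeps the function balanced there. -/
theorem IsBVlocSharp.indicator_Ici (hh : IsBVlocSharp I h) (hτ : τ ∈ I)
    (h0 : Function.leftLim h τ = 0) : IsBVlocSharp I ((Ici τ).indicator h) := by
  refine ⟨locallyBoundedVariationOn_indicator_Ici hh.1 hτ, fun x hx => ?_⟩
  rcases lt_trichotomy x τ with hxτ | rfl | hxτ
  · exact (IsBalancedAt.zero x).congr_nhds (indicator_Ici_eventuallyEq_zero hxτ)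
  · refine ⟨0, _, tendsto_indicator_Ici_left,
      tendsto_indicator_Ici_right (hh.2 x hx).tendsto_right, ?_⟩
    rw [indicator_of_mem self_mem_Ici, (hh.2 x hx).eq_half, h0]
  · exact (hh.2 x hx).congr_nhds (indicator_Ici_eventuallyEq hxτ)

theorem IsBVlocSharp.indicator_Iic (hh : IsBVlocSharp I h) (hτ : τ ∈ I)
    (h0 : Function.rightLim h τ = 0) : IsBVlocSharp I ((Iic τ).indicator h) := by
  refine ⟨locallyBoundedVariationOn_indicator_Iic hh.1 hτ, fun x hx => ?_⟩
  rcases lt_trichotomy x τ with hxτ | rfl | hxτ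
  · exact (hh.2 x hx).congr_nhds (indicator_Iic_eventuallyEq hxτ)
  · refine ⟨_, 0, tendsto_indicator_Iic_left (hh.2 x hx).tendsto_left,
      tendsto_indicator_Iic_right, ?_⟩
    rw [indicator_of_mem self_mem_Iic, (hh.2 x hx).eq_half, h0]
  · exact (IsBalancedAt.zero x).congr_nhds (indicator_Iic_eventuallyEq_zero hxτ)

theorem MatrixMeasure.act_indicator (M : MatrixMeasure n I) (S : Set ℝ) (u : ℝ → Cn n) :
    M.act (S.indicator u) = S.indicator (M.act u) := by
  funext x
  by_cases hx : x ∈ S <;> simp [MatrixMeasure.act, hx]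

theorem IsSolution.integral_eq (hs : IsSolution J q w h 0) {c d : ℝ} (hc : c ∈ I) (hd : d ∈ I)
    (hcd : c < d) : Matrix.toEuclideanLin J (Function.leftLim h d - Function.leftLim h c)
      + ∫ x in Ico c d, q.act h x ∂q.base = 0 := by
  rw [(hs c hc d hd hcd).2.2, MatrixMeasure.act_zero]
  simp

/-- The truncation has zero left-hand limits up to and including τ, just as h has at τ, so the
equation on [c, d) reduces to that of h on [τ, d) when τ lies inside. -/
theorem IsSolution.indicator_Ici (hs : IsSolution J q w h 0) (hh : IsBVlocSharp I h)
    (hτ : τ ∈ I) (h0 : Function.leftLim h τ = 0) :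
    IsSolution J q w ((Ici τ).indicator h) 0 := by
  have hlow : ∀ x, x ≤ τ → Function.leftLim ((Ici τ).indicator h) x = 0 := fun x hx => by
    rcases hx.lt_or_eq with hx | rfl
    · exact leftLim_eq_of_tendsto (tendsto_const_nhds.congr'
        ((indicator_Ici_eventuallyEq_zero hx).symm.filter_mono nhdsWithin_le_nhds))
    · exact leftLim_eq_of_tendsto tendsto_indicator_Ici_left
  have hup : ∀ x ∈ I, τ < x → Function.leftLim ((Ici τ).indicator h) x = Function.leftLim h x :=
    fun x hx hτx => sideVal_congr_nhds (indicator_Ici_eventuallyEq hτx) .neg (hh.2 x hx)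
  intro c hc d hd hcd
  refine ⟨?_, (hs c hc d hd hcd).2.1, ?_⟩
  · rw [MatrixMeasure.act_indicator]
    exact (hs c hc d hd hcd).1.indicator measurableSet_Ici
  rw [MatrixMeasure.act_indicator, setIntegral_indicator measurableSet_Ici, MatrixMeasure.act_zero]
  simp only [Pi.zero_apply, integral_zero]
  rcases le_or_gt d τ with hdτ | hdτ
  · have e : Ico c d ∩ Ici τ = ∅ :=
      eq_empty_of_forall_notMem fun x hx => (hx.1.2.trans_le hdτ).not_ge hx.2
    rw [e, hlow d hdτ, hlow c (hcd.le.trans hdτ)]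
    simp
  rcases le_or_gt c τ with hcτ | hcτ
  · have e : Ico c d ∩ Ici τ = Ico τ d :=
      Subset.antisymm (fun x hx => ⟨hx.2, hx.1.2⟩) fun x hx => ⟨⟨hcτ.trans hx.1, hx.2⟩, hx.1⟩
    have h1 := hs.integral_eq hτ hd hdτ
    rw [h0] at h1
    rw [e, hup d hd hdτ, hlow c hcτ, h1]
  · have e : Ico c d ∩ Ici τ = Ico c d := inter_eq_left.2 fun x hx => hcτ.le.trans hx.1
    rw [e, hup d hd hdτ, hup c hc hcτ]
    exact hs.integral_eq hc hd hcd

/-- Not a mirror image of the other truncation: the equation is stated on intervals [c, d), which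
are cut here to the closed interval [c, τ]. This calls for the form of the equation with the
right-hand limit at τ, assumed zero. -/
theorem IsSolution.indicator_Iic (hs : IsSolution J q w h 0) (hI : IsOpen I)
    (hh : IsBVlocSharp I h) (hτ : τ ∈ I) (h0 : Function.rightLim h τ = 0) :
    IsSolution J q w ((Iic τ).indicator h) 0 := by
  have hup : ∀ x, τ < x → Function.leftLim ((Iic τ).indicator h) x = 0 := fun x hx =>
    leftLim_eq_of_tendsto (tendsto_const_nhds.congr'
      ((indicator_Iic_eventuallyEq_zero hx).symm.filter_mono nhdsWithin_le_nhds))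
  have hlow : ∀ x ∈ I, x ≤ τ →
      Function.leftLim ((Iic τ).indicator h) x = Function.leftLim h x := fun x hx hxτ => by
    rcases hxτ.lt_or_eq with hxτ | rfl
    · exact sideVal_congr_nhds (indicator_Iic_eventuallyEq hxτ) .neg (hh.2 x hx)
    · exact leftLim_eq_of_tendsto (tendsto_indicator_Iic_left (hh.2 x hx).tendsto_left)
  intro c hc d hd hcd
  refine ⟨?_, (hs c hc d hd hcd).2.1, ?_⟩
  · rw [MatrixMeasure.act_indicator]
    exact (hs c hc d hd hcd).1.indicator measurableSet_Iic
  rw [MatrixMeasure.act_indicator, setIntegral_indicator measurableSet_Iic, MatrixMeasure.act_zero]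
  simp only [Pi.zero_apply, integral_zero]
  rcases le_or_gt d τ with hdτ | hdτ
  · have e : Ico c d ∩ Iic τ = Ico c d := inter_eq_left.2 fun x hx => hx.2.le.trans hdτ
    rw [e, hlow d hd hdτ, hlow c hc (hcd.le.trans hdτ)]
    exact hs.integral_eq hc hd hcd
  rcases le_or_gt c τ with hcτ | hcτ
  · have e : Ico c d ∩ Iic τ = Icc c τ :=
      Subset.antisymm (fun x hx => ⟨hx.1.1, hx.2⟩) fun x hx => ⟨⟨hx.1, hx.2.trans_lt hdτ⟩, hx.2⟩
    have e2 : Matrix.toEuclideanLin J (Function.rightLim h τ - Function.leftLim h c)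
        = source q w h 0 (Icc c τ) := by
      rcases hcτ.lt_or_eq with hcτ | rfl
      · exact hs.source_Icc hI hh hc hτ hcτ
      · rw [Icc_self]
        exact hs.source_singleton hI hh hc
    rw [h0] at e2
    rw [e, hup d hdτ, hlow c hc hcτ, e2, source, MatrixMeasure.act_zero]
    simp
  · have e : Ico c d ∩ Iic τ = ∅ :=
      eq_empty_of_forall_notMem fun x hx => (hcτ.trans_le hx.1.1).not_ge hx.2
    rw [e, hup d hdτ, hup c hcτ]
    simp

theorem L0_indicator_Ici (hh : h ∈ L0 J q w) (hτ : τ ∈ I) (h0 : Function.leftLim h τ = 0) :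
    (Ici τ).indicator h ∈ L0 J q w := by
  obtain ⟨h1, h2, h3, h4⟩ := mem_L0_iff.1 hh
  refine mem_L0_iff.2 ⟨h1.indicator_Ici hτ h0, h2.indicator_Ici h1 hτ h0,
    h3.indicator measurableSet_Ici, ?_⟩
  rw [MatrixMeasure.act_indicator]
  filter_upwards [h4] with x hx
  by_cases hxτ : x ∈ Ici τ <;> simp [hxτ, hx]

theorem L0_indicator_Iic (hI : IsOpen I) (hh : h ∈ L0 J q w) (hτ : τ ∈ I)
    (h0 : Function.rightLim h τ = 0) : (Iic τ).indicator h ∈ L0 J q w := by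
  obtain ⟨h1, h2, h3, h4⟩ := mem_L0_iff.1 hh
  refine mem_L0_iff.2 ⟨h1.indicator_Iic hτ h0, h2.indicator_Iic hI h1 hτ h0,
    h3.indicator measurableSet_Iic, ?_⟩
  rw [MatrixMeasure.act_indicator]
  filter_upwards [h4] with x hx
  by_cases hxτ : x ∈ Iic τ <;> simp [hxτ, hx]

end Truncation

/-! ### Uniqueness of distinguished representatives -/

section Distinguished

variable {n : ℕ} {I : Set ℝ} {J : Matrix (Fin n) (Fin n) ℂ} {q : MatrixMeasure n I}
  {w : PosMatrixMeasure n I} {h : ℝ → Cn n} {τ : ℤ → ℝ}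

/-- The hypotheses on the sequence `τ`: it exhausts `I` and contains all singular points, and the
point `τ 0` carries no mass of `q`. -/
structure IsAdmissible (J : Matrix (Fin n) (Fin n) ℂ) (q : MatrixMeasure n I) (τ : ℤ → ℝ) :
    Prop where
  isUnit : IsUnit J
  isOpen : IsOpen I
  ordConnected : I.OrdConnected
  strictMono : StrictMono τ
  mem : ∀ k, τ k ∈ I
  exhaust : ∀ x ∈ I, ∃ m : ℕ, τ (-m) < x ∧ x < τ m
  good : ∀ x ∈ I, (∀ k, τ k ≠ x) → (J + (1 / 2 : ℂ) • q.atom x).det ≠ 0 ∧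
    (J + (-1 / 2 : ℂ) • q.atom x).det ≠ 0
  atom_zero : q.atom (τ 0) = 0

theorem IsAdmissible.Ioo_subset (H : IsAdmissible J q τ) (k : ℤ) : Ioo (τ k) (τ (k + 1)) ⊆ I :=
  Ioo_subset_Icc_self.trans (H.ordConnected.out (H.mem _) (H.mem _))

theorem IsAdmissible.good_Ioo (H : IsAdmissible J q τ) (k : ℤ) :
    ∀ x ∈ Ioo (τ k) (τ (k + 1)), (J + (1 / 2 : ℂ) • q.atom x).det ≠ 0 ∧
      (J + (-1 / 2 : ℂ) • q.atom x).det ≠ 0 := by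
  intro x hx
  refine H.good x (H.Ioo_subset k hx) ?_
  rintro j rfl
  have h1 := H.strictMono.lt_iff_lt.1 hx.1
  have h2 := H.strictMono.lt_iff_lt.1 hx.2
  omega

theorem inner_self_of_condition {k : ℤ} (hc : Condition J q w τ k h)
    (hN : valueAt τ k h ∈ N J q w τ k) : valueAt τ k h = 0 :=
  inner_self_eq_zero.1 (hc _ hN)

/-- A solution of norm zero satisfying all conditions vanishes. -/
theorem eq_zero_of_forall_condition (H : IsAdmissible J q τ) (hh : h ∈ L0 J q w)
    (hc : ∀ k, Condition J q w τ k h) : ∀ x ∈ I, h x = 0 := by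
  obtain ⟨h1, h2, -⟩ := mem_L0_iff.1 hh
  have hmem := H.mem
  have hz : h (τ 0) = 0 := by
    have := inner_self_of_condition (hc 0) ⟨h, hh, by simp, by simp, rfl⟩
    rwa [valueAt, if_pos rfl] at this
  -- Without an atom of q at τ_0, J annihilates the jump of h. Hence h(τ_0) = 0 starts the
  -- propagation in both directions.
  have hlr : Function.rightLim h (τ 0) = Function.leftLim h (τ 0) := by
    have h3 := h2.jump_eq H.isOpen h1 (hmem 0)
    rw [H.atom_zero, smul_zero, smul_zero, add_zero, ← sub_eq_zero, ← map_sub] at h3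
    exact sub_eq_zero.1 (eq_zero_of_toEuclideanLin_eq_zero
      ((Matrix.isUnit_iff_isUnit_det J).1 H.isUnit).ne_zero h3)
  have hl0 : Function.leftLim h (τ 0) = 0 := by
    have h3 := (h1.2 _ (hmem 0)).eq_half
    rw [hz, hlr, ← two_smul ℂ, smul_smul] at h3
    norm_num at h3
    exact h3.symm
  have hright : ∀ k : ℕ, Function.rightLim h (τ k) = 0 ∧ ∀ x ∈ Icc (τ 0) (τ k), h x = 0 := by
    intro k
    induction k with
    | zero =>
      refine ⟨by simpa [hlr] using hl0, fun x hx => ?_⟩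
      have : x = τ 0 := le_antisymm (by simpa using hx.2) hx.1
      rw [this, hz]
    | succ k ih =>
      have hlt : τ (k : ℤ) < τ ((k : ℤ) + 1) := H.strictMono (by omega)
      have h3 := h2.eq_zero_of_rightLim H.isUnit H.isOpen h1 (hmem k) hlt (H.Ioo_subset k)
        (H.good_Ioo k) ih.1
      have h4 : Function.leftLim h (τ ((k : ℤ) + 1)) = 0 :=
        leftLim_eq_of_tendsto (tendsto_const_nhds.congr' (by
          filter_upwards [Ioo_mem_nhdsLT hlt] with x hx using (h3 x hx .zero).symm))
      have h5 : Function.rightLim h (τ ((k : ℤ) + 1)) = 0 := by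
        have hpos : 0 < (k : ℤ) + 1 := by omega
        have e : ∀ g : ℝ → Cn n, valueAt τ ((k : ℤ) + 1) g = Function.rightLim g (τ ((k : ℤ) + 1)) :=
          fun g => by rw [valueAt, if_neg hpos.ne', if_pos hpos]
        rw [← e]
        -- The truncation of h to [τ_{k+1}, b) witnesses that the right-hand limit of h lies in
        -- N_{k+1}, to which the condition makes it orthogonal.
        refine inner_self_of_condition (hc _) ⟨_, L0_indicator_Ici hh (hmem _) h4,
          fun _ x _ hx => indicator_of_notMem (fun h => (mem_Ici.1 h).not_gt hx) _,
          fun h => absurd h hpos.not_gt, ?_⟩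
        rw [e, e]
        exact rightLim_eq_of_tendsto (tendsto_indicator_Ici_right (h1.2 _ (hmem _)).tendsto_right)
      push_cast
      refine ⟨h5, fun x hx => ?_⟩
      rcases le_or_gt x (τ k) with hxk | hxk
      · exact ih.2 x ⟨hx.1, hxk⟩
      · rcases hx.2.lt_or_eq with hx2 | rfl
        · exact h3 x ⟨hxk, hx2⟩ .zero
        · rw [(h1.2 _ (hmem _)).eq_half, h4, h5, add_zero, smul_zero]
  have hleft : ∀ k : ℕ, Function.leftLim h (τ (-k)) = 0 ∧
      ∀ x ∈ Icc (τ (-k)) (τ 0), h x = 0 := by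
    intro k
    induction k with
    | zero =>
      refine ⟨by simpa using hl0, fun x hx => ?_⟩
      have : x = τ 0 := le_antisymm hx.2 (by simpa using hx.1)
      rw [this, hz]
    | succ k ih =>
      have ek : (-((k : ℤ) + 1)) + 1 = -k := by ring
      have hlt : τ (-((k : ℤ) + 1)) < τ (-k) := H.strictMono (by omega)
      have hs := H.Ioo_subset (-((k : ℤ) + 1))
      have hg := H.good_Ioo (-((k : ℤ) + 1))
      rw [ek] at hs hg
      have h3 := h2.eq_zero_of_leftLim H.isUnit H.isOpen h1 (hmem _) hlt hs hg ih.1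
      have h4 : Function.rightLim h (τ (-((k : ℤ) + 1))) = 0 :=
        rightLim_eq_of_tendsto (tendsto_const_nhds.congr' (by
          filter_upwards [Ioo_mem_nhdsGT hlt] with x hx using (h3 x hx .zero).symm))
      have h5 : Function.leftLim h (τ (-((k : ℤ) + 1))) = 0 := by
        have hneg : -((k : ℤ) + 1) < 0 := by omega
        have e : ∀ g : ℝ → Cn n,
            valueAt τ (-((k : ℤ) + 1)) g = Function.leftLim g (τ (-((k : ℤ) + 1))) :=
          fun g => by rw [valueAt, if_neg hneg.ne, if_neg hneg.not_gt]
        rw [← e]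
        refine inner_self_of_condition (hc _) ⟨_, L0_indicator_Iic H.isOpen hh (hmem _) h4,
          fun h => absurd h hneg.not_gt,
          fun _ x _ hx => indicator_of_notMem (fun h => (mem_Iic.1 h).not_gt hx) _, ?_⟩
        rw [e, e]
        exact leftLim_eq_of_tendsto (tendsto_indicator_Iic_left (h1.2 _ (hmem _)).tendsto_left)
      push_cast
      refine ⟨h5, fun x hx => ?_⟩
      rcases lt_or_ge x (τ (-k)) with hxk | hxk
      · rcases hx.1.lt_or_eq with hx2 | rfl
        · exact h3 x ⟨hx2, hxk⟩ .zero
        · rw [(h1.2 _ (hmem _)).eq_half, h4, h5, add_zero, smul_zero]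
      · exact ih.2 x ⟨hxk, hx.2⟩
  intro x hx
  obtain ⟨m, hm1, hm2⟩ := H.exhaust x hx
  rcases le_total x (τ 0) with hx0 | hx0
  · exact (hleft m).2 x ⟨hm1.le, hx0⟩
  · exact (hright m).2 x ⟨hx0, hm2.le⟩

end Distinguished

/-! ### Functionals of point evaluations -/

/-- A nonzero value f g could be rescaled within the complex subspace to equal s itself. -/
theorem eq_zero_of_forall_re_lt {E : Type*} [AddCommGroup E] [Module ℂ E] {G : Submodule ℂ E}
    {f : E →ₗ[ℂ] ℂ} {s : ℝ} (h : ∀ g ∈ G, (f g).re < s) : ∀ g ∈ G, f g = 0 := by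
  intro g hg
  by_contra hne
  have h1 := h (((s : ℂ) / f g) • g) (G.smul_mem _ hg)
  rw [map_smul, smul_eq_mul, div_mul_cancel₀ _ hne, Complex.ofReal_re] at h1
  exact lt_irrefl _ h1

/-- If `y` is annihilated by all finitely supported functionals which are bounded on the range of
`D`, then `y` can be approximated, at finitely many indices, by the images of small vectors. -/
theorem exists_small_norm_approx {T ι : Type*} [SeminormedAddCommGroup T] [NormedSpace ℂ T]
    (D : T →ₗ[ℂ] (ι → ℂ)) {y : ι → ℂ}
    (hy : ∀ φ : ι →₀ ℂ, (∃ C, ∀ t, ‖Finsupp.linearCombination ℂ (D t) φ‖ ≤ C * ‖t‖) →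
      Finsupp.linearCombination ℂ y φ = 0)
    (P : Finset ι) {ε : ℝ} (hε : 0 < ε) :
    ∃ t : T, ‖t‖ < ε ∧ ∀ j ∈ P, ‖D t j - y j‖ < ε := by
  classical
  let res : (ι → ℂ) →ₗ[ℂ] (P → ℂ) := LinearMap.funLeft ℂ ℂ Subtype.val
  -- The range of L is the graph of D restricted to P. The claim is that (0, y restricted to P) lies
  -- in its closure; otherwise Hahn-Banach separates the two.
  let L : T →ₗ[ℂ] T × (P → ℂ) := LinearMap.prod LinearMap.id (res ∘ₗ D)
  set x : T × (P → ℂ) := (0, res y) with hx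
  by_cases hmem : x ∈ (LinearMap.range L).topologicalClosure
  · have h1 : x ∈ closure (LinearMap.range L : Set (T × (P → ℂ))) := hmem
    obtain ⟨_, ⟨t, rfl⟩, ht⟩ := Metric.mem_closure_iff.1 h1 ε hε
    rw [dist_comm, dist_eq_norm, Prod.norm_def, max_lt_iff] at ht
    refine ⟨t, by simpa [L, hx] using ht.1, fun j hj => ?_⟩
    exact (norm_le_pi_norm ((L t - x).2) ⟨j, hj⟩).trans_lt ht.2
  · exfalso
    obtain ⟨f, s, hf1, hf2⟩ := RCLike.geometric_hahn_banach_closed_point (𝕜 := ℂ)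
      ((LinearMap.range L).topologicalClosure.restrictScalars ℝ).convex
      (LinearMap.range L).isClosed_topologicalClosure hmem
    have hf0 : ∀ t, f (L t) = 0 := fun t =>
      eq_zero_of_forall_re_lt (f := (f : (T × (P → ℂ)) →ₗ[ℂ] ℂ))
        (G := (LinearMap.range L).topologicalClosure) hf1 _
        ((LinearMap.range L).le_topologicalClosure ⟨t, rfl⟩)
    have hs : 0 < s := by
      have := hf1 0 (Submodule.zero_mem _)
      simpa using this
    have hfx : f x ≠ 0 := fun h => by
      rw [h] at hf2
      simp at hf2
      linarith
    let φ : ι →₀ ℂ := ∑ j : P, Finsupp.single (j : ι) (f (0, Pi.single j 1))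
    have hφ : ∀ z : ι → ℂ, Finsupp.linearCombination ℂ z φ = f (0, res z) := by
      intro z
      have e : ((0 : T), res z) = ∑ j : P, z j • ((0 : T), (Pi.single j 1 : P → ℂ)) := by
        refine Prod.ext (by simp [Prod.fst_sum]) ?_
        funext k
        simp [Prod.snd_sum, res, LinearMap.funLeft, Finset.sum_apply, Pi.single_apply]
      rw [e, map_sum, map_sum]
      refine Finset.sum_congr rfl fun j _ => ?_
      rw [Finsupp.linearCombination_single, map_smul, smul_eq_mul, smul_eq_mul, mul_comm]
    -- As f vanishes on the graph, φ(D t) = -f(t, 0), so φ is bounded by ‖f‖ and must annihilate y.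
    -- But φ(y) is the value f x, which is nonzero.
    refine hfx ((hφ y).symm.trans (hy φ ⟨‖f‖, fun t => ?_⟩))
    have e : ((0 : T), res (D t)) = L t - (t, 0) := by
      refine Prod.ext (by simp [L]) (by simp [L])
    rw [hφ, e, map_sub, hf0, zero_sub, norm_neg]
    refine (f.le_opNorm _).trans_eq ?_
    congr 1
    simp [Prod.norm_def]

/-! ### Bounded functionals of the data and uniform approximation -/

section Data

variable {n : ℕ} {I : Set ℝ} {J : Matrix (Fin n) (Fin n) ℂ} {q : MatrixMeasure n I}
  {w : PosMatrixMeasure n I}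

/-- The indices of the scalar data of a function on `I`: a point, a side and a component. -/
abbrev DataIndex (n : ℕ) (I : Set ℝ) : Type := I × SignType × Fin n

variable (I) in
/-- The values and the one-sided limits of `u` at the points of `I`. -/
noncomputable def sideData (u : ℝ → Cn n) : DataIndex n I → ℂ :=
  fun j => sideVal j.2.1 u j.1 j.2.2

variable (J q w) in
/-- The data of the first component of an element of the maximal relation. -/
noncomputable def dataMap : calTmax J q w →ₗ[ℂ] (DataIndex n I → ℂ) where
  toFun t := sideData I t.1.1.toFun
  map_add' t t' := by
    funext j
    exact congrArg (fun v : Cn n => v j.2.2)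
      ((t.2.1.2 j.1 j.1.2).sideVal_add (t'.2.1.2 j.1 j.1.2) j.2.1)
  map_smul' c t := by
    funext j
    exact congrArg (fun v : Cn n => v j.2.2) ((t.2.1.2 j.1 j.1.2).sideVal_smul c j.2.1)

variable (J q w) in
/-- The finitely supported functionals of the data which are bounded on the maximal relation. -/
def boundedFunctionals : Submodule ℂ (DataIndex n I →₀ ℂ) where
  carrier := {φ | ∃ C, ∀ t, ‖Finsupp.linearCombination ℂ (dataMap J q w t) φ‖ ≤ C * ‖t‖}
  add_mem' := by
    rintro φ ψ ⟨C, hC⟩ ⟨C', hC'⟩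
    refine ⟨C + C', fun t => ?_⟩
    rw [map_add, add_mul]
    exact (norm_add_le _ _).trans (add_le_add (hC t) (hC' t))
  zero_mem' := ⟨0, fun t => by simp⟩
  smul_mem' := by
    rintro c φ ⟨C, hC⟩
    refine ⟨‖c‖ * C, fun t => ?_⟩
    rw [map_smul, norm_smul, mul_assoc]
    exact mul_le_mul_of_nonneg_left (hC t) (norm_nonneg c)

/-- The pair (h, 0) has seminorm zero, so a bounded functional has no choice. -/
theorem linearCombination_sideData_of_mem_L0 {h : ℝ → Cn n} (hh : h ∈ L0 J q w)
    {φ : DataIndex n I →₀ ℂ} (hφ : φ ∈ boundedFunctionals J q w) :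
    Finsupp.linearCombination ℂ (sideData I h) φ = 0 := by
  obtain ⟨C, hC⟩ := hφ
  have h1 := hC ⟨nullPair hh, nullPair_mem hh⟩
  have h2 : ‖(⟨nullPair hh, nullPair_mem hh⟩ : calTmax J q w)‖ = 0 := norm_nullPair hh
  rw [h2, mul_zero] at h1
  exact norm_le_zero_iff.1 h1

open Classical in
/-- The function with the given data. -/
noncomputable def ofData (y : DataIndex n I → ℂ) (σ : SignType) (x : ℝ) : Cn n :=
  if hx : x ∈ I then WithLp.toLp 2 fun i => y (⟨x, hx⟩, σ, i) else 0

theorem ofData_apply (y : DataIndex n I → ℂ) (σ : SignType) {x : ℝ} (hx : x ∈ I) (i : Fin n) :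
    ofData y σ x i = y (⟨x, hx⟩, σ, i) := by
  rw [ofData, dif_pos hx]

theorem norm_coe_snd_le (t : calTmax J q w) : ‖t.1.2‖ ≤ ‖t‖ := norm_snd_le t.1

theorem norm_coe_fst_le (t : calTmax J q w) : ‖t.1.1‖ ≤ ‖t‖ := norm_fst_le t.1

/-- If all bounded functionals annihilate `y`, then on every compact interval `y` is uniformly
approximated by elements of the maximal relation of small norm. -/
theorem exists_uniform_approx (hJ : IsUnit J) (hI : IsOpen I) {y : DataIndex n I → ℂ}
    (hy : ∀ φ ∈ boundedFunctionals J q w, Finsupp.linearCombination ℂ y φ = 0) {c d : ℝ}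
    (hcd : Icc c d ⊆ I) {ε : ℝ} (hε : 0 < ε) :
    ∃ t : calTmax J q w, ‖t‖ < ε ∧ ∀ z ∈ Icc c d, ∀ σ : SignType,
      ‖sideVal σ t.1.1.toFun z - ofData y σ z‖ < ε := by
  classical
  obtain ⟨P, hP, C, hC, hbound⟩ := exists_sideVal_le q w hJ hI hcd
  set F : Finset (DataIndex n I) := P.subtype (· ∈ I) ×ˢ Finset.univ with hF
  -- Two δ-approximations differ by at most 2δ in each scalar datum over P; the last 2 accounts for
  -- the second components.
  set M : ℝ := (∑ _x ∈ P, ∑ _ρ : SignType, ∑ _i : Fin n, (2 : ℝ)) + 2 with hM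
  have hM0 : 0 ≤ M := by
    have : (0 : ℝ) ≤ ∑ _x ∈ P, ∑ _ρ : SignType, ∑ _i : Fin n, (2 : ℝ) :=
      Finset.sum_nonneg fun _ _ => Finset.sum_nonneg fun _ _ => Finset.sum_nonneg fun _ _ =>
        by norm_num
    linarith
  set δ : ℝ := ε / ((n + 1) * (C * M + 1) + 1) with hδ
  have hδ0 : 0 < δ := by positivity
  obtain ⟨t, ht, htF⟩ := exists_small_norm_approx (dataMap J q w) hy F hδ0
  have hsmall : ((n : ℝ) + 1) * (C * M + 1) * δ < ε := by
    have h1 : ((n + 1) * (C * M + 1) + 1) * δ = ε := by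
      rw [hδ]
      field_simp
    linarith
  have hδε : δ ≤ ε := by
    have : (1 : ℝ) ≤ (n + 1) * (C * M + 1) := by
      have h1 : (1 : ℝ) ≤ (n : ℝ) + 1 := by linarith [Nat.cast_nonneg (α := ℝ) n]
      have h2 : 1 ≤ C * M + 1 := by linarith [mul_nonneg hC hM0]
      nlinarith
    nlinarith
  refine ⟨t, ht.trans_le hδε, fun z hz σ => ?_⟩
  have hzI := hcd hz
  have hcoord : ∀ i, ‖(sideVal σ t.1.1.toFun z - ofData y σ z) i‖ ≤ (C * M + 1) * δ := by
    intro i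
    -- The element t is fixed before z. An auxiliary t', depending on z, approximates y at the datum
    -- in question as well as on F; then t - t' is small on F and in norm, hence small at z by the
    -- compact bound.
    obtain ⟨t', ht', htF'⟩ := exists_small_norm_approx (dataMap J q w) hy
      (insert (⟨z, hzI⟩, σ, i) F) hδ0
    have h1 := htF' _ (Finset.mem_insert_self _ _)
    have h2 := hbound _ (t - t').2 z hz σ
    have hsub : ∀ x ∈ I, ∀ ρ : SignType, sideVal ρ (t - t').1.1.toFun x
        = sideVal ρ t.1.1.toFun x - sideVal ρ t'.1.1.toFun x := fun x hx ρ =>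
      (t.2.1.2 x hx).sideVal_sub (t'.2.1.2 x hx) ρ
    have h3 : (∑ x ∈ P, ∑ ρ : SignType, ‖sideVal ρ (t - t').1.1.toFun x‖) + ‖(t - t').1.2‖
        ≤ M * δ := by
      have h4 : ‖(t - t').1.2‖ ≤ 2 * δ :=
        (norm_coe_snd_le (t - t')).trans ((norm_sub_le _ _).trans (by linarith))
      rw [hM, add_mul, Finset.sum_mul]
      refine add_le_add (Finset.sum_le_sum fun x hx => ?_) h4
      rw [Finset.sum_mul]
      refine Finset.sum_le_sum fun ρ _ => ?_
      rw [Finset.sum_mul]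
      refine (norm_le_sum_norm _).trans (Finset.sum_le_sum fun k _ => ?_)
      rw [hsub x (hP x hx)]
      have hmem : ((⟨x, hP x hx⟩, ρ, k) : DataIndex n I) ∈ F := by
        simp [hF, hx]
      have h5 := htF _ hmem
      have h6 := htF' _ (Finset.mem_insert_of_mem hmem)
      have h7 := norm_sub_le (dataMap J q w t (⟨x, hP x hx⟩, ρ, k) - y (⟨x, hP x hx⟩, ρ, k))
        (dataMap J q w t' (⟨x, hP x hx⟩, ρ, k) - y (⟨x, hP x hx⟩, ρ, k))
      rw [sub_sub_sub_cancel_right] at h7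
      change ‖dataMap J q w t (⟨x, hP x hx⟩, ρ, k) - dataMap J q w t' (⟨x, hP x hx⟩, ρ, k)‖ ≤ _
      linarith
    have h4 := h2.trans (mul_le_mul_of_nonneg_left h3 hC)
    rw [hsub z hzI] at h4
    have h5 := (norm_apply_le _ i).trans h4
    have e : (sideVal σ t.1.1.toFun z - ofData y σ z) i
        = (sideVal σ t.1.1.toFun z - sideVal σ t'.1.1.toFun z) i
          + (dataMap J q w t' (⟨z, hzI⟩, σ, i) - y (⟨z, hzI⟩, σ, i)) := by
      rw [PiLp.sub_apply, PiLp.sub_apply, ofData_apply y σ hzI]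
      change _ = _ + (sideVal σ t'.1.1.toFun z i - _)
      ring
    rw [e]
    refine (norm_add_le _ _).trans ?_
    rw [add_mul, one_mul, mul_assoc]
    exact add_le_add h5 h1.le
  calc ‖sideVal σ t.1.1.toFun z - ofData y σ z‖
      ≤ ∑ i, ‖(sideVal σ t.1.1.toFun z - ofData y σ z) i‖ := norm_le_sum_norm _
    _ ≤ ∑ _i : Fin n, (C * M + 1) * δ := Finset.sum_le_sum fun i _ => hcoord i
    _ = n * ((C * M + 1) * δ) := by simp
    _ ≤ (n + 1) * (C * M + 1) * δ := by
        have : 0 ≤ (C * M + 1) * δ := by positivity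
        nlinarith
    _ < ε := hsmall

end Data

/-! ### Limits of elements of small norm are solutions of norm zero -/

section Limit

variable {n : ℕ} {I : Set ℝ} {J : Matrix (Fin n) (Fin n) ℂ} {q : MatrixMeasure n I}
  {w : PosMatrixMeasure n I}

theorem eq_zero_of_forall_norm_le {E : Type*} [NormedAddCommGroup E] {x : E} {M : ℝ}
    (h : ∀ ε : ℝ, 0 < ε → ‖x‖ ≤ M * ε) : x = 0 := by
  refine norm_le_zero_iff.1 (le_of_forall_pos_le_add fun ε hε => ?_)
  have h1 : 0 < ε / (|M| + 1) := by positivity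
  refine (h _ h1).trans ?_
  rw [zero_add, ← mul_div_assoc, div_le_iff₀ (by positivity)]
  nlinarith [le_abs_self M]

/-- On every compact subinterval, the one-sided data `Y` are uniformly approximated by elements
of the maximal relation of small norm. -/
def IsNullLimit (J : Matrix (Fin n) (Fin n) ℂ) (q : MatrixMeasure n I) (w : PosMatrixMeasure n I)
    (Y : SignType → ℝ → Cn n) : Prop :=
  ∀ c d, Icc c d ⊆ I → ∀ ε : ℝ, 0 < ε → ∃ t : calTmax J q w, ‖t‖ < ε ∧
    ∀ z ∈ Icc c d, ∀ σ : SignType, ‖sideVal σ t.1.1.toFun z - Y σ z‖ < ε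

variable {Y : SignType → ℝ → Cn n}

/-- An ε/3 argument: the approximation is uniform in the point and in the side, so the two limits
may be interchanged. -/
theorem IsNullLimit.tendsto_left (hY : IsNullLimit J q w Y) (hI : IsOpen I) {x : ℝ} (hx : x ∈ I) :
    Tendsto (Y .zero) (𝓝[<] x) (𝓝 (Y .neg x)) := by
  obtain ⟨δ, hδ, hδI⟩ := Metric.nhds_basis_closedBall.mem_iff.1 (hI.mem_nhds hx)
  rw [Real.closedBall_eq_Icc] at hδI
  rw [Metric.tendsto_nhds]
  intro ε hε
  obtain ⟨t, -, ht⟩ := hY _ _ hδI (ε / 3) (by positivity)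
  have h1 := Metric.tendsto_nhds.1 (t.2.1.2 x hx).tendsto_left (ε / 3) (by positivity)
  filter_upwards [h1, Ioo_mem_nhdsLT (show x - δ < x by linarith)] with z hz hzδ
  have h2 := ht z ⟨hzδ.1.le, by linarith [hzδ.2]⟩ .zero
  have h3 := ht x ⟨by linarith, by linarith⟩ .neg
  rw [← dist_eq_norm] at h2 h3
  rw [dist_comm] at h2
  have h4 := dist_triangle4 (Y .zero z) (sideVal .zero t.1.1.toFun z) (sideVal .neg t.1.1.toFun x)
    (Y .neg x)
  change dist (sideVal .zero t.1.1.toFun z) (sideVal .neg t.1.1.toFun x) < ε / 3 at hz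
  linarith

theorem IsNullLimit.tendsto_right (hY : IsNullLimit J q w Y) (hI : IsOpen I) {x : ℝ}
    (hx : x ∈ I) : Tendsto (Y .zero) (𝓝[>] x) (𝓝 (Y .pos x)) := by
  obtain ⟨δ, hδ, hδI⟩ := Metric.nhds_basis_closedBall.mem_iff.1 (hI.mem_nhds hx)
  rw [Real.closedBall_eq_Icc] at hδI
  rw [Metric.tendsto_nhds]
  intro ε hε
  obtain ⟨t, -, ht⟩ := hY _ _ hδI (ε / 3) (by positivity)
  have h1 := Metric.tendsto_nhds.1 (t.2.1.2 x hx).tendsto_right (ε / 3) (by positivity)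
  filter_upwards [h1, Ioo_mem_nhdsGT (show x < x + δ by linarith)] with z hz hzδ
  have h2 := ht z ⟨by linarith [hzδ.1], hzδ.2.le⟩ .zero
  have h3 := ht x ⟨by linarith, by linarith⟩ .pos
  rw [← dist_eq_norm] at h2 h3
  rw [dist_comm] at h2
  have h4 := dist_triangle4 (Y .zero z) (sideVal .zero t.1.1.toFun z) (sideVal .pos t.1.1.toFun x)
    (Y .pos x)
  change dist (sideVal .zero t.1.1.toFun z) (sideVal .pos t.1.1.toFun x) < ε / 3 at hz
  linarith

theorem IsNullLimit.eq_half (hY : IsNullLimit J q w Y) {x : ℝ} (hx : x ∈ I) :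
    Y .zero x = (1 / 2 : ℂ) • (Y .neg x + Y .pos x) := by
  rw [← sub_eq_zero]
  refine eq_zero_of_forall_norm_le (M := 2) fun ε hε => ?_
  obtain ⟨t, -, ht⟩ := hY x x (by simpa using hx) ε hε
  have h (σ : SignType) := (ht x ⟨le_rfl, le_rfl⟩ σ).le
  have hb : sideVal .zero t.1.1.toFun x
      = (1 / 2 : ℂ) • (sideVal .neg t.1.1.toFun x + sideVal .pos t.1.1.toFun x) :=
    (t.2.1.2 x hx).eq_half
  have e : Y .zero x - (1 / 2 : ℂ) • (Y .neg x + Y .pos x)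
      = (1 / 2 : ℂ) • ((sideVal .neg t.1.1.toFun x - Y .neg x)
        + (sideVal .pos t.1.1.toFun x - Y .pos x)) - (sideVal .zero t.1.1.toFun x - Y .zero x) := by
    rw [hb]
    module
  rw [e]
  refine (norm_sub_le _ _).trans ?_
  have e2 : ‖(1 / 2 : ℂ)‖ = 1 / 2 := by norm_num
  rw [norm_smul, e2]
  have h1 := norm_add_le (sideVal .neg t.1.1.toFun x - Y .neg x)
    (sideVal .pos t.1.1.toFun x - Y .pos x)
  linarith [h .neg, h .pos, h .zero]

theorem IsNullLimit.isBalancedAt (hY : IsNullLimit J q w Y) (hI : IsOpen I) {x : ℝ}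
    (hx : x ∈ I) : IsBalancedAt (Y .zero) x :=
  ⟨_, _, hY.tendsto_left hI hx, hY.tendsto_right hI hx, hY.eq_half hx⟩

theorem IsNullLimit.sideVal_eq (hY : IsNullLimit J q w Y) (hI : IsOpen I) {x : ℝ}
    (hx : x ∈ I) (σ : SignType) : sideVal σ (Y .zero) x = Y σ x := by
  cases σ
  · rfl
  · exact leftLim_eq_of_tendsto (hY.tendsto_left hI hx)
  · exact rightLim_eq_of_tendsto (hY.tendsto_right hI hx)

theorem IsNullLimit.exists_norm_le (hY : IsNullLimit J q w Y) {c d : ℝ} (hc : c ∈ I) (hd : d ∈ I)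
    (hcd : Icc c d ⊆ I) : ∃ A, 0 ≤ A ∧ ∀ z ∈ Icc c d, ‖Y .zero z‖ ≤ A := by
  obtain ⟨t, -, ht⟩ := hY c d hcd 1 one_pos
  obtain ⟨A, hA⟩ := t.2.1.exists_norm_le hc hd
  refine ⟨max (A + 1) 0, le_max_right _ _, fun z hz => le_max_of_le_left ?_⟩
  have h1 := (ht z hz .zero).le
  have h2 := hA z ⟨hcd hz, hz⟩
  rw [norm_sub_rev] at h1
  have h3 := norm_le_norm_add_norm_sub' (Y .zero z) (sideVal .zero t.1.1.toFun z)
  change ‖sideVal .zero t.1.1.toFun z‖ ≤ A at h2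
  linarith

theorem IsNullLimit.exists_seq (hY : IsNullLimit J q w Y) {c d : ℝ} (hcd : Icc c d ⊆ I) :
    ∃ t : ℕ → calTmax J q w, ∀ k, ‖t k‖ ≤ 1 ∧
      (∀ z ∈ Icc c d, ‖(t k).1.1.toFun z - Y .zero z‖ ≤ 1) ∧
      ∀ z ∈ Icc c d, Tendsto (fun k => (t k).1.1.toFun z) atTop (𝓝 (Y .zero z)) := by
  choose t ht1 ht2 using fun k : ℕ => hY c d hcd (1 / ((k : ℝ) + 1)) (by positivity)
  have hk : ∀ k : ℕ, 1 / ((k : ℝ) + 1) ≤ 1 := fun k => by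
    rw [div_le_one (by positivity)]
    linarith [Nat.cast_nonneg (α := ℝ) k]
  refine ⟨t, fun k => ⟨(ht1 k).le.trans (hk k),
    fun z hz => (ht2 k z hz .zero).le.trans (hk k), fun z hz => ?_⟩⟩
  rw [tendsto_iff_norm_sub_tendsto_zero]
  exact squeeze_zero (fun _ => norm_nonneg _) (fun k => (ht2 k z hz .zero).le)
    tendsto_one_div_add_atTop_nhds_zero_nat

/-- On a compact interval the approximants have a common bound for supremum and norm, hence for the
variation, and variation is lower semicontinuous under pointwise convergence. -/
theorem IsNullLimit.isBVlocSharp (hY : IsNullLimit J q w Y) (hJ : IsUnit J) (hI : IsOpen I)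
    (hI' : I.OrdConnected) : IsBVlocSharp I (Y .zero) := by
  refine ⟨fun c d hc hd => ?_, fun x hx => hY.isBalancedAt hI hx⟩
  have hcd := hI'.out hc hd
  obtain ⟨A, hA0, hA⟩ := hY.exists_norm_le hc hd hcd
  obtain ⟨C, hC0, hC⟩ := exists_eVariationOn_le (J := J) q w hJ hI hc hd hcd
  obtain ⟨t, ht⟩ := hY.exists_seq hcd
  rw [inter_eq_right.2 hcd]
  refine ne_top_of_le_ne_top (ENNReal.ofReal_ne_top (r := C * (A + 1 + 1))) (le_of_forall_lt ?_)
  intro v hv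
  obtain ⟨k, hk⟩ := (eVariationOn.lowerSemicontinuous_aux (fun x hx => (ht 0).2.2 x hx) hv).exists
  refine hk.trans_le ((hC _ (t k).2 (A + 1) (by positivity) fun z hz => ?_).trans ?_)
  · have h1 := (ht k).2.1 z hz
    have h2 := norm_le_norm_add_norm_sub' ((t k).1.1.toFun z) (Y .zero z)
    linarith [hA z hz]
  · refine ENNReal.ofReal_le_ofReal (mul_le_mul_of_nonneg_left ?_ hC0)
    linarith [(norm_coe_snd_le (t k)).trans (ht k).1]

theorem MatrixMeasure.continuous_act (M : MatrixMeasure n I) (x : ℝ) :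
    Continuous fun v : Cn n => Matrix.toEuclideanLin (M.density x) v :=
  LinearMap.continuous_of_finiteDimensional _

theorem MatrixMeasure.integrableOn_act_of_tendsto (M : MatrixMeasure n I) {v : ℝ → Cn n}
    {u : ℕ → ℝ → Cn n} {c d A : ℝ} (hc : c ∈ I) (hd : d ∈ I)
    (hu : ∀ k, AEStronglyMeasurable (M.act (u k)) (M.base.restrict (Icc c d)))
    (hv : ∀ z ∈ Icc c d, Tendsto (fun k => u k z) atTop (𝓝 (v z)))
    (hA : ∀ z ∈ Icc c d, ‖v z‖ ≤ A) : IntegrableOn (M.act v) (Icc c d) M.base := by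
  refine Integrable.mono' ((M.integrableOn_normDensity hc hd).mul_const A)
    (aestronglyMeasurable_of_tendsto_ae atTop hu ?_) ?_
  · refine ae_restrict_of_forall_mem measurableSet_Icc fun z hz => ?_
    exact ((M.continuous_act z).tendsto _).comp (hv z hz)
  · refine ae_restrict_of_forall_mem measurableSet_Icc fun z hz => ?_
    exact (M.norm_act_le v z).trans
      (mul_le_mul_of_nonneg_left (hA z hz) (M.normDensity_nonneg z))

theorem MatrixMeasure.integral_norm_act_sub_le (M : MatrixMeasure n I) {u v : ℝ → Cn n}
    {c d ε : ℝ} (hc : c ∈ I) (hd : d ∈ I)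
    (hu : IntegrableOn (M.act u) (Icc c d) M.base) (hv : IntegrableOn (M.act v) (Icc c d) M.base)
    (hε : 0 ≤ ε) (huv : ∀ z ∈ Icc c d, ‖u z - v z‖ ≤ ε) {S : Set ℝ} (hS : MeasurableSet S)
    (hS' : S ⊆ Icc c d) :
    ∫ x in S, ‖M.act u x - M.act v x‖ ∂M.base
      ≤ (∫ x in Icc c d, M.normDensity x ∂M.base) * ε := by
  rw [← integral_mul_const]
  have h1 := (M.integrableOn_normDensity hc hd).mul_const ε
  calc ∫ x in S, ‖M.act u x - M.act v x‖ ∂M.base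
      ≤ ∫ x in S, M.normDensity x * ε ∂M.base := by
        refine setIntegral_mono_on ((hu.mono_set hS').sub (hv.mono_set hS')).norm
          (IntegrableOn.mono_set h1 hS') hS fun x hx => ?_
        have h2 := M.norm_act_le (u - v) x
        rw [M.act_sub] at h2
        exact h2.trans (mul_le_mul_of_nonneg_left (huv x (hS' hx)) (M.normDensity_nonneg x))
    _ ≤ _ := setIntegral_mono_set h1
        (Eventually.of_forall fun x => mul_nonneg (M.normDensity_nonneg x) hε) hS'.eventuallyLE

theorem CalL2.aestronglyMeasurable_restrict (f : CalL2 w) {S : Set ℝ} (hS : S ⊆ I) :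
    AEStronglyMeasurable f.toFun (w.base.restrict S) :=
  f.2.1.mono_measure (Measure.restrict_mono_set _ hS)

/-- The integral of |wY| is at most that of |w(Y - u)| plus that of |wu|; uniform closeness makes
the first small and the small norm of u the second. -/
theorem IsNullLimit.act_ae_eq_zero (hY : IsNullLimit J q w Y) {c d : ℝ} (hc : c ∈ I) (hd : d ∈ I)
    (hcd : Icc c d ⊆ I) : w.act (Y .zero) =ᵐ[w.base.restrict (Icc c d)] 0 := by
  obtain ⟨A, hA0, hA⟩ := hY.exists_norm_le hc hd hcd
  obtain ⟨s, hs⟩ := hY.exists_seq hcd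
  have hint : IntegrableOn (w.act (Y .zero)) (Icc c d) w.base :=
    w.integrableOn_act_of_tendsto hc hd
      (fun k => ((s k).1.1.integrableOn_act hc hd hcd).1) (fun z hz => (hs 0).2.2 z hz) hA
  have h0 : ∫ x in Icc c d, ‖w.act (Y .zero) x‖ ∂w.base = 0 := by
    refine eq_zero_of_forall_norm_le (M := (∫ x in Icc c d, w.normDensity x ∂w.base)
      + ((∫ x in Icc c d, w.normDensity x ∂w.base) + 1)) fun ε hε => ?_
    obtain ⟨t, ht1, ht2⟩ := hY c d hcd ε hε
    have hu := t.1.1.integrableOn_act hc hd hcd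
    have h1 := w.integral_norm_act_sub_le hc hd hu hint hε.le (fun z hz => (ht2 z hz .zero).le)
      measurableSet_Icc le_rfl
    have h2 := t.1.1.integral_norm_act_le hc hd hcd
    have hK : 0 ≤ (∫ x in Icc c d, w.normDensity x ∂w.base) + 1 :=
      add_nonneg (integral_nonneg fun x => w.normDensity_nonneg x) zero_le_one
    have h3 := mul_le_mul_of_nonneg_left ((norm_coe_fst_le t).trans ht1.le) hK
    rw [Real.norm_of_nonneg (integral_nonneg fun _ => norm_nonneg _), add_mul]
    refine le_trans ?_ (add_le_add h1 (h2.trans h3))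
    have hd1 : IntegrableOn (fun x => ‖w.act t.1.1.toFun x - w.act (Y .zero) x‖) (Icc c d) w.base :=
      (hu.sub hint).norm
    have hd2 : IntegrableOn (fun x => ‖w.act t.1.1.toFun x‖) (Icc c d) w.base := hu.norm
    rw [← integral_add hd1 hd2]
    refine integral_mono hint.norm (hd1.add hd2) fun x => ?_
    have h4 := norm_le_norm_add_norm_sub' (w.act (Y .zero) x) (w.act t.1.1.toFun x)
    rw [norm_sub_rev] at h4
    change ‖w.act (Y .zero) x‖ ≤ ‖w.act t.1.1.toFun x - w.act (Y .zero) x‖ + ‖w.act t.1.1.toFun x‖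
    linarith
  rw [integral_eq_zero_iff_of_nonneg (fun _ => norm_nonneg _) hint.norm] at h0
  filter_upwards [h0] with x hx
  exact norm_eq_zero.1 hx

theorem IsNullLimit.isSolution (hY : IsNullLimit J q w Y) (hI : IsOpen I)
    (hI' : I.OrdConnected) : IsSolution J q w (Y .zero) 0 := by
  intro c hc d hd hlt
  have hcd := hI'.out hc hd
  obtain ⟨A, hA0, hA⟩ := hY.exists_norm_le hc hd hcd
  obtain ⟨s, hs⟩ := hY.exists_seq hcd
  have hint : IntegrableOn (q.act (Y .zero)) (Icc c d) q.base :=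
    q.integrableOn_act_of_tendsto hc hd
      (fun k => ((s k).2.2.integrableOn_left hI hc hd).1) (fun z hz => (hs 0).2.2 z hz) hA
  rw [MatrixMeasure.act_zero]
  refine ⟨hint.mono_set Ico_subset_Icc_self, integrableOn_zero, ?_⟩
  simp only [Pi.zero_apply, integral_zero]
  set L := LinearMap.toContinuousLinearMap (Matrix.toEuclideanLin J) with hL
  change L (Function.leftLim (Y .zero) d - Function.leftLim (Y .zero) c) + _ = 0
  have hl : ∀ x ∈ I, Function.leftLim (Y .zero) x = Y .neg x := fun x hx =>
    hY.sideVal_eq hI hx .neg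
  rw [hl c hc, hl d hd]
  set K := (∫ x in Icc c d, w.normDensity x ∂w.base) + 1 with hK
  have hK0 : 0 ≤ K := add_nonneg (integral_nonneg fun x => w.normDensity_nonneg x) zero_le_one
  refine eq_zero_of_forall_norm_le
    (M := ‖L‖ * 2 + (∫ x in Icc c d, q.normDensity x ∂q.base) + K) fun ε hε => ?_
  obtain ⟨t, ht1, ht2⟩ := hY c d hcd ε hε
  have hu := t.2.2.integrableOn_left hI hc hd
  have h1 : ‖∫ x in Ico c d, (q.act t.1.1.toFun x - q.act (Y .zero) x) ∂q.base‖
      ≤ (∫ x in Icc c d, q.normDensity x ∂q.base) * ε :=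
    (norm_integral_le_integral_norm _).trans
      (q.integral_norm_act_sub_le hc hd hu hint hε.le (fun z hz => (ht2 z hz .zero).le)
        measurableSet_Ico Ico_subset_Icc_self)
  rw [integral_sub (hu.mono_set Ico_subset_Icc_self) (hint.mono_set Ico_subset_Icc_self)] at h1
  have h2 : ‖∫ x in Ico c d, w.act t.1.2.toFun x ∂w.base‖ ≤ K * ε :=
    ((norm_integral_le_integral_norm _).trans
      (t.1.2.setIntegral_norm_act_le hc hd hcd Ico_subset_Icc_self)).trans
      (mul_le_mul_of_nonneg_left ((norm_coe_snd_le t).trans ht1.le) hK0)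
  have h3 : ‖L ((Y .neg d - Y .neg c)
      - (Function.leftLim t.1.1.toFun d - Function.leftLim t.1.1.toFun c))‖ ≤ ‖L‖ * (2 * ε) := by
    refine (L.le_opNorm _).trans (mul_le_mul_of_nonneg_left ?_ (norm_nonneg _))
    have h4 := (ht2 c ⟨le_rfl, hlt.le⟩ .neg).le
    have h5 := (ht2 d ⟨hlt.le, le_rfl⟩ .neg).le
    have e : (Y .neg d - Y .neg c)
        - (Function.leftLim t.1.1.toFun d - Function.leftLim t.1.1.toFun c)
        = (sideVal .neg t.1.1.toFun c - Y .neg c) - (sideVal .neg t.1.1.toFun d - Y .neg d) := by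
      change _ = (Function.leftLim t.1.1.toFun c - Y .neg c)
        - (Function.leftLim t.1.1.toFun d - Y .neg d)
      abel
    rw [e]
    exact (norm_sub_le _ _).trans (by linarith)
  have h6 : L (Function.leftLim t.1.1.toFun d - Function.leftLim t.1.1.toFun c)
      + ∫ x in Ico c d, q.act t.1.1.toFun x ∂q.base = ∫ x in Ico c d, w.act t.1.2.toFun x ∂w.base :=
    (t.2.2 c hc d hd hlt).2.2
  -- Subtracting the equation of the approximant expresses the defect of Y through three terms of
  -- order ε: the error in the limits, the error in qu, and the small right-hand side wf.
  have e : L (Y .neg d - Y .neg c) + ∫ x in Ico c d, q.act (Y .zero) x ∂q.base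
      = L ((Y .neg d - Y .neg c)
          - (Function.leftLim t.1.1.toFun d - Function.leftLim t.1.1.toFun c))
        - ((∫ x in Ico c d, q.act t.1.1.toFun x ∂q.base) - ∫ x in Ico c d, q.act (Y .zero) x ∂q.base)
        + ∫ x in Ico c d, w.act t.1.2.toFun x ∂w.base := by
    rw [← h6, map_sub L (Y .neg d - Y .neg c)]
    abel
  rw [e]
  refine (norm_add_le _ _).trans ?_
  have h7 := norm_sub_le (L ((Y .neg d - Y .neg c)
    - (Function.leftLim t.1.1.toFun d - Function.leftLim t.1.1.toFun c)))
    ((∫ x in Ico c d, q.act t.1.1.toFun x ∂q.base) - ∫ x in Ico c d, q.act (Y .zero) x ∂q.base)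
  nlinarith

/-- A function all of whose compact restrictions are limits of small elements of the maximal
relation is a solution of norm zero. -/
theorem IsNullLimit.mem_L0 (hY : IsNullLimit J q w Y) {τ : ℤ → ℝ} (H : IsAdmissible J q τ) :
    Y .zero ∈ L0 J q w := by
  -- A countable exhaustion by compact intervals, so that measurability and the almost-everywhere
  -- identity, known on each of them, hold on I.
  have hU : I = ⋃ m : ℕ, Icc (τ (-m)) (τ m) := by
    refine Subset.antisymm (fun x hx => ?_) (iUnion_subset fun m => H.ordConnected.out (H.mem _)
      (H.mem _))
    obtain ⟨m, h1, h2⟩ := H.exhaust x hx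
    exact mem_iUnion.2 ⟨m, h1.le, h2.le⟩
  have hsub : ∀ m : ℕ, Icc (τ (-m)) (τ m) ⊆ I := fun m => H.ordConnected.out (H.mem _) (H.mem _)
  refine mem_L0_iff.2 ⟨hY.isBVlocSharp H.isUnit H.isOpen H.ordConnected,
    hY.isSolution H.isOpen H.ordConnected, ?_, ?_⟩
  · have h1 : AEStronglyMeasurable (Y .zero)
        (w.base.restrict (⋃ m : ℕ, Icc (τ (-m)) (τ m))) := by
      rw [aestronglyMeasurable_iUnion_iff]
      intro m
      obtain ⟨s, hs⟩ := hY.exists_seq (hsub m)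
      exact aestronglyMeasurable_of_tendsto_ae atTop
        (fun k => (s k).1.1.aestronglyMeasurable_restrict (hsub m))
        (ae_restrict_of_forall_mem measurableSet_Icc fun z hz => (hs 0).2.2 z hz)
    rwa [← hU] at h1
  · have h1 : ∀ᵐ x ∂w.base.restrict (⋃ m : ℕ, Icc (τ (-m)) (τ m)),
        w.act (Y .zero) x = (0 : ℝ → Cn n) x := by
      rw [ae_restrict_iUnion_iff]
      exact fun m => hY.act_ae_eq_zero (H.mem _) (H.mem _) (hsub m)
    rwa [← hU] at h1

/-- The converse of `linearCombination_sideData_of_mem_L0`, and the only place where solutions are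
produced: y is a uniform limit on compact intervals of elements of small norm, so it consists of the
value and one-sided limits of a function in 𝓛₀. -/
theorem exists_mem_L0_of_annihilates {τ : ℤ → ℝ} (H : IsAdmissible J q τ)
    {y : DataIndex n I → ℂ}
    (hy : ∀ φ ∈ boundedFunctionals J q w, Finsupp.linearCombination ℂ y φ = 0) :
    ∃ h ∈ L0 J q w, sideData I h = y := by
  have hY : IsNullLimit J q w (ofData y) := fun c d hcd ε hε =>
    exists_uniform_approx H.isUnit H.isOpen hy hcd hε
  refine ⟨_, hY.mem_L0 H, funext fun j => ?_⟩
  rw [sideData, hY.sideVal_eq H.isOpen j.1.2, ofData_apply y _ j.1.2]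

end Limit

/-! ### The conditions as functionals, and the direct sum decomposition -/

section Conditions

variable {n : ℕ} {I : Set ℝ} {J : Matrix (Fin n) (Fin n) ℂ} {q : MatrixMeasure n I}
  {w : PosMatrixMeasure n I} {τ : ℤ → ℝ} {u v h : ℝ → Cn n}

theorem valueAt_add (hτ : ∀ k, τ k ∈ I) (hu : IsBVlocSharp I u) (hv : IsBVlocSharp I v) (k : ℤ) :
    valueAt τ k (u + v) = valueAt τ k u + valueAt τ k v := by
  simp only [valueAt_eq_sideVal]
  exact (hu.2 _ (hτ k)).sideVal_add (hv.2 _ (hτ k)) _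

theorem valueAt_sub (hτ : ∀ k, τ k ∈ I) (hu : IsBVlocSharp I u) (hv : IsBVlocSharp I v) (k : ℤ) :
    valueAt τ k (u - v) = valueAt τ k u - valueAt τ k v := by
  simp only [valueAt_eq_sideVal]
  exact (hu.2 _ (hτ k)).sideVal_sub (hv.2 _ (hτ k)) _

theorem valueAt_smul (hτ : ∀ k, τ k ∈ I) (hu : IsBVlocSharp I u) (c : ℂ) (k : ℤ) :
    valueAt τ k (c • u) = c • valueAt τ k u := by
  simp only [valueAt_eq_sideVal]
  exact (hu.2 _ (hτ k)).sideVal_smul c _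

theorem Condition.add (hτ : ∀ k, τ k ∈ I) (hu : IsBVlocSharp I u) (hv : IsBVlocSharp I v) {k : ℤ}
    (h1 : Condition J q w τ k u) (h2 : Condition J q w τ k v) : Condition J q w τ k (u + v) :=
  fun y hy => by rw [valueAt_add hτ hu hv, inner_add_right, h1 y hy, h2 y hy, add_zero]

theorem Condition.sub (hτ : ∀ k, τ k ∈ I) (hu : IsBVlocSharp I u) (hv : IsBVlocSharp I v) {k : ℤ}
    (h1 : Condition J q w τ k u) (h2 : Condition J q w τ k v) : Condition J q w τ k (u - v) :=
  fun y hy => by rw [valueAt_sub hτ hu hv, inner_sub_right, h1 y hy, h2 y hy, sub_zero]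

theorem Condition.smul (hτ : ∀ k, τ k ∈ I) (hu : IsBVlocSharp I u) (c : ℂ) {k : ℤ}
    (h1 : Condition J q w τ k u) : Condition J q w τ k (c • u) :=
  fun y hy => by rw [valueAt_smul hτ hu, inner_smul_right, h1 y hy, mul_zero]

theorem N_zero (τ : ℤ → ℝ) (k : ℤ) : (0 : Cn n) ∈ N J q w τ k :=
  ⟨0, L0_zero, fun _ _ _ _ => rfl, fun _ _ _ _ => rfl, by
    rw [valueAt_eq_sideVal, sideVal_zero]⟩

theorem N_add (hI : I.OrdConnected) (hτ : ∀ k, τ k ∈ I) {k : ℤ} {y z : Cn n}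
    (hy : y ∈ N J q w τ k) (hz : z ∈ N J q w τ k) : y + z ∈ N J q w τ k := by
  obtain ⟨g, hg, h1, h2, rfl⟩ := hy
  obtain ⟨g', hg', h1', h2', rfl⟩ := hz
  refine ⟨g + g', L0_add hI hg hg', fun hk x hx hxk => ?_, fun hk x hx hxk => ?_,
    valueAt_add hτ hg.1 hg'.1 k⟩
  · rw [Pi.add_apply, h1 hk x hx hxk, h1' hk x hx hxk, add_zero]
  · rw [Pi.add_apply, h2 hk x hx hxk, h2' hk x hx hxk, add_zero]

theorem N_smul (hI : I.OrdConnected) (hτ : ∀ k, τ k ∈ I) {k : ℤ} (c : ℂ) {y : Cn n}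
    (hy : y ∈ N J q w τ k) : c • y ∈ N J q w τ k := by
  obtain ⟨g, hg, h1, h2, rfl⟩ := hy
  refine ⟨c • g, L0_smul hI c hg, fun hk x hx hxk => ?_, fun hk x hx hxk => ?_,
    valueAt_smul hτ hg.1 c k⟩
  · rw [Pi.smul_apply, h1 hk x hx hxk, smul_zero]
  · rw [Pi.smul_apply, h2 hk x hx hxk, smul_zero]

/-- The functional `u ↦ ⟨z, u(τ_k)⟩`, with `u(τ_k)` in the sense of `valueAt`. -/
noncomputable def evalFunctional (hτ : ∀ k, τ k ∈ I) (k : ℤ) (z : Cn n) : DataIndex n I →₀ ℂ :=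
  ∑ i, Finsupp.single (⟨τ k, hτ k⟩, SignType.sign k, i) (starRingEnd ℂ (z i))

theorem linearCombination_evalFunctional (hτ : ∀ k, τ k ∈ I) (k : ℤ) (z : Cn n) (u : ℝ → Cn n) :
    Finsupp.linearCombination ℂ (sideData I u) (evalFunctional hτ k z)
      = inner ℂ z (valueAt τ k u) := by
  rw [evalFunctional, map_sum, PiLp.inner_apply]
  refine Finset.sum_congr rfl fun i _ => ?_
  rw [Finsupp.linearCombination_single, RCLike.inner_apply, valueAt_eq_sideVal, smul_eq_mul,
    mul_comm]
  rfl

theorem evalFunctional_add (hτ : ∀ k, τ k ∈ I) (k : ℤ) (y z : Cn n) :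
    evalFunctional hτ k (y + z) = evalFunctional hτ k y + evalFunctional hτ k z := by
  simp [evalFunctional, Finset.sum_add_distrib]

theorem evalFunctional_smul (hτ : ∀ k, τ k ∈ I) (k : ℤ) (c : ℂ) (z : Cn n) :
    evalFunctional hτ k (c • z) = starRingEnd ℂ c • evalFunctional hτ k z := by
  simp [evalFunctional, Finset.smul_sum]

theorem evalFunctional_zero (hτ : ∀ k, τ k ∈ I) (k : ℤ) :
    evalFunctional hτ k (0 : Cn n) = 0 := by
  simp [evalFunctional]

variable (w) in
/-- The span of the functionals which the conditions require to vanish. -/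
noncomputable def conditionFunctionals (H : IsAdmissible J q τ) :
    Submodule ℂ (DataIndex n I →₀ ℂ) where
  carrier := {φ | ∃ z : ℤ →₀ Cn n, (∀ k, z k ∈ N J q w τ k) ∧ φ = z.sum (evalFunctional H.mem)}
  add_mem' := by
    rintro _ _ ⟨z, hz, rfl⟩ ⟨z', hz', rfl⟩
    exact ⟨z + z', fun k => N_add H.ordConnected H.mem (hz k) (hz' k),
      (Finsupp.sum_add_index' (evalFunctional_zero _) (evalFunctional_add _)).symm⟩
  zero_mem' := ⟨0, fun k => N_zero τ k, by simp⟩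
  smul_mem' := by
    rintro c _ ⟨z, hz, rfl⟩
    -- The functional depends conjugate-linearly on z.
    refine ⟨starRingEnd ℂ c • z, fun k => N_smul H.ordConnected H.mem _ (hz k), ?_⟩
    rw [Finsupp.sum_smul_index' (evalFunctional_zero _), Finsupp.smul_sum]
    refine Finsupp.sum_congr fun k _ => ?_
    rw [evalFunctional_smul, Complex.conj_conj]

theorem evalFunctional_mem (H : IsAdmissible J q τ) {k : ℤ} {z : Cn n} (hz : z ∈ N J q w τ k) :
    evalFunctional H.mem k z ∈ conditionFunctionals w H := by
  classical
  refine ⟨Finsupp.single k z, fun j => ?_, ?_⟩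
  · rw [Finsupp.single_apply]
    split_ifs with hj
    · exact hj ▸ hz
    · exact N_zero τ j
  · rw [Finsupp.sum_single_index (evalFunctional_zero _ _)]

theorem linearCombination_eq_zero_of_condition (H : IsAdmissible J q τ) {φ : DataIndex n I →₀ ℂ}
    (hφ : φ ∈ conditionFunctionals w H) (hu : ∀ k, Condition J q w τ k u) :
    Finsupp.linearCombination ℂ (sideData I u) φ = 0 := by
  obtain ⟨z, hz, rfl⟩ := hφ
  rw [Finsupp.sum, map_sum]
  refine Finset.sum_eq_zero fun k _ => ?_
  rw [linearCombination_evalFunctional, hu k _ (hz k)]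

theorem valueAt_eq_zero_of_lt (H : IsAdmissible J q τ) {j k : ℤ} (hjk : j < k)
    (h0 : ∀ x ∈ I, x < τ k → h x = 0) : valueAt τ j h = 0 := by
  rw [valueAt_eq_sideVal, sideVal_congr_nhds (v := 0) _ _ (IsBalancedAt.zero _), sideVal_zero]
  filter_upwards [H.isOpen.mem_nhds (H.mem j), Iio_mem_nhds (H.strictMono hjk)] with x hx hx'
  exact h0 x hx hx'

theorem valueAt_eq_zero_of_gt (H : IsAdmissible J q τ) {j k : ℤ} (hjk : k < j)
    (h0 : ∀ x ∈ I, τ k < x → h x = 0) : valueAt τ j h = 0 := by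
  rw [valueAt_eq_sideVal, sideVal_congr_nhds (v := 0) _ _ (IsBalancedAt.zero _), sideVal_zero]
  filter_upwards [H.isOpen.mem_nhds (H.mem j), Ioi_mem_nhds (H.strictMono hjk)] with x hx hx'
  exact h0 x hx hx'

/-- In a combination of conditions take a nonzero term z_k with |k| maximal and an element g of 𝓛₀
defining z_k ∈ N_k. The support of g lies outwards of τ_k (no restriction if k = 0), so no other
term sees g and the combination takes the value |z_k|² on it. A bounded functional must give zero.
-/
theorem disjoint_functionals (H : IsAdmissible J q τ) :
    Disjoint (boundedFunctionals J q w) (conditionFunctionals w H) := by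
  rw [Submodule.disjoint_def]
  rintro φ hφ ⟨z, hz, rfl⟩
  by_cases hz0 : z = 0
  · rw [hz0, Finsupp.sum_zero_index]
  exfalso
  obtain ⟨k, hk, hmax⟩ := z.support.exists_max_image (fun k => |k|)
    (Finsupp.support_nonempty_iff.2 hz0)
  obtain ⟨g, hg, hpos, hneg, hval⟩ := hz k
  have h1 := linearCombination_sideData_of_mem_L0 hg hφ
  rw [Finsupp.sum, map_sum, Finset.sum_eq_single_of_mem k hk] at h1
  · rw [linearCombination_evalFunctional, hval] at h1
    exact Finsupp.mem_support_iff.1 hk (inner_self_eq_zero.1 h1)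
  · intro j hj hjk
    rw [linearCombination_evalFunctional]
    have h2 := hmax j hj
    have h3 : valueAt τ j g = 0 := by
      rcases lt_trichotomy k 0 with hk0 | rfl | hk0
      · rw [abs_of_neg hk0] at h2
        exact valueAt_eq_zero_of_gt H (by have := neg_le_abs j; omega) (hneg hk0)
      · rw [abs_zero] at h2
        exact absurd (abs_eq_zero.1 (le_antisymm h2 (abs_nonneg _))) hjk
      · rw [abs_of_pos hk0] at h2
        exact valueAt_eq_zero_of_lt H (by have := le_abs_self j; omega) (hpos hk0)
    rw [h3, inner_zero_right]

theorem sideData_eq_zero (hI : IsOpen I) (h0 : ∀ x ∈ I, h x = 0) : sideData I h = 0 := by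
  funext j
  rw [sideData, sideVal_congr_nhds (v := 0) _ _ (IsBalancedAt.zero _), sideVal_zero]
  · rfl
  · filter_upwards [hI.mem_nhds j.1.2] with x hx using h0 x hx

theorem eq_linearCombination {ι : Type*} (f : (ι →₀ ℂ) →ₗ[ℂ] ℂ) (φ : ι →₀ ℂ) :
    f φ = Finsupp.linearCombination ℂ (fun j => f (Finsupp.single j 1)) φ := by
  refine LinearMap.congr_fun (Finsupp.lhom_ext fun j c => ?_) φ
  rw [Finsupp.linearCombination_single, ← map_smul, Finsupp.smul_single, smul_eq_mul, mul_one]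

theorem condition_of_annihilates (H : IsAdmissible J q τ)
    (h0 : ∀ φ ∈ conditionFunctionals w H, Finsupp.linearCombination ℂ (sideData I u) φ = 0)
    (k : ℤ) : Condition J q w τ k u := fun y hy => by
  rw [← linearCombination_evalFunctional H.mem]
  exact h0 _ (evalFunctional_mem H hy)

/-- Otherwise a nonzero linear form kills both subspaces. Killing the bounded functionals makes it
evaluation at some h ∈ 𝓛₀; killing the condition functionals makes h satisfy all conditions, so h =
0 and the form is zero. -/
theorem codisjoint_functionals (H : IsAdmissible J q τ) :
    Codisjoint (boundedFunctionals J q w) (conditionFunctionals w H) := by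
  rw [codisjoint_iff]
  by_contra hne
  obtain ⟨f, hf, hker⟩ := Submodule.exists_le_ker_of_lt_top
    (boundedFunctionals J q w ⊔ conditionFunctionals w H) (lt_top_iff_ne_top.2 hne)
  obtain ⟨h, hh, hdata⟩ := exists_mem_L0_of_annihilates H
    (y := fun j => f (Finsupp.single j 1)) fun φ hφ => by
      rw [← eq_linearCombination]
      exact hker (Submodule.mem_sup_left hφ)
  have hc : ∀ k, Condition J q w τ k h := condition_of_annihilates H fun φ hφ => by
    rw [hdata, ← eq_linearCombination]
    exact hker (Submodule.mem_sup_right hφ)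
  have h1 := sideData_eq_zero H.isOpen (eq_zero_of_forall_condition H hh hc)
  refine hf (LinearMap.ext fun φ => ?_)
  rw [eq_linearCombination, ← hdata, h1]
  simp

theorem isCompl_functionals (H : IsAdmissible J q τ) :
    IsCompl (boundedFunctionals J q w) (conditionFunctionals w H) :=
  ⟨disjoint_functionals H, codisjoint_functionals H⟩

/-- Every element of the maximal relation satisfies all conditions after subtraction of a
suitable solution of norm zero. -/
theorem exists_sub_condition (H : IsAdmissible J q τ) (t : calTmax J q w) :
    ∃ h ∈ L0 J q w, ∀ k, Condition J q w τ k (t.1.1.toFun - h) := by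
  let B : (DataIndex n I →₀ ℂ) →ₗ[ℂ] ℂ := Finsupp.linearCombination ℂ (sideData I t.1.1.toFun)
  -- The data of the sought h are prescribed by the decomposition: zero on bounded functionals, as
  -- membership in 𝓛₀ demands, and those of t on the condition functionals.
  let f : (DataIndex n I →₀ ℂ) →ₗ[ℂ] ℂ :=
    LinearMap.ofIsCompl (isCompl_functionals (w := w) H) 0 (B ∘ₗ (conditionFunctionals w H).subtype)
  obtain ⟨h, hh, hdata⟩ := exists_mem_L0_of_annihilates H
    (y := fun j => f (Finsupp.single j 1)) fun φ hφ => by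
      rw [← eq_linearCombination]
      exact LinearMap.ofIsCompl_apply_left _ ⟨φ, hφ⟩
  refine ⟨h, hh, fun k y hy => ?_⟩
  rw [valueAt_sub H.mem t.2.1 hh.1, inner_sub_right, ← linearCombination_evalFunctional H.mem,
    ← linearCombination_evalFunctional H.mem, hdata, ← eq_linearCombination, sub_eq_zero]
  have h1 : f (evalFunctional H.mem k y) = B (evalFunctional H.mem k y) :=
    LinearMap.ofIsCompl_apply_right (isCompl_functionals (w := w) H)
      ⟨evalFunctional H.mem k y, evalFunctional_mem H hy⟩
  exact h1.symm

/-- Each scalar datum is bounded on the elements of the maximal relation which satisfy all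
conditions. -/
theorem exists_data_bound (H : IsAdmissible J q τ) (w : PosMatrixMeasure n I)
    (j : DataIndex n I) : ∃ C : ℝ, 0 ≤ C ∧ ∀ t : calTmax J q w,
      (∀ k, Condition J q w τ k t.1.1.toFun) → ‖sideData I t.1.1.toFun j‖ ≤ C * ‖t‖ := by
  have h1 : Finsupp.single j 1 ∈ boundedFunctionals J q w ⊔ conditionFunctionals w H := by
    rw [codisjoint_iff.1 (codisjoint_functionals H)]
    exact Submodule.mem_top
  -- Evaluation of the datum j is φ + ψ, and ψ vanishes as soon as all conditions hold, leaving only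
  -- the bounded φ.
  obtain ⟨φ, ⟨C, hC⟩, ψ, hψ, hsum⟩ := Submodule.mem_sup.1 h1
  refine ⟨max C 0, le_max_right _ _, fun t ht => ?_⟩
  have h2 : sideData I t.1.1.toFun j = Finsupp.linearCombination ℂ (sideData I t.1.1.toFun) φ := by
    have h3 := congrArg (Finsupp.linearCombination ℂ (sideData I t.1.1.toFun)) hsum
    rw [map_add, linearCombination_eq_zero_of_condition H hψ ht, add_zero,
      Finsupp.linearCombination_single, one_smul] at h3
    exact h3.symm
  rw [h2]
  exact (hC t).trans (mul_le_mul_of_nonneg_right (le_max_left _ _) (norm_nonneg _))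

/-- The elements of the maximal relation which satisfy all conditions are bounded in the norm of
functions of bounded variation, on every compact interval. -/
theorem exists_bound (H : IsAdmissible J q τ) (w : PosMatrixMeasure n I) {c d : ℝ} (hc : c ∈ I)
    (hd : d ∈ I) : ∃ C : ℝ, 0 ≤ C ∧ ∀ t : calTmax J q w,
      (∀ k, Condition J q w τ k t.1.1.toFun) →
        (∀ z ∈ Icc c d, ‖t.1.1.toFun z‖ ≤ C * ‖t‖) ∧
        eVariationOn t.1.1.toFun (Icc c d) ≤ ENNReal.ofReal (C * ‖t‖) := by
  classical
  have hcd := H.ordConnected.out hc hd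
  obtain ⟨P, hP, C₁, hC₁, hb⟩ := exists_sideVal_le q w H.isUnit H.isOpen hcd
  obtain ⟨C₂, hC₂, hv⟩ := exists_eVariationOn_le (J := J) q w H.isUnit H.isOpen hc hd hcd
  choose K hK0 hK using exists_data_bound H w
  -- The compact bound needs only the data over the finite set P, so finitely many of the constants
  -- K are added up.
  set S : ℝ := ∑ x ∈ P.attach, ∑ ρ : SignType, ∑ i, K (⟨x.1, hP x.1 x.2⟩, ρ, i) with hS
  have hS0 : 0 ≤ S := Finset.sum_nonneg fun _ _ => Finset.sum_nonneg fun _ _ =>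
    Finset.sum_nonneg fun _ _ => hK0 _
  have hsup : ∀ t : calTmax J q w, (∀ k, Condition J q w τ k t.1.1.toFun) →
      ∀ z ∈ Icc c d, ‖t.1.1.toFun z‖ ≤ C₁ * (S + 1) * ‖t‖ := by
    intro t ht z hz
    refine (hb _ t.2 z hz .zero).trans ?_
    rw [mul_assoc]
    refine mul_le_mul_of_nonneg_left ?_ hC₁
    rw [add_mul, one_mul]
    refine add_le_add ?_ (norm_coe_snd_le t)
    rw [← Finset.sum_attach, hS, Finset.sum_mul]
    refine Finset.sum_le_sum fun x _ => ?_
    rw [Finset.sum_mul]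
    refine Finset.sum_le_sum fun ρ _ => ?_
    rw [Finset.sum_mul]
    exact (norm_le_sum_norm _).trans (Finset.sum_le_sum fun i _ =>
      hK (⟨x.1, hP x.1 x.2⟩, ρ, i) t ht)
  have hC0 : 0 ≤ C₁ * (S + 1) := by positivity
  refine ⟨C₁ * (S + 1) + C₂ * (C₁ * (S + 1) + 1), by positivity, fun t ht => ⟨fun z hz => ?_, ?_⟩⟩
  · refine (hsup t ht z hz).trans (mul_le_mul_of_nonneg_right ?_ (norm_nonneg t))
    have : 0 ≤ C₂ * (C₁ * (S + 1) + 1) := by positivity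
    linarith
  · refine (hv _ t.2 (C₁ * (S + 1) * ‖t‖) (by positivity) (hsup t ht)).trans
      (ENNReal.ofReal_le_ofReal ?_)
    have h1 := mul_le_mul_of_nonneg_left (norm_coe_snd_le t) hC₂
    have h2 : 0 ≤ C₁ * (S + 1) * ‖t‖ := by positivity
    nlinarith

end Conditions

/-! ### The operator `E` -/

section Operator

variable {n : ℕ} {I : Set ℝ} {J : Matrix (Fin n) (Fin n) ℂ} {q : MatrixMeasure n I}
  {w : PosMatrixMeasure n I} {τ : ℤ → ℝ} {v v' : ℝ → Cn n}

theorem cls_eq_cls_iff {f g : CalL2 w} : cls f = cls g ↔ ‖f - g‖ = 0 := by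
  rw [cls, cls, SeparationQuotient.mk_eq_mk, Metric.inseparable_iff, dist_eq_norm]

/-- Subtracting an element of 𝓛₀ changes neither the class of u nor that of f. -/
theorem exists_isDistinguished (H : IsAdmissible J q τ) (p : Tmax J q w) :
    ∃ v, IsDistinguished τ p v := by
  obtain ⟨t, ht, h1, h2⟩ := p.2
  obtain ⟨h, hh, hc⟩ := exists_sub_condition H ⟨t, ht⟩
  refine ⟨_, ⟨t - nullPair hh, sub_mem ht (nullPair_mem hh), ?_, ?_, rfl⟩, hc⟩
  · rw [← h1, cls_eq_cls_iff]
    have h3 : ‖(nullPair hh).1‖ = 0 := hh.2.2.2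
    rw [Prod.fst_sub, sub_sub_cancel_left, norm_neg, h3]
  · rw [← h2, cls_eq_cls_iff, Prod.snd_sub, sub_sub_cancel_left, norm_neg]
    exact norm_zero

/-- The difference of two representatives lies in 𝓛₀ and still satisfies every condition, so it
vanishes on I. -/
theorem IsDistinguished.eqOn (H : IsAdmissible J q τ) {p : Tmax J q w}
    (hv : IsDistinguished τ p v) (hv' : IsDistinguished τ p v') : EqOn v' v I := by
  obtain ⟨⟨t, ht, h1, h2, rfl⟩, hc⟩ := hv
  obtain ⟨⟨t', ht', h1', h2', rfl⟩, hc'⟩ := hv'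
  have h3 : t'.1.toFun - t.1.toFun ∈ L0 J q w :=
    mem_L0_of_norm_eq_zero (t := t' - t) H.ordConnected (sub_mem ht' ht)
      (cls_eq_cls_iff.1 (h1'.trans h1.symm)) (cls_eq_cls_iff.1 (h2'.trans h2.symm))
  intro x hx
  exact sub_eq_zero.1 (eq_zero_of_forall_condition H h3
    (fun k => (hc' k).sub H.mem ht'.1 ht.1 (hc k)) x hx)

theorem IsDistinguished.add (H : IsAdmissible J q τ) {p p' : Tmax J q w}
    (hv : IsDistinguished τ p v) (hv' : IsDistinguished τ p' v') :
    IsDistinguished τ (p + p') (v + v') := by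
  obtain ⟨⟨t, ht, h1, h2, rfl⟩, hc⟩ := hv
  obtain ⟨⟨t', ht', h1', h2', rfl⟩, hc'⟩ := hv'
  refine ⟨⟨t + t', add_mem ht ht', ?_, ?_, rfl⟩, fun k => (hc k).add H.mem ht.1 ht'.1 (hc' k)⟩
  · rw [Submodule.coe_add, WithLp.add_fst, ← h1, ← h1']
    rfl
  · rw [Submodule.coe_add, WithLp.add_snd, ← h2, ← h2']
    rfl

theorem IsDistinguished.smul (H : IsAdmissible J q τ) {p : Tmax J q w} (c : ℂ)
    (hv : IsDistinguished τ p v) : IsDistinguished τ (c • p) (c • v) := by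
  obtain ⟨⟨t, ht, h1, h2, rfl⟩, hc⟩ := hv
  refine ⟨⟨c • t, Submodule.smul_mem _ c ht, ?_, ?_, rfl⟩, fun k => (hc k).smul H.mem ht.1 c⟩
  · rw [Submodule.coe_smul, WithLp.smul_fst, ← h1]
    rfl
  · rw [Submodule.coe_smul, WithLp.smul_snd, ← h2]
    rfl

theorem IsBalancedAt.comp_val {c d : ℝ} {x : Ioo c d} (h : IsBalancedAt v x) :
    IsBalancedAt (fun y : Ioo c d => v y) x := by
  obtain ⟨l, r, h1, h2, h3⟩ := h
  have hc : Tendsto (Subtype.val : Ioo c d → ℝ) (𝓝 x) (𝓝 x) := continuous_subtype_val.tendsto x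
  exact ⟨l, r, h1.comp (hc.inf (tendsto_principal_principal.2 fun y hy => hy)),
    h2.comp (hc.inf (tendsto_principal_principal.2 fun y hy => hy)), h3⟩

theorem eVariationOn_comp_val_le {c d : ℝ} (v : ℝ → Cn n) :
    eVariationOn (fun y : Ioo c d => v y) univ ≤ eVariationOn v (Icc c d) :=
  eVariationOn.comp_le_of_monotoneOn v Subtype.val (fun _ _ _ _ h => h)
    fun y _ => ⟨y.2.1.le, y.2.2.le⟩

/-- A function that is balanced and of locally bounded variation on `I`, restricted to an interval
which is relatively compact in `I`. -/
noncomputable def BVSharp.ofLoc {c d : ℝ} (x₀ : Ioo c d) (hc : c ∈ I) (hd : d ∈ I)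
    (hcd : Icc c d ⊆ I) (hv : IsBVlocSharp I v) : BVSharp n c d x₀ :=
  ⟨fun y => v y, ne_top_of_le_ne_top (hv.1 c d hc hd) ((eVariationOn_comp_val_le v).trans
    (eVariationOn.mono _ fun _ hx => ⟨hcd hx, hx⟩)),
    fun y => (hv.2 y (hcd ⟨y.2.1.le, y.2.2.le⟩)).comp_val⟩

theorem IsDistinguished.isBVlocSharp {p : Tmax J q w} (hv : IsDistinguished τ p v) :
    IsBVlocSharp I v := by
  obtain ⟨⟨t, ht, -, -, rfl⟩, -⟩ := hv
  exact ht.1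

/-- Representatives are chosen arbitrarily; uniqueness on I makes the choice linear, because sums
and multiples of distinguished representatives are distinguished. -/
theorem exists_operator (H : IsAdmissible J q τ) (w : PosMatrixMeasure n I) {c d : ℝ}
    (x₀ : Ioo c d) (hc : c ∈ I) (hd : d ∈ I) :
    ∃ E : Tmax J q w →L[ℂ] BVSharp n c d x₀, ∀ p, ∃ v : ℝ → Cn n, IsDistinguished τ p v ∧
      (∀ v', IsDistinguished τ p v' → EqOn v' v I) ∧ ∀ x, (E p).toFun x = v x := by
  have hcd := H.ordConnected.out hc hd
  have hmem : ∀ y : Ioo c d, (y : ℝ) ∈ Icc c d := fun y => ⟨y.2.1.le, y.2.2.le⟩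
  choose V hV using exists_isDistinguished (w := w) H
  let L : Tmax J q w →ₗ[ℂ] BVSharp n c d x₀ :=
    { toFun := fun p => BVSharp.ofLoc x₀ hc hd hcd (hV p).isBVlocSharp
      map_add' := fun p p' => Subtype.ext (funext fun y =>
        ((hV p).add H (hV p')).eqOn H (hV (p + p')) (hcd (hmem y)))
      map_smul' := fun k p => Subtype.ext (funext fun y =>
        ((hV p).smul H k).eqOn H (hV (k • p)) (hcd (hmem y))) }
  obtain ⟨C, hC0, hC⟩ := exists_bound H w hc hd
  -- One C for the variation, one for the value at the base point.
  have hbound : ∀ p, ‖L p‖ ≤ 2 * C * ‖p‖ := by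
    intro p
    change (eVariationOn (fun y : Ioo c d => V p y) univ).toReal + ‖V p x₀‖ ≤ _
    obtain ⟨⟨t, ht, h1, h2, hv⟩, hcond⟩ := hV p
    rw [← hv] at hcond ⊢
    obtain ⟨hs, hvar⟩ := hC ⟨t, ht⟩ hcond
    -- `calTmax` carries the maximum of the two seminorms, which is at most the Hilbert norm of the
    -- pair of classes.
    have hnorm : ‖(⟨t, ht⟩ : calTmax J q w)‖ ≤ ‖p‖ := by
      change max ‖t.1‖ ‖t.2‖ ≤ ‖p.1‖
      refine max_le ?_ ?_
      · rw [← SeparationQuotient.norm_mk t.1]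
        change ‖cls t.1‖ ≤ _
        rw [h1]
        exact WithLp.norm_fst_le (x := p.1)
      · rw [← SeparationQuotient.norm_mk t.2]
        change ‖cls t.2‖ ≤ _
        rw [h2]
        exact WithLp.norm_snd_le (x := p.1)
    have h3 := ENNReal.toReal_le_of_le_ofReal (by positivity)
      ((eVariationOn_comp_val_le (c := c) (d := d) t.1.toFun).trans hvar)
    have h4 := hs x₀ (hmem x₀)
    have h5 := mul_le_mul_of_nonneg_left hnorm hC0
    change _ ≤ C * ‖(⟨t, ht⟩ : calTmax J q w)‖ at h4
    linarith
  exact ⟨L.mkContinuous _ hbound, fun p => ⟨V p, hV p, fun v' hv' => (hV p).eqOn H hv',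
    fun _ => rfl⟩⟩

end Operator

/-! ### From the functions Q and τ to the abstract hypotheses -/

section Generated

variable {n : ℕ} {I : Set ℝ}

theorem isOpen_interval (a b : EReal) : IsOpen (interval a b) :=
  (isOpen_lt continuous_const continuous_coe_real_ereal).inter
    (isOpen_lt continuous_coe_real_ereal continuous_const)

theorem ordConnected_interval (a b : EReal) : (interval a b).OrdConnected :=
  ⟨fun _ hx _ hy _ hz => ⟨hx.1.trans_le (EReal.coe_le_coe_iff.2 hz.1),
    (EReal.coe_le_coe_iff.2 hz.2).trans_lt hy.2⟩⟩

theorem exists_tendsto_left_of_locallyBoundedVariationOn {g : ℝ → ℂ} (hI : IsOpen I)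
    (hg : LocallyBoundedVariationOn g I) {x : ℝ} (hx : x ∈ I) :
    ∃ l, Tendsto g (𝓝[<] x) (𝓝 l) := by
  obtain ⟨δ, hδ, hδI⟩ := Metric.nhds_basis_closedBall.mem_iff.1 (hI.mem_nhds hx)
  rw [Real.closedBall_eq_Icc] at hδI
  obtain ⟨l, hl⟩ := (hg (x - δ) (x + δ) (hδI ⟨le_rfl, by linarith⟩)
    (hδI ⟨by linarith, le_rfl⟩)).exists_tendsto_left x
  refine ⟨l, hl.mono_left ?_⟩
  refine nhdsWithin_le_iff.2 (inter_mem ?_ self_mem_nhdsWithin)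
  exact mem_nhdsWithin_of_mem_nhds (inter_mem (hI.mem_nhds hx)
    (Icc_mem_nhds (by linarith) (by linarith)))

theorem exists_tendsto_right_of_locallyBoundedVariationOn {g : ℝ → ℂ} (hI : IsOpen I)
    (hg : LocallyBoundedVariationOn g I) {x : ℝ} (hx : x ∈ I) :
    ∃ l, Tendsto g (𝓝[>] x) (𝓝 l) := by
  obtain ⟨δ, hδ, hδI⟩ := Metric.nhds_basis_closedBall.mem_iff.1 (hI.mem_nhds hx)
  rw [Real.closedBall_eq_Icc] at hδI
  obtain ⟨l, hl⟩ := (hg (x - δ) (x + δ) (hδI ⟨le_rfl, by linarith⟩)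
    (hδI ⟨by linarith, le_rfl⟩)).exists_tendsto_right x
  refine ⟨l, hl.mono_left ?_⟩
  refine nhdsWithin_le_iff.2 (inter_mem ?_ self_mem_nhdsWithin)
  exact mem_nhdsWithin_of_mem_nhds (inter_mem (hI.mem_nhds hx)
    (Icc_mem_nhds (by linarith) (by linarith)))

/-- The measure `dF` gives the mass `F⁺(x) - F⁻(x)` to `x`. -/
theorem MatrixMeasure.IsGeneratedBy.atom_eq_jump {M : MatrixMeasure n I}
    {F : ℝ → Matrix (Fin n) (Fin n) ℂ} (hM : M.IsGeneratedBy F) (hI : IsOpen I)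
    (hF : IsBVlocM I F) {x : ℝ} (hx : x ∈ I) : M.atom x = jump F x := by
  ext i j
  obtain ⟨d, hd, hxd⟩ := (mem_nhdsGE_iff_exists_Icc_subset (a := x)).1
    (mem_nhdsWithin_of_mem_nhds (hI.mem_nhds hx))
  have hdI : d ∈ I := hxd ⟨le_of_lt hd, le_rfl⟩
  obtain ⟨s, hs, hsd, hsx⟩ := exists_seq_strictAnti_tendsto' (show x < d from hd)
  have hsI : ∀ k, s k ∈ I := fun k => hxd ⟨(hsd k).1.le, (hsd k).2.le⟩
  have h1 := tendsto_setIntegral_Ico (M.integrableOn_density x hx d hdI i j) hs hsd hsx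
  have h2 : Tendsto (Function.leftLim fun y => F y i j) (𝓝[>] x)
      (𝓝 (Function.rightLim (fun y => F y i j) x)) := by
    refine tendsto_leftLim_nhdsGT (tendsto_rightLim_of_tendsto
      (exists_tendsto_right_of_locallyBoundedVariationOn hI (hF i j) hx)) ?_
    filter_upwards [mem_nhdsWithin_of_mem_nhds (hI.mem_nhds hx)] with y hy
    exact exists_tendsto_left_of_locallyBoundedVariationOn hI (hF i j) hy
  have h3 : Tendsto s atTop (𝓝[>] x) :=
    tendsto_nhdsWithin_iff.2 ⟨hsx, Eventually.of_forall fun k => (hsd k).1⟩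
  have h4 := (h2.comp h3).sub_const (Function.leftLim (fun y => F y i j) x)
  have h5 := tendsto_nhds_unique h4 (h1.congr fun k => (hM x hx (s k) (hsI k) (hsd k).1 i j).symm)
  rw [integral_singleton] at h5
  change _ = Function.rightLim (fun y => F y i j) x - Function.leftLim (fun y => F y i j) x
  rw [h5]
  simp [MatrixMeasure.atom]

/-- The atoms of `dF` are the jumps of `F`, unless no local measure is generated by `F`, in which
case `dF` is the zero measure by convention. -/
theorem atom_dMeasure (hI : IsOpen I) {F : ℝ → Matrix (Fin n) (Fin n) ℂ} (hF : IsBVlocM I F) :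
    (∀ x ∈ I, (dMeasure I F).atom x = jump F x) ∨ ∀ x, (dMeasure I F).atom x = 0 := by
  by_cases h : ∃ M : MatrixMeasure n I, M.IsGeneratedBy F
  · left
    rw [dMeasure, dif_pos h]
    exact fun x hx => h.choose_spec.atom_eq_jump hI hF hx
  · right
    rw [dMeasure, dif_neg h]
    intro x
    simp [MatrixMeasure.atom, PosMatrixMeasure.zero]

/-- The atoms of dQ are the jumps of Q, so the matrices B_± are those of the abstract setting. -/
theorem isAdmissible_dMeasure {a b : EReal} {J : Matrix (Fin n) (Fin n) ℂ} (hJ : IsUnit J)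
    {Q : ℝ → Matrix (Fin n) (Fin n) ℂ} (hQ : IsBVlocM (interval a b) Q) {τ : ℤ → ℝ}
    (hτ : StrictMono τ) (hτ_mem : ∀ k, τ k ∈ interval a b)
    (hτ_bot : Tendsto (fun k => (τ k : EReal)) atBot (𝓝 a))
    (hτ_top : Tendsto (fun k => (τ k : EReal)) atTop (𝓝 b))
    (hτ_bad : ∀ x ∈ interval a b, (Bmat J Q 1 x).det * (Bmat J Q (-1) x).det = 0 → ∃ k, τ k = x)
    (hτ_zero : Bmat J Q 1 (τ 0) = J) : IsAdmissible J (dMeasure (interval a b) Q) τ where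
  isUnit := hJ
  isOpen := isOpen_interval a b
  ordConnected := ordConnected_interval a b
  strictMono := hτ
  mem := hτ_mem
  exhaust x hx := by
    have h1 : Tendsto (fun m : ℕ => (τ (-m) : EReal)) atTop (𝓝 a) :=
      hτ_bot.comp (tendsto_neg_atTop_atBot.comp tendsto_natCast_atTop_atTop)
    have h2 : Tendsto (fun m : ℕ => (τ m : EReal)) atTop (𝓝 b) :=
      hτ_top.comp tendsto_natCast_atTop_atTop
    obtain ⟨m, hm1, hm2⟩ := ((h1.eventually_lt_const hx.1).and
      (h2.eventually_const_lt hx.2)).exists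
    exact ⟨m, EReal.coe_lt_coe_iff.1 hm1, EReal.coe_lt_coe_iff.1 hm2⟩
  good x hx hne := by
    rcases atom_dMeasure (isOpen_interval a b) hQ with h | h
    · rw [h x hx, ← mul_ne_zero_iff]
      intro h0
      obtain ⟨k, hk⟩ := hτ_bad x hx (by simpa [Bmat] using h0)
      exact hne k hk
    · have h1 := ((Matrix.isUnit_iff_isUnit_det J).1 hJ).ne_zero
      simpa [h x] using h1
  atom_zero := by
    rcases atom_dMeasure (isOpen_interval a b) hQ with h | h
    · rw [h _ (hτ_mem 0)]
      simpa [Bmat] using hτ_zero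
    · exact h _

end Generated

end BVSystem

theorem mainTheorem10 (n : ℕ) (a b : EReal)
    (J : Matrix (Fin n) (Fin n) ℂ) (hJ : IsUnit J) (hJ' : J.conjTranspose = -J)
    (Q W : ℝ → Matrix (Fin n) (Fin n) ℂ)
    (hQ : BVSystem.IsBVlocM (BVSystem.interval a b) Q)
    (hW : BVSystem.IsBVlocM (BVSystem.interval a b) W)
    (hQ' : BVSystem.HasHermitianDeriv (BVSystem.interval a b) Q)
    (hW' : BVSystem.HasNonnegDeriv (BVSystem.interval a b) W)
    (τ : ℤ → ℝ) (hτ : StrictMono τ) (hτ_mem : ∀ k, τ k ∈ BVSystem.interval a b)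
    (hτ_bot : Tendsto (fun k => (τ k : EReal)) atBot (𝓝 a))
    (hτ_top : Tendsto (fun k => (τ k : EReal)) atTop (𝓝 b))
    (hτ_bad : ∀ x ∈ BVSystem.interval a b,
      (BVSystem.Bmat J Q 1 x).det * (BVSystem.Bmat J Q (-1) x).det = 0 → ∃ k, τ k = x)
    (hτ_zero : BVSystem.Bmat J Q 1 (τ 0) = J ∧ BVSystem.Bmat J Q (-1) (τ 0) = J)
    (m : ℕ) (hm : 0 < m) :
    ∃ E : BVSystem.Tmax J (BVSystem.dMeasure (BVSystem.interval a b) Q)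
            (BVSystem.dMeasurePos (BVSystem.interval a b) W) →L[ℂ]
          BVSystem.BVSharp n (τ (-m)) (τ m) ⟨τ 0, hτ (by omega), hτ (by omega)⟩,
      ∀ p, ∃ v : ℝ → BVSystem.Cn n, BVSystem.IsDistinguished τ p v ∧
        (∀ v', BVSystem.IsDistinguished τ p v' → EqOn v' v (BVSystem.interval a b)) ∧
        ∀ x, (E p).toFun x = v x := by
  exact BVSystem.exists_operator (BVSystem.isAdmissible_dMeasure hJ hQ hτ hτ_mem hτ_bot hτ_top hτ_bad
    hτ_zero.1) _ _ (hτ_mem _) (hτ_mem _)
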